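/- Let $m,k\ge 0$ be integers and let $t\in\mathbb{R}$. For an almost-Hermitian manifold $(M,J,g)$ of real dimension $2m$ (that is, $M$ is a smooth manifold, $J$ a smooth almost complex structure and $g$ a smooth Riemannian metric with $g(J\cdot,J\cdot)=g$), let $D^g$ be the Levi-Civita connection, $\operatorname{Rm}(g)(X,Y)=D^g_{[X,Y]}-[D^g_X,D^g_Y]$, $\omega=g(J\cdot,\cdot)$, $d^c\omega(X,Y,Z)=d\omega(JX,JY,JZ)$, $N_J(X,Y)=[JX,JY]-[X,Y]-J([JX,Y]+[X,JY])$, and for a $3$-form $\varphi$ let $\varphi=\varphi^++\varphi^-$ be the splitting into the component $\varphi^+$ of type $(2,1)+(1,2)$ and the component $\varphi^-$ of type $(3,0)+(0,3)$. The $t$-Gauduchon connection $\nabla^t$ is defined by $$g(\nabla^t_XY,Z)=g(D^g_XY,Z)-\tfrac{t+1}{4}(d^c\omega)^+(X,JY,JZ)-\tfrac{t-1}{4}(d^c\omega)^+(X,Y,Z)-\tfrac14 g(X,N_J(Y,Z))-\tfrac12(d^c\omega)^-(X,Y,Z),$$ its curvature is $\Omega^t(X,Y)=\nabla^t_{[X,Y]}-[\nabla^t_X,\nabla^t_Y]$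 and its torsion is $T^t(X,Y)=\nabla^t_XY-\nabla^t_YX-[X,Y]$. Let $|\cdot|_g$ denote the tensor norm induced by $g$. (i) For every $K_1>0$ there is a constant $C_1=C_1(m,k,t,K_1)>0$ such that, for every almost-Hermitian manifold $(M,J,g)$ of real dimension $2m$ and every point $x\in M$: if $$\sum_{i=0}^{k}\big|((\nabla^t)^i\Omega^t)_x\big|_g+\sum_{j=0}^{k+1}\big|((\nabla^t)^jT^t)_x\big|_g<K_1,$$ then $$\sum_{i=0}^{k}\big|((D^g)^i\operatorname{Rm}(g))_x\big|_g+\sum_{j=1}^{k+2}\big|((D^g)^jJ)_x\big|_g<C_1.$$ (ii) For every $K_2>0$ there is a constant $C_2=C_2(m,k,t,K_2)>0$ such that, for every almost-Hermitian manifold $(M,J,g)$ of real dimension $2m$ and every point $x\in M$: if $$\sum_{i=0}^{k}\big|((D^g)^i\operatorname{Rm}(g))_x\big|_g+\sum_{j=1}^{k+2}\big|((D^g)^jJ)_x\big|_g<K_2,$$ then $$\sum_{i=0}^{k}\big|((\nabla^t)^i\Omega^t)_x\big|_g+\sum_{j=0}^{k+1}\big|((\nabla^t)^jT^t)_x\big|_g<C_2.$$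 -/

import Mathlib

open scoped Manifold ContDiff Bundle

noncomputable section

/-- An almost-Hermitian structure on a smooth manifold `M` of real dimension `2m`: a smooth
Riemannian metric `g` and a smooth almost complex structure `J` with `g(J·, J·) = g`. -/
structure AlmostHermitianStructure (m : ℕ) (M : Type*) [TopologicalSpace M]
    [ChartedSpace (EuclideanSpace ℝ (Fin (2 * m))) M] [IsManifold (𝓡 (2 * m)) ∞ M] where
  /-- the Riemannian metric -/
  g : Bundle.ContMDiffRiemannianMetric (𝓡 (2 * m)) ∞ (EuclideanSpace ℝ (Fin (2 * m)))
    (TangentSpace (𝓡 (2 * m)) : M → Type _)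
  /-- the almost complex structure -/
  J : ∀ x : M, TangentSpace (𝓡 (2 * m)) x →L[ℝ] TangentSpace (𝓡 (2 * m)) x
  contMDiff_J : ContMDiff (𝓡 (2 * m))
    ((𝓡 (2 * m)).prod
      𝓘(ℝ, EuclideanSpace ℝ (Fin (2 * m)) →L[ℝ] EuclideanSpace ℝ (Fin (2 * m)))) ∞
    (fun x : M ↦ Bundle.TotalSpace.mk'
      (EuclideanSpace ℝ (Fin (2 * m)) →L[ℝ] EuclideanSpace ℝ (Fin (2 * m)))
      (E := fun x : M ↦ TangentSpace (𝓡 (2 * m)) x →L[ℝ] TangentSpace (𝓡 (2 * m)) x)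
      x (J x))
  J_sq : ∀ (x : M) (v : TangentSpace (𝓡 (2 * m)) x), J x (J x v) = -v
  compat : ∀ (x : M) (v w : TangentSpace (𝓡 (2 * m)) x),
    g.inner x (J x v) (J x w) = g.inner x v w

namespace TensorCalculus

/-! ### Tensor calculus in coordinates

Tensor fields are given by their components in the coordinate frame `∂₁, …, ∂ₙ` over (an open
subset of) `ℝⁿ`. A field `S` of type `(r, 1)`, i.e. an `r`-linear map with values in the tangent
space, is written `S y I c`, the `c`-th component of `S(∂_{I 0}, …, ∂_{I (r-1)})` at `y`. A linear
connection is given by its symbols: `Γ y a b c` is the `c`-th component of `∇_{∂_a} ∂_b` at `y`. -/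

variable {n r : ℕ}

/-- The partial derivative `∂ᵢ f` at `y`. -/
def pd (i : Fin n) (f : EuclideanSpace ℝ (Fin n) → ℝ) (y : EuclideanSpace ℝ (Fin n)) : ℝ :=
  fderiv ℝ f y (EuclideanSpace.single i 1)

/-- The covariant derivative `∇S` of a tensor field of type `(r, 1)`,
`(∇S)(X₀, X₁, …, Xᵣ) = ∇_{X₀}(S(X₁, …, Xᵣ)) - ∑ₛ S(X₁, …, ∇_{X₀} Xₛ, …, Xᵣ)`. -/
def covDeriv (Γ : EuclideanSpace ℝ (Fin n) → Fin n → Fin n → Fin n → ℝ)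
    (S : EuclideanSpace ℝ (Fin n) → (Fin r → Fin n) → Fin n → ℝ) :
    EuclideanSpace ℝ (Fin n) → (Fin (r + 1) → Fin n) → Fin n → ℝ :=
  fun y I c ↦
    pd (I 0) (fun z ↦ S z (Fin.tail I) c) y
      + ∑ d, Γ y (I 0) d c * S y (Fin.tail I) d
      - ∑ s : Fin r, ∑ d, Γ y (I 0) (Fin.tail I s) d * S y (Function.update (Fin.tail I) s d) c

/-- The iterated covariant derivative `∇ⁱS`. -/
def iterCovDeriv (Γ : EuclideanSpace ℝ (Fin n) → Fin n → Fin n → Fin n → ℝ)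
    (S : EuclideanSpace ℝ (Fin n) → (Fin r → Fin n) → Fin n → ℝ) :
    (i : ℕ) → EuclideanSpace ℝ (Fin n) → (Fin (r + i) → Fin n) → Fin n → ℝ
  | 0 => S
  | i + 1 => covDeriv Γ (iterCovDeriv Γ S i)

/-- The norm `|S|_g` of a tensor of type `(r, 1)` with respect to the inner product with Gram
matrix `g`: all the indices are contracted using `g` and `g⁻¹`. -/
def tensorNorm (g : Matrix (Fin n) (Fin n) ℝ) (S : (Fin r → Fin n) → Fin n → ℝ) : ℝ :=
  Real.sqrt (∑ I : Fin r → Fin n, ∑ I' : Fin r → Fin n, ∑ c, ∑ c',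
    (∏ s, g⁻¹ (I s) (I' s)) * g c c' * S I c * S I' c')

/-- The curvature `Ω(X, Y)Z = ∇_{[X,Y]}Z - ∇_X ∇_Y Z + ∇_Y ∇_X Z` of a linear connection, as the
tensor field `(X, Y, Z) ↦ Ω(X, Y)Z` of type `(3, 1)`. -/
def curvature (Γ : EuclideanSpace ℝ (Fin n) → Fin n → Fin n → Fin n → ℝ) :
    EuclideanSpace ℝ (Fin n) → (Fin 3 → Fin n) → Fin n → ℝ :=
  fun y I c ↦
    -(pd (I 0) (fun z ↦ Γ z (I 1) (I 2) c) y + ∑ d, Γ y (I 1) (I 2) d * Γ y (I 0) d c)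
      + (pd (I 1) (fun z ↦ Γ z (I 0) (I 2) c) y + ∑ d, Γ y (I 0) (I 2) d * Γ y (I 1) d c)

/-- The torsion `T(X, Y) = ∇_X Y - ∇_Y X - [X, Y]` of a linear connection. -/
def torsion (Γ : EuclideanSpace ℝ (Fin n) → Fin n → Fin n → Fin n → ℝ) :
    EuclideanSpace ℝ (Fin n) → (Fin 2 → Fin n) → Fin n → ℝ :=
  fun y I c ↦ Γ y (I 0) (I 1) c - Γ y (I 1) (I 0) c

/-- The Christoffel symbols of the Levi-Civita connection `D^g`. -/
def leviCivita (g : EuclideanSpace ℝ (Fin n) → Matrix (Fin n) (Fin n) ℝ) :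
    EuclideanSpace ℝ (Fin n) → Fin n → Fin n → Fin n → ℝ :=
  fun y a b c ↦ (1 / 2) * ∑ d, (g y)⁻¹ c d *
    (pd a (fun z ↦ g z b d) y + pd b (fun z ↦ g z a d) y - pd d (fun z ↦ g z a b) y)

/-! In the following `J y c b` is the `c`-th component of `J ∂_b` at `y`. -/

/-- The fundamental form `ω(X, Y) = g(JX, Y)`. -/
def fundForm (g J : EuclideanSpace ℝ (Fin n) → Matrix (Fin n) (Fin n) ℝ) :
    EuclideanSpace ℝ (Fin n) → Fin n → Fin n → ℝ :=
  fun y a b ↦ ∑ p, J y p a * g y p b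

/-- The exterior derivative of a 2-form, with
`dη(∂_a, ∂_b, ∂_c) = ∂_a η_{bc} + ∂_b η_{ca} + ∂_c η_{ab}`. -/
def extDeriv₂ (η : EuclideanSpace ℝ (Fin n) → Fin n → Fin n → ℝ) :
    EuclideanSpace ℝ (Fin n) → Fin n → Fin n → Fin n → ℝ :=
  fun y a b c ↦ pd a (fun z ↦ η z b c) y + pd b (fun z ↦ η z c a) y + pd c (fun z ↦ η z a b) y

/-- `d^c ω = J⁻¹ d J ω`. As `J` acts on forms by precomposition with `J⁻¹` and `Jω = ω`, this is
`d^c ω(X, Y, Z) = dω(JX, JY, JZ)`. -/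
def dcOmega (g J : EuclideanSpace ℝ (Fin n) → Matrix (Fin n) (Fin n) ℝ) :
    EuclideanSpace ℝ (Fin n) → Fin n → Fin n → Fin n → ℝ :=
  fun y a b c ↦ ∑ p, ∑ q, ∑ s, J y p a * J y q b * J y s c * extDeriv₂ (fundForm g J) y p q s

/-- The component `φ⁻` of type `(3,0) + (0,3)` of a 3-form `φ` at a point,
`φ⁻(X,Y,Z) = (φ(X,Y,Z) - φ(JX,JY,Z) - φ(JX,Y,JZ) - φ(X,JY,JZ)) / 4`: inserting `J` in two slots
multiplies a form of type `(3,0)` or `(0,3)` by `-1`, while for a form of type `(2,1)` or `(1,2)`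
the sum over the three pairs of slots is the form itself. -/
def minusPart (J : Matrix (Fin n) (Fin n) ℝ) (φ : Fin n → Fin n → Fin n → ℝ) :
    Fin n → Fin n → Fin n → ℝ :=
  fun a b c ↦ (1 / 4) * (φ a b c - (∑ p, ∑ q, J p a * J q b * φ p q c)
    - (∑ p, ∑ q, J p a * J q c * φ p b q) - ∑ p, ∑ q, J p b * J q c * φ a p q)

/-- The component `φ⁺` of type `(2,1) + (1,2)` of a 3-form `φ` at a point. -/
def plusPart (J : Matrix (Fin n) (Fin n) ℝ) (φ : Fin n → Fin n → Fin n → ℝ) :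
    Fin n → Fin n → Fin n → ℝ :=
  fun a b c ↦ φ a b c - minusPart J φ a b c

/-- The Nijenhuis tensor `N_J(X,Y) = [JX,JY] - [X,Y] - J([JX,Y] + [X,JY])`; `nijenhuis J y a b c`
is the `c`-th component of `N_J(∂_a, ∂_b)`. -/
def nijenhuis (J : EuclideanSpace ℝ (Fin n) → Matrix (Fin n) (Fin n) ℝ) :
    EuclideanSpace ℝ (Fin n) → Fin n → Fin n → Fin n → ℝ :=
  fun y a b c ↦
    (∑ p, (J y p a * pd p (fun z ↦ J z c b) y - J y p b * pd p (fun z ↦ J z c a) y))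
      - ∑ p, J y c p * (pd a (fun z ↦ J z p b) y - pd b (fun z ↦ J z p a) y)

/-- The tensor `g(∇ᵗ_X Y, Z) - g(D^g_X Y, Z)`, namely
`-(t+1)/4 (d^cω)⁺(X,JY,JZ) - (t-1)/4 (d^cω)⁺(X,Y,Z) - 1/4 g(X, N_J(Y,Z)) - 1/2 (d^cω)⁻(X,Y,Z)`. -/
def gauduchonTerm (t : ℝ) (g J : EuclideanSpace ℝ (Fin n) → Matrix (Fin n) (Fin n) ℝ) :
    EuclideanSpace ℝ (Fin n) → Fin n → Fin n → Fin n → ℝ :=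
  fun y a b c ↦
    -((t + 1) / 4) * (∑ p, ∑ q, J y p b * J y q c * plusPart (J y) (dcOmega g J y) a p q)
      - ((t - 1) / 4) * plusPart (J y) (dcOmega g J y) a b c
      - (1 / 4) * (∑ p, g y a p * nijenhuis J y b c p)
      - (1 / 2) * minusPart (J y) (dcOmega g J y) a b c

/-- The symbols of the `t`-Gauduchon connection `∇ᵗ`. -/
def gauduchon (t : ℝ) (g J : EuclideanSpace ℝ (Fin n) → Matrix (Fin n) (Fin n) ℝ) :
    EuclideanSpace ℝ (Fin n) → Fin n → Fin n → Fin n → ℝ :=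
  fun y a b c ↦ leviCivita g y a b c + ∑ d, (g y)⁻¹ c d * gauduchonTerm t g J y a b d

end TensorCalculus

namespace AlmostHermitianStructure

open TensorCalculus

variable {m : ℕ} {M : Type*} [TopologicalSpace M]
  [ChartedSpace (EuclideanSpace ℝ (Fin (2 * m))) M] [IsManifold (𝓡 (2 * m)) ∞ M]

/-- The coordinate vector field `∂ᵢ` of the chart `e`, at the point with coordinates `y`. -/
def coordVec (e : OpenPartialHomeomorph M (EuclideanSpace ℝ (Fin (2 * m))))
    (i : Fin (2 * m)) (y : EuclideanSpace ℝ (Fin (2 * m))) :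
    TangentSpace (𝓡 (2 * m)) (e.symm y) :=
  mfderiv (𝓡 (2 * m)) (𝓡 (2 * m)) e.symm y
    (EuclideanSpace.single i 1 : EuclideanSpace ℝ (Fin (2 * m)))

/-- The components `g(∂ₐ, ∂_b)` of the metric in the chart `e`. -/
def gLoc (h : AlmostHermitianStructure m M)
    (e : OpenPartialHomeomorph M (EuclideanSpace ℝ (Fin (2 * m)))) :
    EuclideanSpace ℝ (Fin (2 * m)) → Matrix (Fin (2 * m)) (Fin (2 * m)) ℝ :=
  fun y ↦ Matrix.of fun a b ↦ h.g.inner (e.symm y) (coordVec e a y) (coordVec e b y)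

/-- The components of the almost complex structure in the chart `e`: the entry `c b` is the
`c`-th coordinate of `J ∂_b`. -/
def JLoc (h : AlmostHermitianStructure m M)
    (e : OpenPartialHomeomorph M (EuclideanSpace ℝ (Fin (2 * m)))) :
    EuclideanSpace ℝ (Fin (2 * m)) → Matrix (Fin (2 * m)) (Fin (2 * m)) ℝ :=
  fun y ↦ Matrix.of fun c b ↦
    (show EuclideanSpace ℝ (Fin (2 * m)) from
      mfderiv (𝓡 (2 * m)) (𝓡 (2 * m)) e (e.symm y) (h.J (e.symm y) (coordVec e b y))) c

/-! The following norms are those of tensors on the tangent space at `x`, computed in a chart `e`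
around `x`; they do not depend on that chart. -/

/-- `|(D^g)ⁱ Rm(g)|_g` at `x`. -/
def normRm (h : AlmostHermitianStructure m M)
    (e : OpenPartialHomeomorph M (EuclideanSpace ℝ (Fin (2 * m)))) (i : ℕ) (x : M) : ℝ :=
  tensorNorm (h.gLoc e (e x))
    (iterCovDeriv (leviCivita (h.gLoc e)) (curvature (leviCivita (h.gLoc e))) i (e x))

/-- `|(D^g)ʲ J|_g` at `x`. -/
def normJ (h : AlmostHermitianStructure m M)
    (e : OpenPartialHomeomorph M (EuclideanSpace ℝ (Fin (2 * m)))) (j : ℕ) (x : M) : ℝ :=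
  tensorNorm (h.gLoc e (e x))
    (iterCovDeriv (r := 1) (leviCivita (h.gLoc e)) (fun y I c ↦ h.JLoc e y c (I 0)) j (e x))

/-- `|(∇ᵗ)ⁱ Ωᵗ|_g` at `x`, for the `t`-Gauduchon curvature `Ωᵗ`. -/
def normGauduchonCurv (h : AlmostHermitianStructure m M) (t : ℝ)
    (e : OpenPartialHomeomorph M (EuclideanSpace ℝ (Fin (2 * m)))) (i : ℕ) (x : M) : ℝ :=
  tensorNorm (h.gLoc e (e x))
    (iterCovDeriv (gauduchon t (h.gLoc e) (h.JLoc e))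
      (curvature (gauduchon t (h.gLoc e) (h.JLoc e))) i (e x))

/-- `|(∇ᵗ)ʲ Tᵗ|_g` at `x`, for the torsion `Tᵗ` of the `t`-Gauduchon connection. -/
def normGauduchonTors (h : AlmostHermitianStructure m M) (t : ℝ)
    (e : OpenPartialHomeomorph M (EuclideanSpace ℝ (Fin (2 * m)))) (j : ℕ) (x : M) : ℝ :=
  tensorNorm (h.gLoc e (e x))
    (iterCovDeriv (gauduchon t (h.gLoc e) (h.JLoc e))
      (torsion (gauduchon t (h.gLoc e) (h.JLoc e))) j (e x))

end AlmostHermitianStructure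

end

/-! Let A be the difference of the `t`-Gauduchon and the Levi-Civita connection. Both connections
are metric, so A can be controlled from either side. On the Levi-Civita side, dω and N_J are
polynomial in g, J and the covariant derivative of J, because D^g is metric and torsion-free; hence
so is A with its last index lowered (`gauduchonTerm_eq_array`). On the Gauduchon side, A is the
contorsion of a metric connection, linear in its torsion (`gauduchonTerm_eq_contorsion`). Moreover
the Gauduchon connection makes J parallel (`covDerivEnd_gauduchon`).

Replacing a connection Γ by Γ + A changes the torsion by the skew part of A, the curvature by ∇A,
A·A and a product of A with the torsion of Γ (`curvature_add`), and every covariant derivative by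
contractions with A. So it suffices to bound A together with k + 1 of its derivatives: k + 2
derivatives of J give this in one direction, k + 1 derivatives of the torsion in the other. In the
second case J is parallel for the starting connection, so its k + 2 Levi-Civita derivatives involve
only k + 1 derivatives of A.

To avoid writing the universal polynomials, a tensor field is replaced by its components in all
frames, which are functions on the space of frames. The horizontal vector fields of a connection act
on these functions as the covariant derivative (`horDeriv_lift`), so by the Leibniz rule the
functions with bounded iterated horizontal derivatives form an algebra (`BddTo`). For a metric
connection the components of g and of its inverse are horizontally constant, so raising and lowering
indices preserves bounds. At an orthonormal frame the tensor norm is the Euclidean norm of the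
components (`tensorNorm_eq`).

No constant is computed. The boundedness statements are proved for arbitrary families, and are
applied to the family of all coordinate structures, with an orthonormal frame, that satisfy the
hypothesis (`exists_uniform_bound`). -/

open scoped Topology

namespace TensorCalculus

/-! ### Arrays with three indices -/

section Array

variable {n : ℕ}

/-- Contraction of the first index of an array with the rows of a matrix. -/
def slot₁ (M : Matrix (Fin n) (Fin n) ℝ) (φ : Fin n → Fin n → Fin n → ℝ) :
    Fin n → Fin n → Fin n → ℝ := fun a b c ↦ ∑ p, M p a * φ p b c

/-- Contraction of the second index of an array with the rows of a matrix. -/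
def slot₂ (M : Matrix (Fin n) (Fin n) ℝ) (φ : Fin n → Fin n → Fin n → ℝ) :
    Fin n → Fin n → Fin n → ℝ := fun a b c ↦ ∑ p, M p b * φ a p c

/-- Contraction of the third index of an array with the rows of a matrix. -/
def slot₃ (M : Matrix (Fin n) (Fin n) ℝ) (φ : Fin n → Fin n → Fin n → ℝ) :
    Fin n → Fin n → Fin n → ℝ := fun a b c ↦ ∑ p, M p c * φ a b p

/-- Contraction of the three indices of an array with the rows of three matrices. -/
def comp3 (φ : Fin n → Fin n → Fin n → ℝ) (M₁ M₂ M₃ : Matrix (Fin n) (Fin n) ℝ) :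
    Fin n → Fin n → Fin n → ℝ := slot₁ M₁ (slot₂ M₂ (slot₃ M₃ φ))

/-- Exchange of the first two indices. -/
def swap₁₂ (φ : Fin n → Fin n → Fin n → ℝ) : Fin n → Fin n → Fin n → ℝ := fun a b c ↦ φ b a c

/-- Exchange of the last two indices. -/
def swap₂₃ (φ : Fin n → Fin n → Fin n → ℝ) : Fin n → Fin n → Fin n → ℝ := fun a b c ↦ φ a c b

/-- Cyclic rotation of the indices. -/
def rot (φ : Fin n → Fin n → Fin n → ℝ) : Fin n → Fin n → Fin n → ℝ := fun a b c ↦ φ b c a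

variable (φ ψ : Fin n → Fin n → Fin n → ℝ) (M₁ M₂ M₃ N₁ N₂ N₃ : Matrix (Fin n) (Fin n) ℝ)

lemma slot₁_slot₁ : slot₁ N₁ (slot₁ M₁ φ) = slot₁ (M₁ * N₁) φ := by
  ext a b c
  simp only [slot₁, Matrix.mul_apply, Finset.mul_sum, Finset.sum_mul]
  rw [Finset.sum_comm]
  exact Finset.sum_congr rfl fun _ _ ↦ Finset.sum_congr rfl fun _ _ ↦ by ring

lemma slot₂_slot₂ : slot₂ N₁ (slot₂ M₁ φ) = slot₂ (M₁ * N₁) φ := by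
  ext a b c
  simp only [slot₂, Matrix.mul_apply, Finset.mul_sum, Finset.sum_mul]
  rw [Finset.sum_comm]
  exact Finset.sum_congr rfl fun _ _ ↦ Finset.sum_congr rfl fun _ _ ↦ by ring

lemma slot₃_slot₃ : slot₃ N₁ (slot₃ M₁ φ) = slot₃ (M₁ * N₁) φ := by
  ext a b c
  simp only [slot₃, Matrix.mul_apply, Finset.mul_sum, Finset.sum_mul]
  rw [Finset.sum_comm]
  exact Finset.sum_congr rfl fun _ _ ↦ Finset.sum_congr rfl fun _ _ ↦ by ring

lemma slot₂_slot₁ : slot₂ M₂ (slot₁ M₁ φ) = slot₁ M₁ (slot₂ M₂ φ) := by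
  ext a b c
  simp only [slot₁, slot₂, Finset.mul_sum]
  rw [Finset.sum_comm]
  exact Finset.sum_congr rfl fun _ _ ↦ Finset.sum_congr rfl fun _ _ ↦ by ring

lemma slot₃_slot₁ : slot₃ M₂ (slot₁ M₁ φ) = slot₁ M₁ (slot₃ M₂ φ) := by
  ext a b c
  simp only [slot₁, slot₃, Finset.mul_sum]
  rw [Finset.sum_comm]
  exact Finset.sum_congr rfl fun _ _ ↦ Finset.sum_congr rfl fun _ _ ↦ by ring

lemma slot₃_slot₂ : slot₃ M₂ (slot₂ M₁ φ) = slot₂ M₁ (slot₃ M₂ φ) := by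
  ext a b c
  simp only [slot₂, slot₃, Finset.mul_sum]
  rw [Finset.sum_comm]
  exact Finset.sum_congr rfl fun _ _ ↦ Finset.sum_congr rfl fun _ _ ↦ by ring

lemma slot₁_one : slot₁ 1 φ = φ := by ext a b c; simp [slot₁, Matrix.one_apply]

lemma slot₂_one : slot₂ 1 φ = φ := by ext a b c; simp [slot₂, Matrix.one_apply]

lemma slot₃_one : slot₃ 1 φ = φ := by ext a b c; simp [slot₃, Matrix.one_apply]

lemma comp3_apply (a b c : Fin n) : comp3 φ M₁ M₂ M₃ a b c =
    ∑ p, ∑ q, ∑ s, M₁ p a * M₂ q b * M₃ s c * φ p q s := by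
  simp only [comp3, slot₁, slot₂, slot₃, Finset.mul_sum, mul_assoc]

/-- Together with the linearity and permutation rules, this gives a normal form: any expression
built from contractions becomes a combination of permuted single `comp3` terms, which `simp` and
`ring` can compare. -/
lemma comp3_comp3 : comp3 (comp3 φ M₁ M₂ M₃) N₁ N₂ N₃ =
    comp3 φ (M₁ * N₁) (M₂ * N₂) (M₃ * N₃) := by
  simp only [comp3, slot₃_slot₁, slot₃_slot₂, slot₂_slot₁, slot₁_slot₁, slot₂_slot₂, slot₃_slot₃]

lemma comp3_one : comp3 φ 1 1 1 = φ := by simp only [comp3, slot₁_one, slot₂_one, slot₃_one]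

lemma comp3_add : comp3 (φ + ψ) M₁ M₂ M₃ = comp3 φ M₁ M₂ M₃ + comp3 ψ M₁ M₂ M₃ := by
  ext a b c; simp [comp3, slot₁, slot₂, slot₃, mul_add, Finset.sum_add_distrib]

lemma comp3_smul (r : ℝ) : comp3 (r • φ) M₁ M₂ M₃ = r • comp3 φ M₁ M₂ M₃ := by
  ext a b c; simp [comp3, slot₁, slot₂, slot₃, Finset.mul_sum, mul_left_comm]

lemma comp3_neg : comp3 (-φ) M₁ M₂ M₃ = -comp3 φ M₁ M₂ M₃ := by
  ext a b c; simp [comp3, slot₁, slot₂, slot₃]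

lemma comp3_sub : comp3 (φ - ψ) M₁ M₂ M₃ = comp3 φ M₁ M₂ M₃ - comp3 ψ M₁ M₂ M₃ := by
  rw [sub_eq_add_neg, comp3_add, comp3_neg, ← sub_eq_add_neg]

lemma comp3_neg₁ : comp3 φ (-M₁) M₂ M₃ = -comp3 φ M₁ M₂ M₃ := by
  ext a b c; simp [comp3, slot₁, slot₂, slot₃]

lemma comp3_neg₂ : comp3 φ M₁ (-M₂) M₃ = -comp3 φ M₁ M₂ M₃ := by
  ext a b c; simp [comp3, slot₁, slot₂, slot₃]

lemma comp3_neg₃ : comp3 φ M₁ M₂ (-M₃) = -comp3 φ M₁ M₂ M₃ := by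
  ext a b c; simp [comp3, slot₁, slot₂, slot₃]

lemma comp3_swap₁₂ : comp3 (swap₁₂ φ) M₁ M₂ M₃ = swap₁₂ (comp3 φ M₂ M₁ M₃) := by
  ext a b c
  simp only [comp3_apply, swap₁₂]
  rw [Finset.sum_comm]
  exact Finset.sum_congr rfl fun _ _ ↦ Finset.sum_congr rfl fun _ _ ↦
    Finset.sum_congr rfl fun _ _ ↦ by ring

lemma comp3_swap₂₃ : comp3 (swap₂₃ φ) M₁ M₂ M₃ = swap₂₃ (comp3 φ M₁ M₃ M₂) := by
  ext a b c
  simp only [comp3_apply, swap₂₃]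
  refine Finset.sum_congr rfl fun _ _ ↦ ?_
  rw [Finset.sum_comm]
  exact Finset.sum_congr rfl fun _ _ ↦ Finset.sum_congr rfl fun _ _ ↦ by ring

lemma rot_eq : rot φ = swap₁₂ (swap₂₃ φ) := by
  ext a b c; rfl

lemma comp3_rot : comp3 (rot φ) M₁ M₂ M₃ = rot (comp3 φ M₂ M₃ M₁) := by
  rw [rot_eq, comp3_swap₁₂, comp3_swap₂₃, rot_eq]

end Array

/-! ### Multilinear algebra of the Gauduchon difference tensor. -/

section Gauduchon

variable {n : ℕ}

lemma minusPart_eq (J : Matrix (Fin n) (Fin n) ℝ) (φ : Fin n → Fin n → Fin n → ℝ) :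
    minusPart J φ = (1 / 4 : ℝ) • (φ - comp3 φ J J 1 - comp3 φ J 1 J - comp3 φ 1 J J) := by
  ext a b c
  simp only [minusPart, comp3_apply, Matrix.one_apply, Pi.smul_apply, Pi.sub_apply, smul_eq_mul]
  congr 1
  simp

lemma plusPart_eq (J : Matrix (Fin n) (Fin n) ℝ) (φ : Fin n → Fin n → Fin n → ℝ) :
    plusPart J φ = φ - minusPart J φ := rfl

/-- The lowered Nijenhuis array `(X, Y, Z) ↦ g(X, N_J(Y, Z))` in terms of the array `K` of the
covariant derivative of `J` for a torsion-free connection. -/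
def nijenhuisArray (J : Matrix (Fin n) (Fin n) ℝ) (K : Fin n → Fin n → Fin n → ℝ) :
    Fin n → Fin n → Fin n → ℝ :=
  (comp3 K J 1 1 - swap₁₂ (comp3 K J 1 1)) - (comp3 K 1 1 J.transpose -
    swap₁₂ (comp3 K 1 1 J.transpose))

/-- The array of `dω` in terms of the array `K` of the covariant derivative of `J` for the
Levi-Civita connection. -/
def dOmegaArray (g : Matrix (Fin n) (Fin n) ℝ) (K : Fin n → Fin n → Fin n → ℝ) :
    Fin n → Fin n → Fin n → ℝ :=
  comp3 K 1 1 g + rot (comp3 K 1 1 g) + rot (rot (comp3 K 1 1 g))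

/-- The array of the difference of the Gauduchon and the Levi-Civita connection in terms of
the arrays of `(d^cω)` and `N_J`. -/
noncomputable def gauduchonForm (t : ℝ) (g J : Matrix (Fin n) (Fin n) ℝ)
    (dc N : Fin n → Fin n → Fin n → ℝ) :
    Fin n → Fin n → Fin n → ℝ :=
  (-((t + 1) / 4)) • comp3 (plusPart J dc) 1 J J - ((t - 1) / 4) • plusPart J dc
    - (1 / 4 : ℝ) • rot (comp3 N 1 1 g.transpose) - (1 / 2 : ℝ) • minusPart J dc

/-- The array of the difference of the Gauduchon and the Levi-Civita connection in terms of
the array `K` of the covariant derivative of `J`. -/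
noncomputable def gauduchonArray (t : ℝ) (g J : Matrix (Fin n) (Fin n) ℝ)
    (K : Fin n → Fin n → Fin n → ℝ) :
    Fin n → Fin n → Fin n → ℝ :=
  gauduchonForm t g J (comp3 (dOmegaArray g K) J J J) (nijenhuisArray J K)

lemma gauduchonTerm_eq (t : ℝ) (g J : EuclideanSpace ℝ (Fin n) → Matrix (Fin n) (Fin n) ℝ)
    (y : EuclideanSpace ℝ (Fin n)) :
    gauduchonTerm t g J y = gauduchonForm t (g y) (J y)
      (comp3 (extDeriv₂ (fundForm g J) y) (J y) (J y) (J y)) (nijenhuis J y) := by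
  have hdc : dcOmega g J y = comp3 (extDeriv₂ (fundForm g J) y) (J y) (J y) (J y) := by
    ext a b c; simp only [dcOmega, comp3_apply]
  ext a b c
  simp only [gauduchonTerm, gauduchonForm, hdc, Pi.sub_apply, Pi.smul_apply, smul_eq_mul, rot]
  congr 3
  · congr 1
    simp [comp3_apply, Matrix.one_apply]
  · simp [comp3_apply, Matrix.one_apply]

/-- The Gauduchon array is natural under changes of the frame. -/
lemma gauduchonArray_frame (t : ℝ) (g J P Q : Matrix (Fin n) (Fin n) ℝ)
    (K : Fin n → Fin n → Fin n → ℝ) (hPQ : P * Q = 1) :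
    gauduchonArray t (P.transpose * g * P) (Q * J * P) (comp3 K P P Q.transpose) =
      comp3 (gauduchonArray t g J K) P P P := by
  -- Frame and coframe matrices meet in adjacent pairs wherever an index is contracted; cancelling
  -- them reduces both sides to the same normal form.
  have h1 : ∀ X : Matrix (Fin n) (Fin n) ℝ, P * (Q * X) = X := fun X ↦ by
    rw [← Matrix.mul_assoc, hPQ, Matrix.one_mul]
  have h2 : Q.transpose * P.transpose = 1 := by
    rw [← Matrix.transpose_mul, hPQ, Matrix.transpose_one]
  have h3 : ∀ X : Matrix (Fin n) (Fin n) ℝ, Q.transpose * (P.transpose * X) = X := fun X ↦ by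
    rw [← Matrix.mul_assoc, h2, Matrix.one_mul]
  simp only [gauduchonArray, gauduchonForm, plusPart_eq, minusPart_eq, dOmegaArray,
    nijenhuisArray, comp3_add, comp3_sub, comp3_smul, comp3_swap₁₂, comp3_rot, comp3_comp3,
    Matrix.mul_assoc, Matrix.mul_one, Matrix.one_mul, h1, h3, Matrix.transpose_mul,
    Matrix.transpose_transpose]

/-- The Gauduchon connection preserves the complex structure, and is metric: algebraic form. -/
lemma gauduchonArray_parallel (t : ℝ) (g J : Matrix (Fin n) (Fin n) ℝ)
    (K : Fin n → Fin n → Fin n → ℝ) (hJ : J * J = -1) (hg : g.transpose = g)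
    (hgJ : J.transpose * g = -(g * J))
    (hK : comp3 K 1 1 J.transpose = - comp3 K 1 J 1)
    (hk : swap₂₃ (comp3 K 1 1 g) = - comp3 K 1 1 g) :
    comp3 K 1 1 g + comp3 (gauduchonArray t g J K) 1 J 1 + comp3 (gauduchonArray t g J K) 1 1 J
      = 0 ∧ swap₂₃ (gauduchonArray t g J K) = - gauduchonArray t g J K := by
  obtain ⟨k, hkdef⟩ : ∃ k, k = comp3 K 1 1 g := ⟨_, rfl⟩
  -- A derivative of J anticommutes with J, and J is skew for g. The two signs cancel, so k(X, Y,
  -- JZ) = k(X, JY, Z) for the lowered array k.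
  have c1 : ∀ M₁ M₂ M₃ : Matrix (Fin n) (Fin n) ℝ,
      comp3 k M₁ M₂ (J * M₃) = comp3 k M₁ (J * M₂) M₃ := by
    intro M₁ M₂ M₃
    have : comp3 (comp3 (comp3 K 1 1 J.transpose) 1 1 g) M₁ M₂ M₃ =
        comp3 (comp3 (-comp3 K 1 J 1) 1 1 g) M₁ M₂ M₃ := by rw [hK]
    simp only [comp3_neg, comp3_comp3, Matrix.one_mul, Matrix.mul_one, hgJ,
      comp3_neg₃, neg_inj] at this
    simpa only [hkdef, comp3_comp3, Matrix.one_mul, Matrix.mul_assoc] using this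
  have c1' : ∀ M₁ M₂ : Matrix (Fin n) (Fin n) ℝ,
      comp3 k M₁ M₂ J = comp3 k M₁ (J * M₂) 1 := fun M₁ M₂ ↦ by
    simpa using c1 M₁ M₂ 1
  have c3 : ∀ M₁ M₂ M₃ : Matrix (Fin n) (Fin n) ℝ,
      comp3 K M₁ M₂ (g * M₃) = comp3 k M₁ M₂ M₃ := fun M₁ M₂ M₃ ↦ by
    rw [hkdef, comp3_comp3, Matrix.one_mul, Matrix.one_mul]
  have c3' : ∀ M₁ M₂ : Matrix (Fin n) (Fin n) ℝ,
      comp3 K M₁ M₂ g = comp3 k M₁ M₂ 1 := fun M₁ M₂ ↦ by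
    simpa using c3 M₁ M₂ 1
  have sk : ∀ M₁ M₂ M₃ a b c, comp3 k M₁ M₂ M₃ a b c = - comp3 k M₁ M₃ M₂ a c b := by
    intro M₁ M₂ M₃ a b c
    rw [← hkdef] at hk
    have : k = - swap₂₃ k := by rw [hk, neg_neg]
    rw [this, comp3_neg, comp3_swap₂₃, ← this]; rfl
  have s1 : ∀ M a b c, comp3 k M 1 1 a b c = - comp3 k M 1 1 a c b := fun M ↦ sk M 1 1
  -- Skewness in the last two slots persists after inserting J in the second one, since J can be
  -- moved to the third.
  have s2 : ∀ M a b c, comp3 k M J 1 a b c = - comp3 k M J 1 a c b := fun M a b c ↦ by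
    rw [sk, c1', Matrix.mul_one]
  constructor
  -- In normal form only k with J possibly inserted in its first two slots remains, at permuted
  -- indices. The two skewness rules select one order per pair of last indices, and the rest is a
  -- linear identity.
  · ext a b c
    simp only [gauduchonArray, gauduchonForm, plusPart_eq, minusPart_eq, dOmegaArray,
      nijenhuisArray, comp3_add, comp3_sub, comp3_smul, comp3_swap₁₂, comp3_rot, comp3_comp3,
      Matrix.mul_one, Matrix.one_mul, hJ, hg, hgJ, comp3_neg, comp3_neg₁, comp3_neg₂,
      comp3_neg₃, Matrix.mul_neg, c3, c3', c1']
    simp only [rot, swap₁₂, Pi.add_apply, Pi.sub_apply, Pi.smul_apply, Pi.neg_apply,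
      Pi.zero_apply, smul_eq_mul]
    simp only [s1 _ c b a, s2 _ c b a]
    ring
  · ext a b c
    simp only [gauduchonArray, gauduchonForm, plusPart_eq, minusPart_eq, dOmegaArray,
      nijenhuisArray, comp3_add, comp3_sub, comp3_smul, comp3_swap₁₂, comp3_rot, comp3_comp3,
      Matrix.mul_one, Matrix.one_mul, hJ, hg, hgJ, comp3_neg, comp3_neg₁, comp3_neg₂,
      comp3_neg₃, Matrix.mul_neg, c3, c3', c1']
    simp only [rot, swap₁₂, swap₂₃, Pi.add_apply, Pi.sub_apply, Pi.smul_apply, Pi.neg_apply,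
      smul_eq_mul]
    simp only [s1 _ a c b, s1 _ b a c, s1 _ c b a, s2 _ a c b, s2 _ b a c, s2 _ c b a]
    ring

end Gauduchon

/-! ### Components of a tensor in a frame -/

section Frame

variable {n r : ℕ}

/-- The components of a tensor in the frame given by the columns of `P`, with `Q` in the role of
the inverse of `P`. -/
def frameComp (P Q : Matrix (Fin n) (Fin n) ℝ) (S : (Fin r → Fin n) → Fin n → ℝ) :
    (Fin r → Fin n) → Fin n → ℝ :=
  fun I c ↦ ∑ I', ∑ d, (∏ s, P (I' s) (I s)) * Q c d * S I' d

/-- The components of an endomorphism in a frame; `G b c` is the `c`-th component of the image of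
the `b`-th vector. -/
def frameEnd (P Q : Matrix (Fin n) (Fin n) ℝ) (G : Fin n → Fin n → ℝ) : Fin n → Fin n → ℝ :=
  fun b c ↦ ∑ b', ∑ c', P b' b * Q c c' * G b' c'

variable (P Q : Matrix (Fin n) (Fin n) ℝ)

lemma frameComp_add (S S' : (Fin r → Fin n) → Fin n → ℝ) (I : Fin r → Fin n) (c : Fin n) :
    frameComp P Q (fun J d ↦ S J d + S' J d) I c = frameComp P Q S I c + frameComp P Q S' I c := by
  simp only [frameComp, mul_add, Finset.sum_add_distrib]

lemma frameComp_sub (S S' : (Fin r → Fin n) → Fin n → ℝ) (I : Fin r → Fin n) (c : Fin n) :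
    frameComp P Q (fun J d ↦ S J d - S' J d) I c = frameComp P Q S I c - frameComp P Q S' I c := by
  simp only [frameComp, mul_sub, Finset.sum_sub_distrib]

lemma frameComp_sum {ι : Type*} (s : Finset ι) (S : ι → (Fin r → Fin n) → Fin n → ℝ)
    (I : Fin r → Fin n) (c : Fin n) :
    frameComp P Q (fun J d ↦ ∑ i ∈ s, S i J d) I c = ∑ i ∈ s, frameComp P Q (S i) I c := by
  simp only [frameComp, Finset.mul_sum]
  rw [Finset.sum_comm (s := s)]
  exact Finset.sum_congr rfl fun _ _ ↦ Finset.sum_comm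

lemma frameComp_cons (S : (Fin (r + 1) → Fin n) → Fin n → ℝ) (I : Fin (r + 1) → Fin n)
    (c : Fin n) :
    frameComp P Q S I c =
      ∑ j, P j (I 0) * frameComp P Q (fun J d ↦ S (Fin.cons j J) d) (Fin.tail I) c := by
  simp only [frameComp]
  rw [← (Fin.consEquiv fun _ ↦ Fin n).sum_comp, Fintype.sum_prod_type]
  refine Finset.sum_congr rfl fun j _ ↦ ?_
  simp only [Finset.mul_sum]
  refine Finset.sum_congr rfl fun J _ ↦ Finset.sum_congr rfl fun d _ ↦ ?_
  have : Fin.consEquiv (fun _ ↦ Fin n) (j, J) = Fin.cons j J := rfl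
  rw [Fin.prod_univ_succ, this]
  simp only [Fin.cons_zero, Fin.cons_succ, Fin.tail]
  ring

lemma frameComp_comp_perm (σ : Equiv.Perm (Fin r)) (S : (Fin r → Fin n) → Fin n → ℝ)
    (I : Fin r → Fin n) (c : Fin n) :
    frameComp P Q (fun J d ↦ S (J ∘ σ) d) I c = frameComp P Q S (I ∘ σ) c := by
  simp only [frameComp]
  refine Fintype.sum_equiv (Equiv.arrowCongr σ.symm (Equiv.refl _)) _ _ fun J ↦ ?_
  refine Finset.sum_congr rfl fun d _ ↦ ?_
  congr 2
  rw [← Equiv.prod_comp σ]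
  rfl

/-- Exchanging the value J s with f is an involution on pairs (J, f). -/
lemma sum_update_comm (s : Fin r) (H : (Fin r → Fin n) → Fin n → ℝ) :
    ∑ J, ∑ f, H J f = ∑ J : Fin r → Fin n, ∑ f, H (Function.update J s f) (J s) := by
  simp only [← Fintype.sum_prod_type']
  refine Finset.sum_nbij' (fun x ↦ (Function.update x.1 s x.2, x.1 s))
    (fun x ↦ (Function.update x.1 s x.2, x.1 s)) ?_ ?_ ?_ ?_ ?_ <;> simp

variable {P Q}

lemma sum_frame_coframe (h : P * Q = 1) (a b : Fin n) :
    ∑ e, P a e * Q e b = if a = b then 1 else 0 := by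
  rw [← Matrix.mul_apply, h, Matrix.one_apply]

/-- Contraction over a frame of an endomorphism with a coframe vector. -/
lemma sum_frameEnd_mul_coframe (h : P * Q = 1) (G : Fin n → Fin n → ℝ) (c d : Fin n) :
    ∑ e, frameEnd P Q G e c * Q e d = ∑ c', Q c c' * G d c' := by
  calc ∑ e, frameEnd P Q G e c * Q e d
      = ∑ b', ∑ c', (∑ e, P b' e * Q e d) * (Q c c' * G b' c') := by
        simp only [frameEnd, Finset.sum_mul]
        rw [Finset.sum_comm]
        refine Finset.sum_congr rfl fun _ _ ↦ ?_
        rw [Finset.sum_comm]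
        exact Finset.sum_congr rfl fun _ _ ↦ Finset.sum_congr rfl fun _ _ ↦ by ring
    _ = _ := by simp [sum_frame_coframe h]

/-- Contraction over a frame of an endomorphism with a frame vector. -/
lemma sum_frameEnd_mul_frame (h : P * Q = 1) (G : Fin n → Fin n → ℝ) (b d : Fin n) :
    ∑ e, frameEnd P Q G b e * P d e = ∑ b', P b' b * G b' d := by
  calc ∑ e, frameEnd P Q G b e * P d e
      = ∑ b', ∑ c', (∑ e, P d e * Q e c') * (P b' b * G b' c') := by
        simp only [frameEnd, Finset.sum_mul]
        rw [Finset.sum_comm]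
        refine Finset.sum_congr rfl fun _ _ ↦ ?_
        rw [Finset.sum_comm]
        exact Finset.sum_congr rfl fun _ _ ↦ Finset.sum_congr rfl fun _ _ ↦ by ring
    _ = _ := by simp [sum_frame_coframe h]

/-- Contraction is independent of the frame: summing a frame vector against its dual coframe vector
gives the identity. -/
lemma frameComp_end (h : P * Q = 1) (G : Fin n → Fin n → ℝ)
    (S : (Fin r → Fin n) → Fin n → ℝ) (I : Fin r → Fin n) (c : Fin n) :
    frameComp P Q (fun J c ↦ ∑ d, G d c * S J d) I c =
      ∑ e, frameEnd P Q G e c * frameComp P Q S I e := by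
  have : ∑ e, frameEnd P Q G e c * frameComp P Q S I e =
      ∑ J, ∑ d, (∏ s, P (J s) (I s)) * S J d * ∑ e, frameEnd P Q G e c * Q e d := by
    simp only [frameComp, Finset.mul_sum]
    rw [Finset.sum_comm]
    refine Finset.sum_congr rfl fun _ _ ↦ ?_
    rw [Finset.sum_comm]
    exact Finset.sum_congr rfl fun _ _ ↦ Finset.sum_congr rfl fun _ _ ↦ by ring
  rw [this]
  simp only [frameComp, sum_frameEnd_mul_coframe h, Finset.mul_sum]
  refine Finset.sum_congr rfl fun _ _ ↦ ?_
  rw [Finset.sum_comm]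
  exact Finset.sum_congr rfl fun _ _ ↦ Finset.sum_congr rfl fun _ _ ↦ by ring

lemma prod_frame_update (s : Fin r) (J I : Fin r → Fin n) (f e : Fin n) :
    ∏ s', P (Function.update J s f s') (Function.update I s e s') =
      P f e * ∏ s' ∈ Finset.univ.erase s, P (J s') (I s') := by
  rw [← Finset.mul_prod_erase _ _ (Finset.mem_univ s), Function.update_self, Function.update_self]
  congr 1
  refine Finset.prod_congr rfl fun s' hs' ↦ ?_
  rw [Function.update_of_ne (Finset.ne_of_mem_erase hs'),
    Function.update_of_ne (Finset.ne_of_mem_erase hs')]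

lemma frameComp_slot (h : P * Q = 1) (G : Fin n → Fin n → ℝ) (s : Fin r)
    (S : (Fin r → Fin n) → Fin n → ℝ) (I : Fin r → Fin n) (c : Fin n) :
    frameComp P Q (fun J c ↦ ∑ d, G (J s) d * S (Function.update J s d) c) I c =
      ∑ e, frameEnd P Q G (I s) e * frameComp P Q S (Function.update I s e) c := by
  have hp : ∀ (J : Fin r → Fin n) (e : Fin n), ∏ s', P (J s') (Function.update I s e s') =
      P (J s) e * ∏ s' ∈ Finset.univ.erase s, P (J s') (I s') := fun J e ↦ by
    simpa using prod_frame_update s J I (J s) e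
  have h1 : ∑ e, frameEnd P Q G (I s) e * frameComp P Q S (Function.update I s e) c =
      ∑ J, ∑ d, (∏ s' ∈ Finset.univ.erase s, P (J s') (I s')) * Q c d * S J d *
        ∑ e, frameEnd P Q G (I s) e * P (J s) e := by
    simp only [frameComp, hp, Finset.mul_sum]
    rw [Finset.sum_comm]
    refine Finset.sum_congr rfl fun _ _ ↦ ?_
    rw [Finset.sum_comm]
    exact Finset.sum_congr rfl fun _ _ ↦ Finset.sum_congr rfl fun _ _ ↦ by ring
  have h2 : ∀ F : (Fin r → Fin n) → Fin n → Fin n → ℝ,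
      ∑ J, ∑ d, ∑ f, F J d f = ∑ J, ∑ f, ∑ d, F J d f := fun F ↦
    Finset.sum_congr rfl fun _ _ ↦ Finset.sum_comm
  rw [h1]
  simp only [frameComp, sum_frameEnd_mul_frame h, Finset.mul_sum]
  -- On one side the contracted index sits in slot s of the tensor, on the other it is a separate
  -- variable; the exchange makes the two sums agree term by term.
  conv_lhs => rw [h2, sum_update_comm s]
  conv_rhs => rw [h2]
  refine Finset.sum_congr rfl fun J _ ↦ Finset.sum_congr rfl fun f _ ↦
    Finset.sum_congr rfl fun d _ ↦ ?_
  have h3 : ∏ s', P (Function.update J s f s') (I s') =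
      P f (I s) * ∏ s' ∈ Finset.univ.erase s, P (J s') (I s') := by
    simpa using prod_frame_update s J I f (I s)
  rw [h3, Function.update_self, Function.update_idem, Function.update_eq_self]
  ring

/-- The components in a frame of the algebraic part of a covariant derivative. -/
lemma frameComp_covDeriv (h : P * Q = 1) (A : Fin n → Fin n → Fin n → ℝ)
    (D : Fin n → (Fin r → Fin n) → Fin n → ℝ)
    (S : (Fin r → Fin n) → Fin n → ℝ) (I : Fin (r + 1) → Fin n) (c : Fin n) :
    frameComp P Q (fun J c ↦ D (J 0) (Fin.tail J) c + ∑ d, A (J 0) d c * S (Fin.tail J) d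
      - ∑ s : Fin r, ∑ d, A (J 0) (Fin.tail J s) d * S (Function.update (Fin.tail J) s d) c) I c =
    ∑ j, P j (I 0) * frameComp P Q (D j) (Fin.tail I) c
      + ∑ e, comp3 A P P Q.transpose (I 0) e c * frameComp P Q S (Fin.tail I) e
      - ∑ s : Fin r, ∑ e, comp3 A P P Q.transpose (I 0) (Fin.tail I s) e *
        frameComp P Q S (Function.update (Fin.tail I) s e) c := by
  have hA : ∀ a b c, comp3 A P P Q.transpose a b c = ∑ j, P j a * frameEnd P Q (A j) b c := by
    intro a b c
    simp only [comp3_apply, frameEnd, Finset.mul_sum, Matrix.transpose_apply, mul_assoc]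
  rw [frameComp_cons]
  simp only [Fin.cons_zero, Fin.tail_cons, frameComp_add, frameComp_sub, frameComp_sum,
    frameComp_end h, frameComp_slot h, hA, mul_add, mul_sub, Finset.sum_add_distrib,
    Finset.sum_sub_distrib]
  congr 1
  · congr 1
    simp only [Finset.mul_sum, Finset.sum_mul]
    rw [Finset.sum_comm]
    exact Finset.sum_congr rfl fun _ _ ↦ Finset.sum_congr rfl fun _ _ ↦ by ring
  · simp only [Finset.mul_sum, Finset.sum_mul]
    rw [Finset.sum_comm]
    refine Finset.sum_congr rfl fun _ _ ↦ ?_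
    rw [Finset.sum_comm]
    exact Finset.sum_congr rfl fun _ _ ↦ Finset.sum_congr rfl fun _ _ ↦ by ring

lemma frameComp_two (A : Fin n → Fin n → Fin n → ℝ) (I : Fin 2 → Fin n) (c : Fin n) :
    frameComp P Q (fun J d ↦ A (J 0) (J 1) d) I c =
      comp3 A P P Q.transpose (I 0) (I 1) c := by
  simp only [frameComp, comp3_apply, Fin.prod_univ_two]
  rw [← (finTwoArrowEquiv (Fin n)).symm.sum_comp, Fintype.sum_prod_type]
  rfl

lemma frameComp_one (J : Matrix (Fin n) (Fin n) ℝ) (I : Fin 1 → Fin n) (c : Fin n) :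
    frameComp P Q (fun I d ↦ J d (I 0)) I c = (Q * J * P) c (I 0) := by
  simp only [frameComp, Fin.prod_univ_one, Matrix.mul_apply]
  rw [← (Equiv.funUnique (Fin 1) (Fin n)).symm.sum_comp]
  refine Finset.sum_congr rfl fun p _ ↦ ?_
  rw [Finset.sum_mul]
  refine Finset.sum_congr rfl fun d _ ↦ ?_
  simp [Equiv.funUnique]
  ring

end Frame

/-! ### The frame bundle of a coordinate domain -/

section FrameBundle

variable {n r : ℕ}

/-- Pairs of a point of `ℝⁿ` and a family of `n` vectors, the columns of a matrix. -/
abbrev FrameSpace (n : ℕ) := EuclideanSpace ℝ (Fin n) × (Fin n → Fin n → ℝ)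

/-- The matrix of the vectors of a point of the frame space. -/
def frame (p : FrameSpace n) : Matrix (Fin n) (Fin n) ℝ := Matrix.of p.2

/-- The matrix of the dual frame. -/
noncomputable def coframe (p : FrameSpace n) : Matrix (Fin n) (Fin n) ℝ := (frame p)⁻¹

/-- The components of a tensor field in all frames, as functions on the frame space. -/
noncomputable def lift (S : EuclideanSpace ℝ (Fin n) → (Fin r → Fin n) → Fin n → ℝ)
    (p : FrameSpace n) : (Fin r → Fin n) → Fin n → ℝ :=
  frameComp (frame p) (coframe p) (S p.1)

/-- The components of an array of type `(2, 1)` in all frames. -/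
noncomputable def lift₃ (A : EuclideanSpace ℝ (Fin n) → Fin n → Fin n → Fin n → ℝ)
    (p : FrameSpace n) : Fin n → Fin n → Fin n → ℝ :=
  comp3 (A p.1) (frame p) (frame p) (coframe p).transpose

/-- The horizontal vector at a frame for a linear connection, projecting to the `a`-th vector of
the frame. -/
noncomputable def horVec (Γ : EuclideanSpace ℝ (Fin n) → Fin n → Fin n → Fin n → ℝ) (a : Fin n)
    (p : FrameSpace n) : FrameSpace n :=
  (∑ j, p.2 j a • EuclideanSpace.single j 1,
    fun j i ↦ -∑ q, ∑ s, p.2 q a * p.2 s i * Γ p.1 q s j)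

/-- The derivative of a function on the frame space along the standard horizontal vector fields
of a linear connection. -/
noncomputable def horDeriv (Γ : EuclideanSpace ℝ (Fin n) → Fin n → Fin n → Fin n → ℝ) (a : Fin n)
    (f : FrameSpace n → ℝ) (p : FrameSpace n) : ℝ :=
  fderiv ℝ f p (horVec Γ a p)

variable (Γ : EuclideanSpace ℝ (Fin n) → Fin n → Fin n → Fin n → ℝ) (a : Fin n)
  {p : FrameSpace n}

lemma horDeriv_congr {f f' : FrameSpace n → ℝ} (h : f =ᶠ[𝓝 p] f') :
    horDeriv Γ a f =ᶠ[𝓝 p] horDeriv Γ a f' :=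
  (h.fderiv (𝕜 := ℝ)).mono fun q hq ↦ by simp only [horDeriv, hq]

lemma horDeriv_const (c : ℝ) : horDeriv Γ a (fun _ ↦ c) p = 0 := by simp [horDeriv]

lemma horDeriv_add {f f' : FrameSpace n → ℝ} (hf : DifferentiableAt ℝ f p)
    (hf' : DifferentiableAt ℝ f' p) :
    horDeriv Γ a (fun q ↦ f q + f' q) p = horDeriv Γ a f p + horDeriv Γ a f' p := by
  simp [horDeriv, fderiv_fun_add hf hf']

lemma horDeriv_mul {f f' : FrameSpace n → ℝ} (hf : DifferentiableAt ℝ f p)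
    (hf' : DifferentiableAt ℝ f' p) :
    horDeriv Γ a (fun q ↦ f q * f' q) p = horDeriv Γ a f p * f' p + f p * horDeriv Γ a f' p := by
  simp [horDeriv, fderiv_fun_mul hf hf']
  ring

lemma horDeriv_sum {κ : Type*} (s : Finset κ) {f : κ → FrameSpace n → ℝ}
    (hf : ∀ i ∈ s, DifferentiableAt ℝ (f i) p) :
    horDeriv Γ a (fun q ↦ ∑ i ∈ s, f i q) p = ∑ i ∈ s, horDeriv Γ a (f i) p := by
  simp [horDeriv, fderiv_fun_sum hf]

lemma horDeriv_prod {κ : Type*} [DecidableEq κ] (s : Finset κ) {f : κ → FrameSpace n → ℝ}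
    (hf : ∀ i ∈ s, DifferentiableAt ℝ (f i) p) :
    horDeriv Γ a (fun q ↦ ∏ i ∈ s, f i q) p =
      ∑ i ∈ s, (∏ j ∈ s.erase i, f j p) * horDeriv Γ a (f i) p := by
  simp only [horDeriv]
  rw [(HasFDerivAt.finsetProd fun i hi ↦ (hf i hi).hasFDerivAt).fderiv]
  simp

lemma horDeriv_base {f : EuclideanSpace ℝ (Fin n) → ℝ} (hf : DifferentiableAt ℝ f p.1) :
    horDeriv Γ a (fun q ↦ f q.1) p = ∑ j, frame p j a * pd j f p.1 := by
  have : HasFDerivAt (fun q : FrameSpace n ↦ f q.1)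
      ((fderiv ℝ f p.1).comp (ContinuousLinearMap.fst ℝ _ _)) p :=
    hf.hasFDerivAt.comp p hasFDerivAt_fst
  simp [horDeriv, this.fderiv, horVec, pd, frame]

lemma differentiableAt_frame (i j : Fin n) :
    DifferentiableAt ℝ (fun q : FrameSpace n ↦ frame q i j) p := by
  simp only [frame, Matrix.of_apply]
  fun_prop

lemma contDiffAt_frame (i j : Fin n) :
    ContDiffAt ℝ ∞ (fun q : FrameSpace n ↦ frame q i j) p := by
  simp only [frame, Matrix.of_apply]
  fun_prop

/-- The entries of the inverse of a smooth matrix are smooth. -/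
lemma contDiffAt_matrix_inv {X : Type*} [NormedAddCommGroup X] [NormedSpace ℝ X]
    {M : X → Matrix (Fin n) (Fin n) ℝ} {x : X} (hM : ∀ i j, ContDiffAt ℝ ∞ (fun z ↦ M z i j) x)
    (hx : (M x).det ≠ 0) (i j : Fin n) : ContDiffAt ℝ ∞ (fun z ↦ (M z)⁻¹ i j) x := by
  have hdet : ∀ N : X → Matrix (Fin n) (Fin n) ℝ,
      (∀ i j, ContDiffAt ℝ ∞ (fun z ↦ N z i j) x) → ContDiffAt ℝ ∞ (fun z ↦ (N z).det) x := by
    intro N hN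
    simp only [Matrix.det_apply, Units.smul_def, zsmul_eq_mul]
    exact ContDiffAt.sum fun σ _ ↦ contDiffAt_const.mul (contDiffAt_prod fun i _ ↦ hN _ _)
  simp only [Matrix.inv_def, Ring.inverse_eq_inv', Matrix.smul_apply, smul_eq_mul,
    Matrix.adjugate_apply]
  refine ((hdet M hM).inv hx).mul (hdet _ fun k l ↦ ?_)
  by_cases hk : k = j
  · subst hk
    simpa using contDiffAt_const
  · simpa [Matrix.updateRow_ne hk] using hM k l

lemma eventually_det_ne_zero {X : Type*} [NormedAddCommGroup X] [NormedSpace ℝ X]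
    {M : X → Matrix (Fin n) (Fin n) ℝ} {x : X} (hM : ∀ i j, ContDiffAt ℝ ∞ (fun z ↦ M z i j) x)
    (hx : (M x).det ≠ 0) : ∀ᶠ z in 𝓝 x, (M z).det ≠ 0 := by
  have hdet : ContinuousAt (fun z ↦ (M z).det) x := by
    simp only [Matrix.det_apply, Units.smul_def, zsmul_eq_mul]
    exact tendsto_finsetSum _ fun σ _ ↦ tendsto_const_nhds.mul
      (tendsto_finsetProd _ fun i _ ↦ (hM _ _).continuousAt)
  exact hdet.eventually_ne hx

lemma eventually_frame_det (hp : (frame p).det ≠ 0) :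
    ∀ᶠ q in 𝓝 p, (frame q).det ≠ 0 :=
  eventually_det_ne_zero (fun i j ↦ contDiffAt_frame i j) hp

lemma contDiffAt_coframe (hp : (frame p).det ≠ 0) (i j : Fin n) :
    ContDiffAt ℝ ∞ (fun q : FrameSpace n ↦ coframe q i j) p :=
  contDiffAt_matrix_inv (fun i j ↦ contDiffAt_frame i j) hp i j

lemma frame_mul_coframe (hp : (frame p).det ≠ 0) : frame p * coframe p = 1 :=
  Matrix.mul_nonsing_inv _ (isUnit_iff_ne_zero.2 hp)

lemma coframe_mul_frame (hp : (frame p).det ≠ 0) : coframe p * frame p = 1 :=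
  Matrix.nonsing_inv_mul _ (isUnit_iff_ne_zero.2 hp)

lemma _root_.ContDiffAt.eventually_differentiableAt {X : Type*} [NormedAddCommGroup X]
    [NormedSpace ℝ X] {f : X → ℝ} {x : X} (hf : ContDiffAt ℝ ∞ f x) :
    ∀ᶠ z in 𝓝 x, DifferentiableAt ℝ f z :=
  ((hf.of_le (m := 1) (by exact_mod_cast le_top)).eventually (by simp)).mono
    fun _ h ↦ h.differentiableAt one_ne_zero

lemma _root_.ContDiffAt.differentiableAt_of_smooth {X : Type*} [NormedAddCommGroup X]
    [NormedSpace ℝ X] {f : X → ℝ} {x : X} (hf : ContDiffAt ℝ ∞ f x) : DifferentiableAt ℝ f x :=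
  hf.differentiableAt (by simp)

lemma contDiffAt_pd {f : EuclideanSpace ℝ (Fin n) → ℝ} {y : EuclideanSpace ℝ (Fin n)}
    (hf : ContDiffAt ℝ ∞ f y) (i : Fin n) : ContDiffAt ℝ ∞ (pd i f) y :=
  (hf.fderiv_right (m := ∞) (by simp)).clm_apply contDiffAt_const

/-- Smoothness of the components of a tensor field at a point. -/
def SmoothAt (S : EuclideanSpace ℝ (Fin n) → (Fin r → Fin n) → Fin n → ℝ)
    (y : EuclideanSpace ℝ (Fin n)) : Prop :=
  ∀ I c, ContDiffAt ℝ ∞ (fun z ↦ S z I c) y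

/-- Smoothness of the entries of an array at a point. -/
def SmoothAt₃ (A : EuclideanSpace ℝ (Fin n) → Fin n → Fin n → Fin n → ℝ)
    (y : EuclideanSpace ℝ (Fin n)) : Prop :=
  ∀ i j k, ContDiffAt ℝ ∞ (fun z ↦ A z i j k) y

lemma SmoothAt.contDiffAt_lift {S : EuclideanSpace ℝ (Fin n) → (Fin r → Fin n) → Fin n → ℝ}
    (hS : SmoothAt S p.1) (hp : (frame p).det ≠ 0) (I : Fin r → Fin n) (c : Fin n) :
    ContDiffAt ℝ ∞ (fun q ↦ lift S q I c) p := by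
  refine ContDiffAt.sum fun J _ ↦ ContDiffAt.sum fun d _ ↦ ?_
  exact ((contDiffAt_prod fun s _ ↦ contDiffAt_frame _ _).mul (contDiffAt_coframe hp c d)).mul
    ((hS J d).comp p contDiffAt_fst)

lemma SmoothAt.covDeriv {Γ : EuclideanSpace ℝ (Fin n) → Fin n → Fin n → Fin n → ℝ}
    {S : EuclideanSpace ℝ (Fin n) → (Fin r → Fin n) → Fin n → ℝ} {y : EuclideanSpace ℝ (Fin n)}
    (hS : SmoothAt S y) (hΓ : SmoothAt₃ Γ y) : SmoothAt (covDeriv Γ S) y := by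
  intro I c
  refine ContDiffAt.sub (ContDiffAt.add ?_ ?_) ?_
  · exact contDiffAt_pd (hS _ _) _
  · exact ContDiffAt.sum fun d _ ↦ (hΓ _ _ _).mul (hS _ _)
  · exact ContDiffAt.sum fun s _ ↦ ContDiffAt.sum fun d _ ↦ (hΓ _ _ _).mul (hS _ _)

lemma SmoothAt.iterCovDeriv {Γ : EuclideanSpace ℝ (Fin n) → Fin n → Fin n → Fin n → ℝ}
    {S : EuclideanSpace ℝ (Fin n) → (Fin r → Fin n) → Fin n → ℝ} {y : EuclideanSpace ℝ (Fin n)}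
    (hS : SmoothAt S y) (hΓ : SmoothAt₃ Γ y) : ∀ i, SmoothAt (iterCovDeriv Γ S i) y
  | 0 => hS
  | i + 1 => (hS.iterCovDeriv hΓ i).covDeriv hΓ

lemma horDeriv_frame' (j i : Fin n) :
    horDeriv Γ a (fun q ↦ frame q j i) p =
      -∑ q, ∑ s, frame p q a * frame p s i * Γ p.1 q s j := by
  obtain ⟨L, hL⟩ : ∃ L : FrameSpace n →L[ℝ] ℝ, L = (ContinuousLinearMap.proj i).comp
      ((ContinuousLinearMap.proj j).comp
        (ContinuousLinearMap.snd ℝ (EuclideanSpace ℝ (Fin n)) (Fin n → Fin n → ℝ))) := ⟨_, rfl⟩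
  have h0 : (fun q : FrameSpace n ↦ frame q j i) = L := by rw [hL]; rfl
  rw [horDeriv, h0, L.fderiv, hL]
  rfl

/-- Along a horizontal direction the frame is parallel, so its coordinates vary by minus the
connection symbols, here re-expanded in the frame itself. -/
lemma horDeriv_frame (hp : (frame p).det ≠ 0) (j i : Fin n) :
    horDeriv Γ a (fun q ↦ frame q j i) p = -∑ e, frame p j e * lift₃ Γ p a i e := by
  rw [horDeriv_frame']
  have h2 : ∀ c, lift₃ Γ p a i c = ∑ q, ∑ s, ∑ d, frame p q a * frame p s i * coframe p c d * Γ p.1 q s d :=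
    fun c ↦ by simp only [lift₃, comp3_apply, Matrix.transpose_apply]
  have h3 : ∑ e, frame p j e * lift₃ Γ p a i e =
      ∑ q, ∑ s, ∑ d, (∑ e, frame p j e * coframe p e d) * (frame p q a * frame p s i * Γ p.1 q s d) := by
    simp only [h2, Finset.mul_sum, Finset.sum_mul]
    rw [Finset.sum_comm]
    refine Finset.sum_congr rfl fun _ _ ↦ ?_
    rw [Finset.sum_comm]
    refine Finset.sum_congr rfl fun _ _ ↦ ?_
    rw [Finset.sum_comm]
    exact Finset.sum_congr rfl fun _ _ ↦ Finset.sum_congr rfl fun _ _ ↦ by ring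
  rw [h3]
  simp [sum_frame_coframe (frame_mul_coframe hp)]

/-- Differentiating W M = 1 gives dW = -W dM W. It serves both for the dual frame and for the
inverse metric. -/
lemma horDeriv_matrix_inverse {M W : FrameSpace n → Matrix (Fin n) (Fin n) ℝ}
    (hM : ∀ i j, DifferentiableAt ℝ (fun q ↦ M q i j) p)
    (hW : ∀ i j, DifferentiableAt ℝ (fun q ↦ W q i j) p)
    (h : ∀ᶠ q in 𝓝 p, W q * M q = 1) (c d : Fin n) :
    horDeriv Γ a (fun q ↦ W q c d) p =
      -∑ e, (∑ f, W p c f * horDeriv Γ a (fun q ↦ M q f e) p) * W p e d := by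
  have h1 : ∀ e, ∑ f, horDeriv Γ a (fun q ↦ W q c f) p * M p f e =
      -∑ f, W p c f * horDeriv Γ a (fun q ↦ M q f e) p := by
    intro e
    have : horDeriv Γ a (fun q ↦ ∑ f, W q c f * M q f e) p = 0 := by
      rw [(horDeriv_congr Γ a (f' := fun _ ↦ (1 : Matrix (Fin n) (Fin n) ℝ) c e) ?_).eq_of_nhds,
        horDeriv_const]
      exact h.mono fun q hq ↦ by simp only [← Matrix.mul_apply, hq]
    rw [horDeriv_sum Γ a _ fun f _ ↦ (hW c f).fun_mul (hM f e)] at this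
    simp only [horDeriv_mul Γ a (hW c _) (hM _ e), Finset.sum_add_distrib] at this
    linarith
  have h2 : M p * W p = 1 := mul_eq_one_comm.1 h.self_of_nhds
  have h3 : horDeriv Γ a (fun q ↦ W q c d) p =
      ∑ e, (∑ f, horDeriv Γ a (fun q ↦ W q c f) p * M p f e) * W p e d := by
    simp only [Finset.sum_mul]
    rw [Finset.sum_comm]
    simp only [mul_assoc, ← Finset.mul_sum, sum_frame_coframe h2]
    simp
  rw [h3]
  simp only [h1, neg_mul, Finset.sum_neg_distrib]

lemma horDeriv_coframe (hp : (frame p).det ≠ 0) (c d : Fin n) :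
    horDeriv Γ a (fun q ↦ coframe q c d) p = ∑ e, lift₃ Γ p a e c * coframe p e d := by
  rw [horDeriv_matrix_inverse Γ a (M := frame) (fun i j ↦ differentiableAt_frame i j)
    (fun i j ↦ (contDiffAt_coframe hp i j).differentiableAt_of_smooth)
    ((eventually_frame_det hp).mono fun q hq ↦ coframe_mul_frame hq)]
  rw [← Finset.sum_neg_distrib]
  refine Finset.sum_congr rfl fun e _ ↦ ?_
  simp only [horDeriv_frame Γ a hp, mul_neg, Finset.sum_neg_distrib, neg_mul, neg_neg,
    Finset.mul_sum]
  rw [Finset.sum_comm]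
  simp only [← mul_assoc, ← Finset.sum_mul, sum_frame_coframe (coframe_mul_frame hp)]
  simp

/-- The horizontal derivatives of the components of a tensor field are the components of its
covariant derivative. -/
lemma horDeriv_lift {S : EuclideanSpace ℝ (Fin n) → (Fin r → Fin n) → Fin n → ℝ}
    (hp : (frame p).det ≠ 0) (hS : ∀ I c, DifferentiableAt ℝ (fun z ↦ S z I c) p.1)
    (I : Fin r → Fin n) (c : Fin n) :
    horDeriv Γ a (fun q ↦ lift S q I c) p = lift (covDeriv Γ S) p (Fin.cons a I) c := by
  have hS' : ∀ I c, DifferentiableAt ℝ (fun q : FrameSpace n ↦ S q.1 I c) p := fun I c ↦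
    (hS I c).comp p differentiableAt_fst
  have hθ : ∀ c d, DifferentiableAt ℝ (fun q : FrameSpace n ↦ coframe q c d) p := fun c d ↦
    (contDiffAt_coframe hp c d).differentiableAt_of_smooth
  have hP : ∀ J : Fin r → Fin n,
      DifferentiableAt ℝ (fun q : FrameSpace n ↦ ∏ s, frame q (J s) (I s)) p := fun J ↦
    (contDiffAt_prod fun s _ ↦ contDiffAt_frame _ _).differentiableAt_of_smooth
  -- The product rule reproduces the three parts of a covariant derivative: the coefficient gives
  -- the partial derivatives, the dual frame gives the connection term on the value, and each frame
  -- factor gives the correction in its slot.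
  have key : ∀ J d, horDeriv Γ a
      (fun q ↦ (∏ s, frame q (J s) (I s)) * coframe q c d * S q.1 J d) p =
      ∑ j, frame p j a * ((∏ s, frame p (J s) (I s)) * coframe p c d * pd j (fun z ↦ S z J d) p.1)
      + ∑ e, lift₃ Γ p a e c * ((∏ s, frame p (J s) (I s)) * coframe p e d * S p.1 J d)
      - ∑ s : Fin r, ∑ e, lift₃ Γ p a (I s) e *
          ((∏ s', frame p (J s') (Function.update I s e s')) * coframe p c d * S p.1 J d) := by
    intro J d
    have hp' : ∀ s e, ∏ s', frame p (J s') (Function.update I s e s') =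
        frame p (J s) e * ∏ s' ∈ Finset.univ.erase s, frame p (J s') (I s') := fun s e ↦ by
      simpa using prod_frame_update (P := frame p) s J I (J s) e
    rw [horDeriv_mul Γ a ((hP J).fun_mul (hθ c d)) (hS' J d), horDeriv_mul Γ a (hP J) (hθ c d),
      horDeriv_prod Γ a _ fun s _ ↦ differentiableAt_frame _ _, horDeriv_base Γ a (hS J d),
      horDeriv_coframe Γ a hp]
    simp only [horDeriv_frame Γ a hp, hp', Finset.mul_sum, Finset.sum_mul, add_mul, mul_neg,
      neg_mul, Finset.sum_neg_distrib]
    have e1 : ∀ x y z x' y' z' : ℝ, x = x' → y = y' → z = z' → -x + y + z = z' + y' - x' := by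
      intros; subst_vars; ring
    refine e1 _ _ _ _ _ _ ?_ ?_ ?_
    · exact Finset.sum_congr rfl fun _ _ ↦ Finset.sum_congr rfl fun _ _ ↦ by ring
    · exact Finset.sum_congr rfl fun _ _ ↦ by ring
    · exact Finset.sum_congr rfl fun _ _ ↦ by ring
  have hL : horDeriv Γ a (fun q ↦ lift S q I c) p = ∑ J, ∑ d, horDeriv Γ a
      (fun q ↦ (∏ s, frame q (J s) (I s)) * coframe q c d * S q.1 J d) p := by
    simp only [lift, frameComp]
    rw [horDeriv_sum Γ a _ fun J _ ↦ DifferentiableAt.fun_sum fun d _ ↦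
      ((hP J).fun_mul (hθ c d)).fun_mul (hS' J d)]
    refine Finset.sum_congr rfl fun J _ ↦ ?_
    rw [horDeriv_sum Γ a _ fun d _ ↦ ((hP J).fun_mul (hθ c d)).fun_mul (hS' J d)]
  have hR := frameComp_covDeriv (frame_mul_coframe hp) (Γ p.1)
    (fun j J d ↦ pd j (fun z ↦ S z J d) p.1) (S p.1) (Fin.cons a I) c
  simp only [Fin.cons_zero, Fin.tail_cons] at hR
  rw [hL]
  refine Eq.trans ?_ hR.symm
  simp only [key, Finset.sum_add_distrib, Finset.sum_sub_distrib, frameComp, Finset.mul_sum]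
  congr 1
  · congr 1
    · rw [Finset.sum_comm (s := (Finset.univ : Finset (Fin n)))]
      exact Finset.sum_congr rfl fun _ _ ↦ Finset.sum_comm
    · rw [Finset.sum_comm (s := (Finset.univ : Finset (Fin n)))]
      exact Finset.sum_congr rfl fun _ _ ↦ Finset.sum_comm
  · simp_rw [Finset.sum_comm (s := (Finset.univ : Finset (Fin n)))
      (t := (Finset.univ : Finset (Fin r → Fin n)))]
    rw [Finset.sum_comm (s := (Finset.univ : Finset (Fin r)))]
    refine Finset.sum_congr rfl fun _ _ ↦ ?_
    rw [Finset.sum_comm]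
    exact Finset.sum_congr rfl fun _ _ ↦ Finset.sum_comm

end FrameBundle

/-! ### Uniform bounds of iterated horizontal derivatives -/

section BddTo

variable {ι : Type*} {n r : ℕ} (Γ : ι → EuclideanSpace ℝ (Fin n) → Fin n → Fin n → Fin n → ℝ)
  (p : ι → FrameSpace n)

/-- A family of functions on the frame space is smooth at the given points, and its iterated
horizontal derivatives up to order `N` are bounded there, uniformly in the family. -/
def BddTo : ℕ → (ι → FrameSpace n → ℝ) → Prop
  | 0, f => (∀ l, ContDiffAt ℝ ∞ (f l) (p l)) ∧ ∃ C, ∀ l, |f l (p l)| ≤ C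
  | N + 1, f => ((∀ l, ContDiffAt ℝ ∞ (f l) (p l)) ∧ ∃ C, ∀ l, |f l (p l)| ≤ C) ∧
      ∀ a, BddTo N (fun l ↦ horDeriv (Γ l) a (f l))

variable {Γ p} {N : ℕ} {f f' : ι → FrameSpace n → ℝ}

lemma BddTo.zero (h : BddTo Γ p N f) : BddTo Γ p 0 f := by
  cases N with
  | zero => exact h
  | succ N => exact h.1

lemma BddTo.contDiffAt (h : BddTo Γ p N f) (l : ι) : ContDiffAt ℝ ∞ (f l) (p l) := h.zero.1 l

lemma BddTo.bound (h : BddTo Γ p N f) : ∃ C, ∀ l, |f l (p l)| ≤ C := h.zero.2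

lemma BddTo.mono {N' : ℕ} (h : BddTo Γ p N f) (hN : N' ≤ N) : BddTo Γ p N' f := by
  induction N' generalizing N f with
  | zero => exact h.zero
  | succ N' ih =>
    obtain ⟨N, rfl⟩ : ∃ N₀, N = N₀ + 1 := ⟨N - 1, by omega⟩
    exact ⟨h.zero, fun a ↦ ih (h.2 a) (by omega)⟩

/-- Agreement is required near the points and not only at them, because iterated derivatives see the
germ. -/
lemma BddTo.congr (h : BddTo Γ p N f) (hf : ∀ l, f l =ᶠ[𝓝 (p l)] f' l) : BddTo Γ p N f' := by
  have base : ∀ {f f' : ι → FrameSpace n → ℝ}, BddTo Γ p 0 f → (∀ l, f l =ᶠ[𝓝 (p l)] f' l) →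
      BddTo Γ p 0 f' := fun {f f'} h hf ↦
    ⟨fun l ↦ (h.1 l).congr_of_eventuallyEq (hf l).symm,
      h.2.imp fun C hC l ↦ (hf l).eq_of_nhds ▸ hC l⟩
  induction N generalizing f f' with
  | zero => exact base h hf
  | succ N ih => exact ⟨base h.zero hf, fun a ↦ ih (h.2 a) fun l ↦ horDeriv_congr _ a (hf l)⟩

/-- The local constant may vary with the member of the family, provided it is uniformly bounded; all
its derivatives vanish. -/
lemma BddTo.of_const {c : ι → ℝ} {C : ℝ} (hc : ∀ l, |c l| ≤ C)
    (hf : ∀ l, f l =ᶠ[𝓝 (p l)] fun _ ↦ c l) : BddTo Γ p N f := by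
  have base : ∀ {f : ι → FrameSpace n → ℝ} {c : ι → ℝ} {C : ℝ}, (∀ l, |c l| ≤ C) →
      (∀ l, f l =ᶠ[𝓝 (p l)] fun _ ↦ c l) → BddTo Γ p 0 f := fun {f c C} hc hf ↦
    ⟨fun l ↦ contDiffAt_const.congr_of_eventuallyEq (hf l),
      C, fun l ↦ by rw [(hf l).eq_of_nhds]; exact hc l⟩
  induction N generalizing f c C with
  | zero => exact base hc hf
  | succ N ih =>
    refine ⟨base hc hf, fun a ↦ ih (c := 0) (C := 0) (by simp) fun l ↦ ?_⟩
    refine (horDeriv_congr _ a (hf l)).trans (Filter.Eventually.of_forall fun q ↦ ?_)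
    exact horDeriv_const _ _ _

lemma BddTo.const (c : ℝ) : BddTo Γ p N (fun _ _ ↦ c) :=
  BddTo.of_const (c := fun _ ↦ c) (fun _ ↦ le_rfl) fun _ ↦ Filter.EventuallyEq.rfl

/-- A smooth function all of whose horizontal derivatives vanish is bounded to all orders as soon
as it is bounded. -/
lemma BddTo.of_parallel (h : BddTo Γ p 0 f)
    (hf : ∀ l a, horDeriv (Γ l) a (f l) =ᶠ[𝓝 (p l)] fun _ ↦ 0) : BddTo Γ p N f := by
  cases N with
  | zero => exact h
  | succ N => exact ⟨h, fun a ↦ BddTo.of_const (c := 0) (C := 0) (by simp) fun l ↦ hf l a⟩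

lemma BddTo.add (h : BddTo Γ p N f) (h' : BddTo Γ p N f') :
    BddTo Γ p N (fun l q ↦ f l q + f' l q) := by
  have base : ∀ {f f' : ι → FrameSpace n → ℝ}, BddTo Γ p 0 f → BddTo Γ p 0 f' →
      BddTo Γ p 0 (fun l q ↦ f l q + f' l q) := fun {f f'} h h' ↦ by
    obtain ⟨C, hC⟩ := h.2
    obtain ⟨C', hC'⟩ := h'.2
    exact ⟨fun l ↦ (h.1 l).add (h'.1 l), C + C', fun l ↦
      (abs_add_le _ _).trans (add_le_add (hC l) (hC' l))⟩
  induction N generalizing f f' with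
  | zero => exact base h h'
  | succ N ih =>
    refine ⟨base h.zero h'.zero, fun a ↦ (ih (h.2 a) (h'.2 a)).congr fun l ↦ ?_⟩
    filter_upwards [(h.contDiffAt l).eventually_differentiableAt,
      (h'.contDiffAt l).eventually_differentiableAt] with q h1 h2
    exact (horDeriv_add _ a h1 h2).symm

/-- By the Leibniz rule a derivative of the product is a sum of products in which both factors are
bounded to one order less. -/
lemma BddTo.mul (h : BddTo Γ p N f) (h' : BddTo Γ p N f') :
    BddTo Γ p N (fun l q ↦ f l q * f' l q) := by
  have base : ∀ {f f' : ι → FrameSpace n → ℝ}, BddTo Γ p 0 f → BddTo Γ p 0 f' →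
      BddTo Γ p 0 (fun l q ↦ f l q * f' l q) := fun {f f'} h h' ↦ by
    obtain ⟨C, hC⟩ := h.2
    obtain ⟨C', hC'⟩ := h'.2
    refine ⟨fun l ↦ (h.1 l).mul (h'.1 l), C * C', fun l ↦ ?_⟩
    rw [abs_mul]
    exact mul_le_mul (hC l) (hC' l) (abs_nonneg _) ((abs_nonneg _).trans (hC l))
  induction N generalizing f f' with
  | zero => exact base h h'
  | succ N ih =>
    refine ⟨base h.zero h'.zero, fun a ↦ ((ih (h.2 a) (h'.mono N.le_succ)).add
      (ih (h.mono N.le_succ) (h'.2 a))).congr fun l ↦ ?_⟩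
    filter_upwards [(h.contDiffAt l).eventually_differentiableAt,
      (h'.contDiffAt l).eventually_differentiableAt] with q h1 h2
    exact (horDeriv_mul _ a h1 h2).symm

lemma BddTo.const_mul (c : ℝ) (h : BddTo Γ p N f) : BddTo Γ p N (fun l q ↦ c * f l q) :=
  (BddTo.const c).mul h

lemma BddTo.neg (h : BddTo Γ p N f) : BddTo Γ p N (fun l q ↦ -f l q) := by
  simpa using h.const_mul (-1)

lemma BddTo.sub (h : BddTo Γ p N f) (h' : BddTo Γ p N f') :
    BddTo Γ p N (fun l q ↦ f l q - f' l q) := by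
  simpa only [sub_eq_add_neg] using h.add h'.neg

lemma BddTo.sum {κ : Type*} (s : Finset κ) {F : κ → ι → FrameSpace n → ℝ}
    (h : ∀ i ∈ s, BddTo Γ p N (F i)) : BddTo Γ p N (fun l q ↦ ∑ i ∈ s, F i l q) := by
  classical
  induction s using Finset.induction_on with
  | empty => simpa using BddTo.const 0
  | insert i s hi ih =>
    simp only [Finset.sum_insert hi]
    exact (h i (Finset.mem_insert_self i s)).add
      (ih fun j hj ↦ h j (Finset.mem_insert_of_mem hj))

end BddTo

/-! ### Bounds for polynomial expressions in arrays and matrices. -/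

section Arrays

variable {ι : Type*} {n r : ℕ} (Γ : ι → EuclideanSpace ℝ (Fin n) → Fin n → Fin n → Fin n → ℝ)
  (p : ι → FrameSpace n) (N : ℕ)

/-- Uniform bounds for the entries of a family of arrays. -/
def BddTo₃ (φ : ι → FrameSpace n → Fin n → Fin n → Fin n → ℝ) : Prop :=
  ∀ a b c, BddTo Γ p N (fun l q ↦ φ l q a b c)

/-- Uniform bounds for the entries of a family of matrices. -/
def BddToMat (M : ι → FrameSpace n → Matrix (Fin n) (Fin n) ℝ) : Prop :=
  ∀ a b, BddTo Γ p N (fun l q ↦ M l q a b)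

variable {Γ p N} {φ ψ : ι → FrameSpace n → Fin n → Fin n → Fin n → ℝ}
  {M₁ M₂ M₃ : ι → FrameSpace n → Matrix (Fin n) (Fin n) ℝ}

lemma BddTo₃.mono {N' : ℕ} (h : BddTo₃ Γ p N φ) (hN : N' ≤ N) : BddTo₃ Γ p N' φ :=
  fun a b c ↦ (h a b c).mono hN

lemma BddTo₃.congr (h : BddTo₃ Γ p N φ) (hf : ∀ l, φ l =ᶠ[𝓝 (p l)] ψ l) : BddTo₃ Γ p N ψ :=
  fun a b c ↦ (h a b c).congr fun l ↦ (hf l).mono fun _ hq ↦ by simp only [hq]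

lemma BddTo₃.add (h : BddTo₃ Γ p N φ) (h' : BddTo₃ Γ p N ψ) :
    BddTo₃ Γ p N (fun l q ↦ φ l q + ψ l q) := fun a b c ↦ (h a b c).add (h' a b c)

lemma BddTo₃.sub (h : BddTo₃ Γ p N φ) (h' : BddTo₃ Γ p N ψ) :
    BddTo₃ Γ p N (fun l q ↦ φ l q - ψ l q) := fun a b c ↦ (h a b c).sub (h' a b c)

lemma BddTo₃.neg (h : BddTo₃ Γ p N φ) : BddTo₃ Γ p N (fun l q ↦ -φ l q) :=
  fun a b c ↦ (h a b c).neg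

lemma BddTo₃.smul (t : ℝ) (h : BddTo₃ Γ p N φ) : BddTo₃ Γ p N (fun l q ↦ t • φ l q) :=
  fun a b c ↦ (h a b c).const_mul t

lemma BddTo₃.swap₁₂ (h : BddTo₃ Γ p N φ) : BddTo₃ Γ p N (fun l q ↦ swap₁₂ (φ l q)) :=
  fun a b c ↦ h b a c

lemma BddTo₃.rot (h : BddTo₃ Γ p N φ) : BddTo₃ Γ p N (fun l q ↦ rot (φ l q)) :=
  fun a b c ↦ h b c a

lemma BddTo₃.comp3 (h : BddTo₃ Γ p N φ) (h₁ : BddToMat Γ p N M₁) (h₂ : BddToMat Γ p N M₂)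
    (h₃ : BddToMat Γ p N M₃) :
    BddTo₃ Γ p N (fun l q ↦ comp3 (φ l q) (M₁ l q) (M₂ l q) (M₃ l q)) := by
  intro a b c
  simp only [comp3_apply]
  exact BddTo.sum _ fun i _ ↦ BddTo.sum _ fun j _ ↦ BddTo.sum _ fun k _ ↦
    (((h₁ _ _).mul (h₂ _ _)).mul (h₃ _ _)).mul (h _ _ _)

lemma BddToMat.one : BddToMat Γ p N (fun _ _ ↦ 1) := fun _ _ ↦ BddTo.const _

lemma BddToMat.transpose (h : BddToMat Γ p N M₁) :
    BddToMat Γ p N (fun l q ↦ (M₁ l q).transpose) := fun a b ↦ h b a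

/-- The array is polynomial in the entries of the metric, of J and of the derivative of J; no
inverse matrix enters before the last index is raised. -/
lemma BddTo₃.gauduchonArray (t : ℝ) (hg : BddToMat Γ p N M₁) (hJ : BddToMat Γ p N M₂)
    (h : BddTo₃ Γ p N φ) :
    BddTo₃ Γ p N (fun l q ↦ gauduchonArray t (M₁ l q) (M₂ l q) (φ l q)) := by
  have h1 := BddToMat.one (Γ := Γ) (p := p) (N := N)
  have hk := h.comp3 h1 h1 hg
  have hdc := ((hk.add hk.rot).add hk.rot.rot).comp3 hJ hJ hJ
  have hN1 := h.comp3 hJ h1 h1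
  have hN2 := h.comp3 h1 h1 hJ.transpose
  have hN := (hN1.sub hN1.swap₁₂).sub (hN2.sub hN2.swap₁₂)
  have hm := (((hdc.sub (hdc.comp3 hJ hJ h1)).sub (hdc.comp3 hJ h1 hJ)).sub
    (hdc.comp3 h1 hJ hJ)).smul (1 / 4)
  have hp := hdc.sub hm
  have := ((((hp.comp3 h1 hJ hJ).smul (-((t + 1) / 4))).sub (hp.smul ((t - 1) / 4))).sub
    ((hN.comp3 h1 h1 hg.transpose).rot.smul (1 / 4))).sub (hm.smul (1 / 2))
  simpa only [TensorCalculus.gauduchonArray, gauduchonForm, plusPart_eq, minusPart_eq, dOmegaArray,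
    nijenhuisArray] using this

end Arrays

/-! ### Bounds for tensor fields and their transfer to another connection. -/

section Transfer

variable {ι : Type*} {n r : ℕ} (Γ : ι → EuclideanSpace ℝ (Fin n) → Fin n → Fin n → Fin n → ℝ)
  (p : ι → FrameSpace n)

/-- Uniform bounds for the components, in all frames, of a family of tensor fields. -/
def LiftBdd (N : ℕ) (S : ι → EuclideanSpace ℝ (Fin n) → (Fin r → Fin n) → Fin n → ℝ) : Prop :=
  ∀ I c, BddTo Γ p N (fun l q ↦ lift (S l) q I c)

variable {Γ p} {N : ℕ} {S S' : ι → EuclideanSpace ℝ (Fin n) → (Fin r → Fin n) → Fin n → ℝ}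

lemma LiftBdd.mono {N' : ℕ} (h : LiftBdd Γ p N S) (hN : N' ≤ N) : LiftBdd Γ p N' S :=
  fun I c ↦ (h I c).mono hN

lemma lift_congr {S S' : EuclideanSpace ℝ (Fin n) → (Fin r → Fin n) → Fin n → ℝ}
    {q : FrameSpace n} (h : S =ᶠ[𝓝 q.1] S') : lift S =ᶠ[𝓝 q] lift S' :=
  (continuous_fst.continuousAt.eventually h).mono fun z hz ↦ by simp only [lift, hz]

lemma LiftBdd.congr (h : LiftBdd Γ p N S) (hS : ∀ l, S l =ᶠ[𝓝 (p l).1] S' l) :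
    LiftBdd Γ p N S' :=
  fun I c ↦ (h I c).congr fun l ↦ (lift_congr (hS l)).mono fun q hq ↦ by simp only [hq]

lemma horDeriv_lift_eventuallyEq (Γ : EuclideanSpace ℝ (Fin n) → Fin n → Fin n → Fin n → ℝ)
    {S : EuclideanSpace ℝ (Fin n) → (Fin r → Fin n) → Fin n → ℝ} {q : FrameSpace n}
    (hq : (frame q).det ≠ 0) (hS : SmoothAt S q.1) (a : Fin n) (I : Fin r → Fin n) (c : Fin n) :
    horDeriv Γ a (fun q ↦ lift S q I c) =ᶠ[𝓝 q]
      fun q ↦ lift (covDeriv Γ S) q (Fin.cons a I) c := by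
  have h : ∀ᶠ z in 𝓝 q.1, ∀ I c, DifferentiableAt ℝ (fun z ↦ S z I c) z :=
    Filter.eventually_all.2 fun I ↦ Filter.eventually_all.2 fun c ↦
      (hS I c).eventually_differentiableAt
  filter_upwards [eventually_frame_det hq, continuous_fst.continuousAt.eventually h] with z h1 h2
  exact horDeriv_lift Γ a h1 h2 I c

/-- The components of the covariant derivative are horizontal derivatives of the components, so
exactly one order is lost. -/
lemma LiftBdd.covDeriv (hp : ∀ l, (frame (p l)).det ≠ 0) (hS : ∀ l, SmoothAt (S l) (p l).1)
    (h : LiftBdd Γ p (N + 1) S) : LiftBdd Γ p N (fun l ↦ covDeriv (Γ l) (S l)) := by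
  intro I c
  refine ((h (Fin.tail I) c).2 (I 0)).congr fun l ↦ ?_
  refine (horDeriv_lift_eventuallyEq (Γ l) (hp l) (hS l) _ _ _).trans ?_
  rw [Fin.cons_self_tail]

/-- Bounds on the components of the iterated covariant derivatives at the given points are uniform
bounds for the components. -/
lemma LiftBdd.of_iterCovDeriv (hp : ∀ l, (frame (p l)).det ≠ 0)
    (hΓ : ∀ l, SmoothAt₃ (Γ l) (p l).1) (hS : ∀ l, SmoothAt (S l) (p l).1)
    (h : ∀ j ≤ N, ∃ C, ∀ l I c, |lift (iterCovDeriv (Γ l) (S l) j) (p l) I c| ≤ C) :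
    LiftBdd Γ p N S := by
  -- The number j of derivatives already taken and the remaining order d are balanced: a horizontal
  -- derivative raises j and lowers d, keeping j + d = N.
  suffices H : ∀ d j, j + d = N → LiftBdd Γ p d (fun l ↦ iterCovDeriv (Γ l) (S l) j) from
    H N 0 (by simp)
  have base : ∀ j ≤ N, LiftBdd Γ p 0 (fun l ↦ iterCovDeriv (Γ l) (S l) j) := by
    intro j hj I c
    obtain ⟨C, hC⟩ := h j hj
    exact ⟨fun l ↦ ((hS l).iterCovDeriv (hΓ l) j).contDiffAt_lift (hp l) I c, C,
      fun l ↦ hC l I c⟩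
  intro d
  induction d with
  | zero => exact fun j hj ↦ base j (by omega)
  | succ d ih =>
    intro j hj I c
    refine ⟨base j (by omega) I c, fun a ↦ (ih (j + 1) (by omega) (Fin.cons a I) c).congr
      fun l ↦ ?_⟩
    exact (horDeriv_lift_eventuallyEq (Γ l) (hp l) ((hS l).iterCovDeriv (hΓ l) j) a I c).symm

section Algebra

variable {P Q : Matrix (Fin n) (Fin n) ℝ}

lemma comp3_frame_eq (A : Fin n → Fin n → Fin n → ℝ) (a b c : Fin n) :
    comp3 A P P Q.transpose a b c = ∑ j, P j a * frameEnd P Q (A j) b c := by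
  simp only [comp3_apply, frameEnd, Finset.mul_sum, Matrix.transpose_apply, mul_assoc]

lemma frameComp_cons_end (h : P * Q = 1) (A : Fin n → Fin n → Fin n → ℝ)
    (S : (Fin r → Fin n) → Fin n → ℝ) (I : Fin (r + 1) → Fin n) (c : Fin n) :
    frameComp P Q (fun J c ↦ ∑ d, A (J 0) d c * S (Fin.tail J) d) I c =
      ∑ e, comp3 A P P Q.transpose (I 0) e c * frameComp P Q S (Fin.tail I) e := by
  rw [frameComp_cons]
  simp only [Fin.cons_zero, Fin.tail_cons, frameComp_end h, comp3_frame_eq, Finset.mul_sum,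
    Finset.sum_mul]
  rw [Finset.sum_comm]
  exact Finset.sum_congr rfl fun _ _ ↦ Finset.sum_congr rfl fun _ _ ↦ by ring

lemma frameComp_cons_slot (h : P * Q = 1) (A : Fin n → Fin n → Fin n → ℝ) (s : Fin r)
    (S : (Fin r → Fin n) → Fin n → ℝ) (I : Fin (r + 1) → Fin n) (c : Fin n) :
    frameComp P Q (fun J c ↦ ∑ d, A (J 0) (Fin.tail J s) d *
        S (Function.update (Fin.tail J) s d) c) I c =
      ∑ e, comp3 A P P Q.transpose (I 0) (Fin.tail I s) e *
        frameComp P Q S (Function.update (Fin.tail I) s e) c := by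
  rw [frameComp_cons]
  simp only [Fin.cons_zero, Fin.tail_cons, frameComp_slot h, comp3_frame_eq, Finset.mul_sum,
    Finset.sum_mul]
  rw [Finset.sum_comm]
  exact Finset.sum_congr rfl fun _ _ ↦ Finset.sum_congr rfl fun _ _ ↦ by ring

end Algebra

variable {A : ι → EuclideanSpace ℝ (Fin n) → Fin n → Fin n → Fin n → ℝ}

/-- In any invertible frame the contraction is the same polynomial in the components of both
factors, so the algebra property of `BddTo` applies. -/
lemma LiftBdd.endo (hp : ∀ l, (frame (p l)).det ≠ 0)
    (hA : BddTo₃ Γ p N (fun l ↦ lift₃ (A l))) (hS : LiftBdd Γ p N S) :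
    LiftBdd Γ p N (fun l y (I : Fin (r + 1) → Fin n) c ↦
      ∑ d, A l y (I 0) d c * S l y (Fin.tail I) d) := by
  intro I c
  refine BddTo.congr (BddTo.sum Finset.univ fun e _ ↦
    (hA (I 0) e c).mul (hS (Fin.tail I) e)) fun l ↦ ?_
  filter_upwards [eventually_frame_det (hp l)] with q hq
  exact (frameComp_cons_end (frame_mul_coframe hq) (A l q.1) (S l q.1) I c).symm

lemma LiftBdd.slot (hp : ∀ l, (frame (p l)).det ≠ 0)
    (hA : BddTo₃ Γ p N (fun l ↦ lift₃ (A l))) (hS : LiftBdd Γ p N S) (s : Fin r) :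
    LiftBdd Γ p N (fun l y (I : Fin (r + 1) → Fin n) c ↦
      ∑ d, A l y (I 0) (Fin.tail I s) d * S l y (Function.update (Fin.tail I) s d) c) := by
  intro I c
  refine BddTo.congr (BddTo.sum Finset.univ fun e _ ↦
    (hA (I 0) (Fin.tail I s) e).mul (hS (Function.update (Fin.tail I) s e) c)) fun l ↦ ?_
  filter_upwards [eventually_frame_det (hp l)] with q hq
  exact (frameComp_cons_slot (frame_mul_coframe hq) (A l q.1) s (S l q.1) I c).symm

lemma LiftBdd.add (h : LiftBdd Γ p N S) (h' : LiftBdd Γ p N S') :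
    LiftBdd Γ p N (fun l y I c ↦ S l y I c + S' l y I c) := by
  intro I c
  simpa only [lift, frameComp_add] using (h I c).add (h' I c)

lemma LiftBdd.sub (h : LiftBdd Γ p N S) (h' : LiftBdd Γ p N S') :
    LiftBdd Γ p N (fun l y I c ↦ S l y I c - S' l y I c) := by
  intro I c
  simpa only [lift, frameComp_sub] using (h I c).sub (h' I c)

lemma LiftBdd.sum {κ : Type*} (s : Finset κ)
    {F : κ → ι → EuclideanSpace ℝ (Fin n) → (Fin r → Fin n) → Fin n → ℝ}
    (h : ∀ i ∈ s, LiftBdd Γ p N (F i)) : LiftBdd Γ p N (fun l y I c ↦ ∑ i ∈ s, F i l y I c) := by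
  intro I c
  simpa only [lift, frameComp_sum] using BddTo.sum s fun i hi ↦ h i hi I c

lemma LiftBdd.perm (h : LiftBdd Γ p N S) (σ : Equiv.Perm (Fin r)) :
    LiftBdd Γ p N (fun l y I c ↦ S l y (I ∘ σ) c) := by
  intro I c
  simpa only [lift, frameComp_comp_perm] using h (I ∘ σ) c

lemma covDeriv_add (Γ A : EuclideanSpace ℝ (Fin n) → Fin n → Fin n → Fin n → ℝ)
    (S : EuclideanSpace ℝ (Fin n) → (Fin r → Fin n) → Fin n → ℝ) :
    TensorCalculus.covDeriv (Γ + A) S = fun y I c ↦ TensorCalculus.covDeriv Γ S y I c +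
      ((∑ d, A y (I 0) d c * S y (Fin.tail I) d) -
      ∑ s : Fin r, ∑ d, A y (I 0) (Fin.tail I s) d * S y (Function.update (Fin.tail I) s d) c) := by
  funext y I c
  simp only [TensorCalculus.covDeriv, Pi.add_apply, add_mul, Finset.sum_add_distrib]
  ring

/-- Uniform bounds for the covariant derivative with respect to another connection. -/
lemma LiftBdd.covDeriv_add (hp : ∀ l, (frame (p l)).det ≠ 0) (hS : ∀ l, SmoothAt (S l) (p l).1)
    (hA : BddTo₃ Γ p N (fun l ↦ lift₃ (A l))) (h : LiftBdd Γ p (N + 1) S) :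
    LiftBdd Γ p N (fun l ↦ TensorCalculus.covDeriv (Γ l + A l) (S l)) := by
  simp only [TensorCalculus.covDeriv_add]
  have h' := h.mono N.le_succ
  exact (h.covDeriv hp hS).add ((h'.endo hp hA).sub (LiftBdd.sum _ fun s _ ↦ h'.slot hp hA s))

/-- Uniform bounds for the iterated covariant derivatives with respect to another connection. -/
lemma LiftBdd.iterCovDeriv_add {M : ℕ} (hp : ∀ l, (frame (p l)).det ≠ 0)
    (hΓ : ∀ l, SmoothAt₃ (Γ l) (p l).1) (hA' : ∀ l, SmoothAt₃ (A l) (p l).1)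
    (hS : ∀ l, SmoothAt (S l) (p l).1) (hA : BddTo₃ Γ p M (fun l ↦ lift₃ (A l)))
    (h : LiftBdd Γ p N S) (hMN : N ≤ M + 1) (i d : ℕ) (hi : i + d = N) :
    LiftBdd Γ p d (fun l ↦ iterCovDeriv (Γ l + A l) (S l) i) := by
  induction i generalizing d with
  | zero => obtain rfl : d = N := by omega
            exact h
  | succ i ih =>
    exact (ih (d + 1) (by omega)).covDeriv_add hp
      (fun l ↦ (hS l).iterCovDeriv (fun i j k ↦ (hΓ l i j k).add (hA' l i j k)) i)
      (hA.mono (by omega))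

/-- The tensor field of type `(2, 1)` of an array. -/
def ofArray (A : EuclideanSpace ℝ (Fin n) → Fin n → Fin n → Fin n → ℝ) :
    EuclideanSpace ℝ (Fin n) → (Fin 2 → Fin n) → Fin n → ℝ := fun y I c ↦ A y (I 0) (I 1) c

lemma lift_ofArray (A : EuclideanSpace ℝ (Fin n) → Fin n → Fin n → Fin n → ℝ) (q : FrameSpace n)
    (I : Fin 2 → Fin n) (c : Fin n) : lift (ofArray A) q I c = lift₃ A q (I 0) (I 1) c :=
  frameComp_two (A q.1) I c

lemma liftBdd_ofArray : LiftBdd Γ p N (fun l ↦ ofArray (A l)) ↔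
    BddTo₃ Γ p N (fun l ↦ lift₃ (A l)) := by
  simp only [LiftBdd, lift_ofArray]
  exact ⟨fun h a b c ↦ by simpa using h ![a, b] c, fun h I c ↦ h _ _ _⟩

/-- With the sign convention in force, the change of curvature is -(∇_X A)(Y, Z) - A(X, A(Y, Z)),
plus the same with X and Y exchanged and the sign reversed, minus A(T(X, Y), Z). The torsion T of Γ
appears because ∇A also differentiates the slots of A filled by X and Y. -/
lemma curvature_add (Γ A : EuclideanSpace ℝ (Fin n) → Fin n → Fin n → Fin n → ℝ)
    (y : EuclideanSpace ℝ (Fin n))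
    (hΓ : ∀ i j k, DifferentiableAt ℝ (fun z ↦ Γ z i j k) y)
    (hA : ∀ i j k, DifferentiableAt ℝ (fun z ↦ A z i j k) y) (I : Fin 3 → Fin n) (c : Fin n) :
    curvature (Γ + A) y I c = curvature Γ y I c
      - (TensorCalculus.covDeriv Γ (ofArray A) y I c
        + ∑ d, A y (I 0) d c * ofArray A y (Fin.tail I) d)
      + (TensorCalculus.covDeriv Γ (ofArray A) y (I ∘ Equiv.swap 0 1) c
        + ∑ d, A y ((I ∘ Equiv.swap (0 : Fin 3) 1) 0) d c *
          ofArray A y (Fin.tail (I ∘ Equiv.swap (0 : Fin 3) 1)) d)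
      - ∑ d, (Γ y (I 0) (Fin.tail I 0) d - Γ y (Fin.tail I 0) (I 0) d) *
          ofArray A y (Function.update (Fin.tail I) 0 d) c := by
  have hpd : ∀ a i j k, pd a (fun z ↦ Γ z i j k + A z i j k) y =
      pd a (fun z ↦ Γ z i j k) y + pd a (fun z ↦ A z i j k) y := by
    intro a i j k
    simp only [pd, fderiv_fun_add (hΓ i j k) (hA i j k)]
    rfl
  have e2 : (Equiv.swap (0 : Fin 3) 1) 2 = 2 := by decide
  have t0 : ∀ J : Fin 3 → Fin n, Fin.tail J 0 = J 1 := fun _ ↦ rfl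
  have t1 : ∀ J : Fin 3 → Fin n, Fin.tail J 1 = J 2 := fun _ ↦ rfl
  have hAA : ∀ i j k, ∑ d, A y i j d * A y k d c = ∑ d, A y k d c * A y i j d := fun i j k ↦
    Finset.sum_congr rfl fun _ _ ↦ mul_comm _ _
  simp only [curvature, TensorCalculus.covDeriv, ofArray, Fin.sum_univ_two, Pi.add_apply, hpd,
    Function.update_self, ne_eq, one_ne_zero, not_false_eq_true, Function.update_of_ne,
    zero_ne_one, t0, t1, Function.comp, Equiv.swap_apply_left, Equiv.swap_apply_right, e2, add_mul,
    mul_add, sub_mul, Finset.sum_add_distrib, Finset.sum_sub_distrib,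
    mul_comm (A y _ _ _) (Γ y _ _ _), hAA (I 1) (I 2) (I 0), hAA (I 0) (I 2) (I 1)]
  ring

/-- Uniform bounds for the curvature of another connection. -/
lemma LiftBdd.curvature_add (hp : ∀ l, (frame (p l)).det ≠ 0)
    (hΓ : ∀ l, SmoothAt₃ (Γ l) (p l).1) (hA' : ∀ l, SmoothAt₃ (A l) (p l).1)
    (hA : BddTo₃ Γ p (N + 1) (fun l ↦ lift₃ (A l)))
    (hT : LiftBdd Γ p N (fun l ↦ torsion (Γ l)))
    (h : LiftBdd Γ p N (fun l ↦ curvature (Γ l))) :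
    LiftBdd Γ p N (fun l ↦ curvature (Γ l + A l)) := by
  have hA1 := hA.mono N.le_succ
  have hAN := liftBdd_ofArray.2 hA1
  have h1 : LiftBdd Γ p N (fun l ↦ TensorCalculus.covDeriv (Γ l) (ofArray (A l))) :=
    (liftBdd_ofArray.2 hA).covDeriv hp fun l I c ↦ hA' l _ _ _
  have h2 := h1.add (hAN.endo hp hA1)
  -- The last correction term contracts the torsion with A, so the torsion is read as an array.
  have hT' : BddTo₃ Γ p N (fun l ↦ lift₃ (fun y a b c ↦ Γ l y a b c - Γ l y b a c)) :=
    liftBdd_ofArray.1 hT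
  have h3 := ((h.sub h2).add (h2.perm (Equiv.swap 0 1))).sub (hAN.slot hp hT' 0)
  refine h3.congr fun l ↦ ?_
  have e1 : ∀ {A : EuclideanSpace ℝ (Fin n) → Fin n → Fin n → Fin n → ℝ}
      {y : EuclideanSpace ℝ (Fin n)}, SmoothAt₃ A y →
      ∀ᶠ z in 𝓝 y, ∀ i j k, DifferentiableAt ℝ (fun z ↦ A z i j k) z := fun hA ↦
    Filter.eventually_all.2 fun i ↦ Filter.eventually_all.2 fun j ↦
      Filter.eventually_all.2 fun k ↦ (hA i j k).eventually_differentiableAt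
  filter_upwards [e1 (hΓ l), e1 (hA' l)] with y hy hy'
  funext I c
  exact (TensorCalculus.curvature_add (Γ l) (A l) y hy hy' I c).symm

lemma LiftBdd.torsion_add (hA : BddTo₃ Γ p N (fun l ↦ lift₃ (A l)))
    (hT : LiftBdd Γ p N (fun l ↦ torsion (Γ l))) :
    LiftBdd Γ p N (fun l ↦ torsion (Γ l + A l)) := by
  have hAN := liftBdd_ofArray.2 hA
  refine (hT.add (hAN.sub (hAN.perm (Equiv.swap 0 1)))).congr fun l ↦ ?_
  refine Filter.Eventually.of_forall fun y ↦ ?_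
  funext I c
  simp only [torsion, ofArray, Pi.add_apply, Function.comp, Equiv.swap_apply_left,
    Equiv.swap_apply_right]
  ring

end Transfer

/-! ### The Levi-Civita and the Gauduchon connections in coordinates -/

section AlmostHermitian

variable {n : ℕ}

/-- First-order regularity and the algebraic relations of the coordinate expressions of an
almost-Hermitian structure near a point. -/
structure AlmostHermitianNear (g J : EuclideanSpace ℝ (Fin n) → Matrix (Fin n) (Fin n) ℝ)
    (y : EuclideanSpace ℝ (Fin n)) : Prop where
  diff_g : ∀ i j, DifferentiableAt ℝ (fun z ↦ g z i j) y
  diff_J : ∀ i j, DifferentiableAt ℝ (fun z ↦ J z i j) y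
  symm : ∀ᶠ z in 𝓝 y, (g z).transpose = g z
  det : (g y).det ≠ 0
  J_sq : ∀ᶠ z in 𝓝 y, J z * J z = -1
  compat : ∀ᶠ z in 𝓝 y, (J z).transpose * g z * J z = g z

/-- The array of the partial derivatives of the entries of a matrix. -/
noncomputable def pdArray (g : EuclideanSpace ℝ (Fin n) → Matrix (Fin n) (Fin n) ℝ)
    (y : EuclideanSpace ℝ (Fin n)) : Fin n → Fin n → Fin n → ℝ :=
  fun a b c ↦ pd a (fun z ↦ g z b c) y

/-- The array of the covariant derivative of an endomorphism field. -/
noncomputable def covDerivEnd (Γ : EuclideanSpace ℝ (Fin n) → Fin n → Fin n → Fin n → ℝ)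
    (J : EuclideanSpace ℝ (Fin n) → Matrix (Fin n) (Fin n) ℝ) (y : EuclideanSpace ℝ (Fin n)) :
    Fin n → Fin n → Fin n → ℝ :=
  swap₂₃ (pdArray J y) + comp3 (Γ y) 1 (J y) 1 - comp3 (Γ y) 1 1 (J y).transpose

lemma covDeriv_end (Γ : EuclideanSpace ℝ (Fin n) → Fin n → Fin n → Fin n → ℝ)
    (J : EuclideanSpace ℝ (Fin n) → Matrix (Fin n) (Fin n) ℝ) :
    covDeriv (r := 1) Γ (fun y I c ↦ J y c (I 0)) = ofArray (covDerivEnd Γ J) := by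
  funext y I c
  simp [covDeriv, ofArray, covDerivEnd, swap₂₃, pdArray, comp3_apply, Matrix.one_apply, Fin.tail,
    mul_comm]

/-- The connection with symbols `Γ` preserves the metric `g`. -/
def IsMetric (Γ : EuclideanSpace ℝ (Fin n) → Fin n → Fin n → Fin n → ℝ)
    (g : EuclideanSpace ℝ (Fin n) → Matrix (Fin n) (Fin n) ℝ) (y : EuclideanSpace ℝ (Fin n)) :
    Prop :=
  pdArray g y = comp3 (Γ y) 1 1 (g y) + swap₂₃ (comp3 (Γ y) 1 1 (g y))

lemma pd_congr {f f' : EuclideanSpace ℝ (Fin n) → ℝ} {y : EuclideanSpace ℝ (Fin n)}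
    (h : f =ᶠ[𝓝 y] f') (a : Fin n) : pd a f y = pd a f' y := by
  rw [pd, pd, h.fderiv_eq]

lemma pd_mul {f f' : EuclideanSpace ℝ (Fin n) → ℝ} {y : EuclideanSpace ℝ (Fin n)}
    (hf : DifferentiableAt ℝ f y) (hf' : DifferentiableAt ℝ f' y) (a : Fin n) :
    pd a (fun z ↦ f z * f' z) y = pd a f y * f' y + f y * pd a f' y := by
  simp [pd, fderiv_fun_mul hf hf']
  ring

lemma pd_sum {κ : Type*} (s : Finset κ) {f : κ → EuclideanSpace ℝ (Fin n) → ℝ}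
    {y : EuclideanSpace ℝ (Fin n)} (hf : ∀ i ∈ s, DifferentiableAt ℝ (f i) y) (a : Fin n) :
    pd a (fun z ↦ ∑ i ∈ s, f i z) y = ∑ i ∈ s, pd a (f i) y := by
  simp [pd, fderiv_fun_sum hf]

lemma pd_neg (f : EuclideanSpace ℝ (Fin n) → ℝ) (y : EuclideanSpace ℝ (Fin n)) (a : Fin n) :
    pd a (fun z ↦ -f z) y = -pd a f y := by
  simp [pd, fderiv_fun_neg]

variable {g J : EuclideanSpace ℝ (Fin n) → Matrix (Fin n) (Fin n) ℝ}
  {y : EuclideanSpace ℝ (Fin n)}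

namespace AlmostHermitianNear

variable (h : AlmostHermitianNear g J y)
include h

lemma g_symm : (g y).transpose = g y := h.symm.self_of_nhds

lemma J_sq' : J y * J y = -1 := h.J_sq.self_of_nhds

lemma inv_mul : (g y)⁻¹ * g y = 1 := Matrix.nonsing_inv_mul _ (isUnit_iff_ne_zero.2 h.det)

lemma mul_inv : g y * (g y)⁻¹ = 1 := Matrix.mul_nonsing_inv _ (isUnit_iff_ne_zero.2 h.det)

lemma inv_symm : ((g y)⁻¹).transpose = (g y)⁻¹ := by
  rw [Matrix.transpose_nonsing_inv, h.g_symm]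

lemma eventually_transpose_mul :
    ∀ᶠ z in 𝓝 y, (J z).transpose * g z = -(g z * J z) := by
  filter_upwards [h.J_sq, h.compat] with z h1 h2
  have : (J z).transpose * g z * J z * J z = g z * J z := by rw [h2]
  rw [Matrix.mul_assoc, h1, Matrix.mul_neg, Matrix.mul_one] at this
  rw [← this, neg_neg]

lemma transpose_mul : (J y).transpose * g y = -(g y * J y) :=
  h.eventually_transpose_mul.self_of_nhds

lemma J_mul_inv : J y * (g y)⁻¹ = -((g y)⁻¹ * (J y).transpose) := by
  have : (g y)⁻¹ * ((J y).transpose * g y) * (g y)⁻¹ = (g y)⁻¹ * (-(g y * J y)) * (g y)⁻¹ := by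
    rw [h.transpose_mul]
  rw [Matrix.mul_assoc, Matrix.mul_assoc, h.mul_inv, Matrix.mul_one, Matrix.mul_neg,
    ← Matrix.mul_assoc, h.inv_mul, Matrix.one_mul, Matrix.neg_mul] at this
  rw [this, neg_neg]

lemma pdArray_symm : swap₂₃ (pdArray g y) = pdArray g y := by
  ext a b c
  exact pd_congr (h.symm.mono fun z hz ↦ congrFun (congrFun hz b) c) a

lemma leviCivita_eq : leviCivita g y = comp3 ((1 / 2 : ℝ) •
    (pdArray g y + swap₁₂ (pdArray g y) - rot (rot (pdArray g y)))) 1 1 (g y)⁻¹ := by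
  ext a b c
  have hs : ∀ d, (g y)⁻¹ d c = (g y)⁻¹ c d := fun d ↦ congrFun (congrFun h.inv_symm c) d
  simp only [leviCivita, comp3_apply, Matrix.one_apply, Pi.smul_apply, Pi.add_apply, Pi.sub_apply,
    smul_eq_mul, swap₁₂, rot, pdArray, hs, Finset.mul_sum]
  simp
  exact Finset.sum_congr rfl fun _ _ ↦ by ring

lemma lower_leviCivita : comp3 (leviCivita g y) 1 1 (g y) = (1 / 2 : ℝ) •
    (pdArray g y + swap₁₂ (pdArray g y) - rot (rot (pdArray g y))) := by
  rw [h.leviCivita_eq, comp3_comp3, h.inv_mul, Matrix.mul_one, comp3_one]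

lemma swap₁₂_leviCivita : swap₁₂ (leviCivita g y) = leviCivita g y := by
  rw [h.leviCivita_eq, ← comp3_swap₁₂]
  congr 1
  ext a b c
  have hs : pdArray g y c a b = pdArray g y c b a :=
    congrFun (congrFun (congrFun h.pdArray_symm c) b) a
  simp only [swap₁₂, rot, Pi.smul_apply, Pi.add_apply, Pi.sub_apply, smul_eq_mul, hs]
  ring

lemma leviCivita_isMetric : IsMetric (leviCivita g) g y := by
  have hs : ∀ a b c, pdArray g y a b c = pdArray g y a c b := fun a b c ↦
    congrFun (congrFun (congrFun h.pdArray_symm a) c) b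
  rw [IsMetric, h.lower_leviCivita]
  ext a b c
  simp only [swap₁₂, swap₂₃, rot, Pi.smul_apply, Pi.add_apply, Pi.sub_apply, smul_eq_mul,
    hs a c b, hs b a c, hs c a b]
  ring

/-- The partial derivatives in N_J may be replaced by Levi-Civita derivatives: the connection terms
cancel by the symmetry of the Christoffel symbols. -/
lemma nijenhuis_eq : nijenhuis J y =
    nijenhuisArray (J y) (covDerivEnd (leviCivita g) J y) := by
  have h1 : nijenhuis J y = nijenhuisArray (J y) (swap₂₃ (pdArray J y)) := by
    ext a b c
    simp only [nijenhuis, nijenhuisArray, comp3_apply, Matrix.one_apply, Pi.sub_apply, swap₁₂,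
      swap₂₃, pdArray, Finset.sum_sub_distrib, mul_sub, Matrix.transpose_apply]
    simp
  have hs : ∀ M₁ M₂ M₃ a b c, comp3 (leviCivita g y) M₁ M₂ M₃ b a c =
      comp3 (leviCivita g y) M₂ M₁ M₃ a b c := by
    intro M₁ M₂ M₃ a b c
    conv_lhs => rw [← h.swap₁₂_leviCivita, comp3_swap₁₂]
    rfl
  rw [h1]
  ext a b c
  simp only [nijenhuisArray, covDerivEnd, comp3_add, comp3_sub, comp3_comp3, Matrix.mul_one,
    Matrix.one_mul]
  simp only [Pi.add_apply, Pi.sub_apply, swap₁₂, hs _ _ _ a b c]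
  ring

lemma pd_fundForm : (fun a b c ↦ pd a (fun z ↦ fundForm g J z b c) y) =
    comp3 (swap₂₃ (pdArray J y)) 1 1 (g y) + comp3 (pdArray g y) 1 (J y) 1 := by
  ext a b c
  simp only [fundForm]
  rw [pd_sum _ fun p _ ↦ (h.diff_J p b).fun_mul (h.diff_g p c)]
  simp only [pd_mul (h.diff_J _ b) (h.diff_g _ c), Finset.sum_add_distrib, comp3_apply,
    Matrix.one_apply, swap₂₃, pdArray, Pi.add_apply]
  simp [mul_comm]

/-- Since D^g is metric, ∂ω is the lowered derivative of J plus two connection terms. Those two are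
interchanged up to sign by exchanging the last two slots, and their cyclic sum vanishes by symmetry
of the symbols. -/
lemma pd_fundForm' : (fun a b c ↦ pd a (fun z ↦ fundForm g J z b c) y) =
    comp3 (covDerivEnd (leviCivita g) J y) 1 1 (g y)
      + swap₂₃ (comp3 (leviCivita g y) 1 1 (g y * J y))
      - comp3 (leviCivita g y) 1 1 (g y * J y) := by
  rw [h.pd_fundForm, h.leviCivita_isMetric]
  simp only [covDerivEnd, comp3_add, comp3_sub, comp3_swap₂₃, comp3_comp3, Matrix.mul_one,
    Matrix.one_mul, h.transpose_mul, comp3_neg₃]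
  abel

lemma extDeriv₂_fundForm : extDeriv₂ (fundForm g J) y =
    dOmegaArray (g y) (covDerivEnd (leviCivita g) J y) := by
  have h1 : extDeriv₂ (fundForm g J) y = (fun a b c ↦ pd a (fun z ↦ fundForm g J z b c) y)
      + rot (fun a b c ↦ pd a (fun z ↦ fundForm g J z b c) y)
      + rot (rot (fun a b c ↦ pd a (fun z ↦ fundForm g J z b c) y)) := rfl
  have hs : ∀ M₁ M₂ M₃ a b c, comp3 (leviCivita g y) M₁ M₂ M₃ b a c =
      comp3 (leviCivita g y) M₂ M₁ M₃ a b c := by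
    intro M₁ M₂ M₃ a b c
    conv_lhs => rw [← h.swap₁₂_leviCivita, comp3_swap₁₂]
    rfl
  rw [h1, h.pd_fundForm', dOmegaArray]
  ext a b c
  simp only [Pi.add_apply, Pi.sub_apply, rot, swap₂₃, hs _ _ _ a b c, hs _ _ _ b c a,
    hs _ _ _ a c b]
  ring

/-- This is the derivative of J² = -1. -/
lemma covDerivEnd_anticomm :
    comp3 (covDerivEnd (leviCivita g) J y) 1 1 (J y).transpose =
      -comp3 (covDerivEnd (leviCivita g) J y) 1 (J y) 1 := by
  have h1 : comp3 (swap₂₃ (pdArray J y)) 1 1 (J y).transpose +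
      comp3 (swap₂₃ (pdArray J y)) 1 (J y) 1 = 0 := by
    ext a b c
    have h2 : pd a (fun z ↦ ∑ p, J z c p * J z p b) y = 0 := by
      rw [pd_congr (f' := fun _ ↦ (-1 : Matrix (Fin n) (Fin n) ℝ) c b)
        (h.J_sq.mono fun z hz ↦ by simp only [← Matrix.mul_apply, hz])]
      simp [pd]
    rw [pd_sum _ fun p _ ↦ (h.diff_J c p).fun_mul (h.diff_J p b)] at h2
    simp only [pd_mul (h.diff_J c _) (h.diff_J _ b), Finset.sum_add_distrib] at h2
    rw [Pi.zero_apply, Pi.zero_apply, Pi.zero_apply, ← h2, add_comm]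
    simp only [comp3_apply, Matrix.one_apply, swap₂₃, pdArray, Pi.add_apply,
      Matrix.transpose_apply]
    simp [mul_comm]
  have hT : (J y).transpose * (J y).transpose = -1 := by
    rw [← Matrix.transpose_mul, h.J_sq', Matrix.transpose_neg, Matrix.transpose_one]
  rw [eq_neg_iff_add_eq_zero]
  simp only [covDerivEnd, comp3_add, comp3_sub, comp3_comp3, Matrix.mul_one,
    Matrix.one_mul, hT, h.J_sq', comp3_neg₂, comp3_neg₃]
  rw [← h1]
  abel

/-- The form ω is skew near the point, hence so are its partial derivatives; the connection terms of
`pd_fundForm'` are skew by themselves. -/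
lemma covDerivEnd_skew :
    swap₂₃ (comp3 (covDerivEnd (leviCivita g) J y) 1 1 (g y)) =
      -comp3 (covDerivEnd (leviCivita g) J y) 1 1 (g y) := by
  have hω : ∀ a b c, pd a (fun z ↦ fundForm g J z c b) y =
      -pd a (fun z ↦ fundForm g J z b c) y := by
    intro a b c
    rw [← pd_neg]
    refine pd_congr ?_ a
    filter_upwards [h.eventually_transpose_mul, h.symm] with z h1 h2
    have e1 : fundForm g J z = (J z).transpose * g z := by
      ext b c; simp [fundForm, Matrix.mul_apply]
    have e2 : ((J z).transpose * g z).transpose = -((J z).transpose * g z) := by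
      rw [Matrix.transpose_mul, Matrix.transpose_transpose, h2, h1, neg_neg]
    rw [e1]
    exact congrFun (congrFun e2 b) c
  ext a b c
  have e1 := congrFun (congrFun (congrFun h.pd_fundForm' a) b) c
  have e2 := congrFun (congrFun (congrFun h.pd_fundForm' a) c) b
  simp only [Pi.add_apply, Pi.sub_apply, swap₂₃, hω a b c] at e1 e2
  simp only [swap₂₃, Pi.neg_apply]
  linarith

lemma gauduchonTerm_eq_array (t : ℝ) : gauduchonTerm t g J y =
    gauduchonArray t (g y) (J y) (covDerivEnd (leviCivita g) J y) := by
  rw [gauduchonTerm_eq, h.nijenhuis_eq, h.extDeriv₂_fundForm, gauduchonArray]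

end AlmostHermitianNear

/-- The symbols of the difference of the Gauduchon and the Levi-Civita connections. -/
noncomputable def gauduchonDiff (t : ℝ) (g J : EuclideanSpace ℝ (Fin n) → Matrix (Fin n) (Fin n) ℝ)
    (y : EuclideanSpace ℝ (Fin n)) : Fin n → Fin n → Fin n → ℝ :=
  comp3 (gauduchonTerm t g J y) 1 1 ((g y)⁻¹).transpose

lemma gauduchon_eq (t : ℝ) (g J : EuclideanSpace ℝ (Fin n) → Matrix (Fin n) (Fin n) ℝ) :
    gauduchon t g J = leviCivita g + gauduchonDiff t g J := by
  ext y a b c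
  simp [gauduchon, gauduchonDiff, comp3_apply, Matrix.one_apply]

namespace AlmostHermitianNear

variable (h : AlmostHermitianNear g J y) (t : ℝ)
include h

lemma lower_gauduchonDiff : comp3 (gauduchonDiff t g J y) 1 1 (g y) = gauduchonTerm t g J y := by
  rw [gauduchonDiff, comp3_comp3, h.inv_symm, h.inv_mul, Matrix.mul_one, comp3_one]

/-- Skewness in the last two slots says that adding this tensor to a metric connection leaves it
metric. -/
lemma gauduchonTerm_skew : swap₂₃ (gauduchonTerm t g J y) = -gauduchonTerm t g J y := by
  rw [h.gauduchonTerm_eq_array]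
  exact (gauduchonArray_parallel t (g y) (J y) _ h.J_sq' h.g_symm h.transpose_mul
    h.covDerivEnd_anticomm h.covDerivEnd_skew).2

/-- The Gauduchon connection preserves the complex structure. -/
lemma covDerivEnd_gauduchon : covDerivEnd (gauduchon t g J) J y = 0 := by
  have h1 := (gauduchonArray_parallel t (g y) (J y) _ h.J_sq' h.g_symm h.transpose_mul
    h.covDerivEnd_anticomm h.covDerivEnd_skew).1
  rw [← h.gauduchonTerm_eq_array] at h1
  -- Raising the last index turns the lowered identity into the vanishing of the derivative of J; J
  -- passes through the inverse metric up to a sign and a transpose.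
  have h2 := congrArg (fun φ ↦ comp3 φ 1 1 (g y)⁻¹) h1
  simp only [comp3_add, comp3_comp3, Matrix.mul_one, Matrix.one_mul, h.mul_inv, comp3_one,
    h.J_mul_inv, comp3_neg₃] at h2
  have h3 : comp3 (0 : Fin n → Fin n → Fin n → ℝ) 1 1 (g y)⁻¹ = 0 := by
    simpa using comp3_smul (0 : Fin n → Fin n → Fin n → ℝ) 1 1 (g y)⁻¹ 0
  rw [h3] at h2
  rw [← h2]
  simp only [covDerivEnd, gauduchon_eq, Pi.add_apply, comp3_add, gauduchonDiff, comp3_comp3,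
    Matrix.mul_one, Matrix.one_mul, h.inv_symm]
  abel

/-- The Gauduchon connection preserves the metric. -/
lemma gauduchon_isMetric : IsMetric (gauduchon t g J) g y := by
  rw [IsMetric, gauduchon_eq, Pi.add_apply, comp3_add, h.lower_gauduchonDiff,
    h.leviCivita_isMetric]
  have : ∀ φ ψ : Fin n → Fin n → Fin n → ℝ, swap₂₃ (φ + ψ) = swap₂₃ φ + swap₂₃ ψ :=
    fun _ _ ↦ rfl
  rw [this, h.gauduchonTerm_skew]
  abel

/-- The lowered difference of the Gauduchon and the Levi-Civita connections is the contorsion. -/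
lemma gauduchonTerm_eq_contorsion : gauduchonTerm t g J y = (1 / 2 : ℝ) •
    (comp3 (fun a b c ↦ gauduchon t g J y a b c - gauduchon t g J y b a c) 1 1 (g y)
    - rot (comp3 (fun a b c ↦ gauduchon t g J y a b c - gauduchon t g J y b a c) 1 1 (g y))
    + rot (rot (comp3 (fun a b c ↦ gauduchon t g J y a b c - gauduchon t g J y b a c)
      1 1 (g y)))) := by
  -- The Levi-Civita connection has no torsion, so the torsion is the skew part of the difference
  -- tensor. Skewness in the other pair of slots then allows one to solve for that tensor, as in the
  -- Koszul formula.
  have h1 : (fun a b c ↦ gauduchon t g J y a b c - gauduchon t g J y b a c) =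
      gauduchonDiff t g J y - swap₁₂ (gauduchonDiff t g J y) := by
    ext a b c
    have := congrFun (congrFun (congrFun h.swap₁₂_leviCivita a) b) c
    simp only [swap₁₂] at this
    simp only [gauduchon_eq, Pi.add_apply, Pi.sub_apply, swap₁₂, this]
    ring
  have hs : ∀ a b c, gauduchonTerm t g J y a b c = -gauduchonTerm t g J y a c b := fun a b c ↦
    congrFun (congrFun (congrFun (h.gauduchonTerm_skew t) a) c) b
  rw [h1, comp3_sub, comp3_swap₁₂, h.lower_gauduchonDiff]
  ext a b c
  simp only [swap₁₂, rot, Pi.smul_apply, Pi.add_apply, Pi.sub_apply, smul_eq_mul, hs a c b,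
    hs b a c, hs c b a]
  ring

end AlmostHermitianNear

end AlmostHermitian

/-! ### Norms and orthonormal frames -/

section Norm

variable {n r : ℕ}

/-- The norm of a tensor is the Euclidean norm of its components in an orthonormal frame. -/
lemma tensorNorm_eq {g P Q : Matrix (Fin n) (Fin n) ℝ} (hPQ : P * Q = 1)
    (hg : P.transpose * g * P = 1) (S : (Fin r → Fin n) → Fin n → ℝ) :
    tensorNorm g S = Real.sqrt (∑ I, ∑ c, frameComp P Q S I c ^ 2) := by
  have hQP : Q * P = 1 := mul_eq_one_comm.1 hPQ
  have hT : Q.transpose * P.transpose = 1 := by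
    rw [← Matrix.transpose_mul, hPQ, Matrix.transpose_one]
  have hT' : P.transpose * Q.transpose = 1 := by
    rw [← Matrix.transpose_mul, hQP, Matrix.transpose_one]
  have h1 : g = Q.transpose * Q := by
    calc g = Q.transpose * P.transpose * g * (P * Q) := by rw [hT, hPQ]; simp
      _ = Q.transpose * (P.transpose * g * P) * Q := by simp only [Matrix.mul_assoc]
      _ = _ := by rw [hg, Matrix.mul_one]
  have h2 : g⁻¹ = P * P.transpose := by
    refine Matrix.inv_eq_left_inv ?_
    rw [h1, Matrix.mul_assoc, ← Matrix.mul_assoc P.transpose, hT', Matrix.one_mul, hPQ]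
  -- Each factor of the inverse metric is a sum over the frame; expanding the product of these sums
  -- yields one sum over multi-indices K.
  have h3 : ∀ I I' : Fin r → Fin n, ∏ s, g⁻¹ (I s) (I' s) =
      ∑ K : Fin r → Fin n, (∏ s, P (I s) (K s)) * ∏ s, P (I' s) (K s) := by
    intro I I'
    simp only [h2, Matrix.mul_apply, Matrix.transpose_apply, Finset.prod_univ_sum,
      Fintype.piFinset_univ, Finset.prod_mul_distrib]
  have h4 : ∀ c c', g c c' = ∑ e, Q e c * Q e c' := fun c c' ↦ by
    rw [h1, Matrix.mul_apply]; rfl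
  rw [tensorNorm]
  congr 1
  have h5 : ∀ K e, frameComp P Q S K e ^ 2 = ∑ I, ∑ I', ∑ c, ∑ c',
      (∏ s, P (I s) (K s)) * (∏ s, P (I' s) (K s)) * (Q e c * Q e c') * S I c * S I' c' := by
    intro K e
    rw [sq, frameComp, Finset.sum_mul_sum]
    refine Finset.sum_congr rfl fun I _ ↦ Finset.sum_congr rfl fun I' _ ↦ ?_
    rw [Finset.sum_mul_sum]
    exact Finset.sum_congr rfl fun c _ ↦ Finset.sum_congr rfl fun c' _ ↦ by ring
  have h6 : ∀ I I' c c', (∏ s, g⁻¹ (I s) (I' s)) * g c c' * S I c * S I' c' =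
      ∑ K : Fin r → Fin n, ∑ e,
      (∏ s, P (I s) (K s)) * (∏ s, P (I' s) (K s)) * (Q e c * Q e c') * S I c * S I' c' := by
    intro I I' c c'
    rw [h3, h4, Finset.sum_mul_sum, Finset.sum_mul, Finset.sum_mul]
    refine Finset.sum_congr rfl fun K _ ↦ ?_
    rw [Finset.sum_mul, Finset.sum_mul]
  simp only [h5, h6]
  have h7 : ∀ {X Y : Type} [Fintype X] [Fintype Y] (F : X → Y → (Fin r → Fin n) →
      (Fin r → Fin n) → Fin n → Fin n → ℝ),
      ∑ I, ∑ I', ∑ c, ∑ c', ∑ x, ∑ y, F x y I I' c c' =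
        ∑ x, ∑ y, ∑ I, ∑ I', ∑ c, ∑ c', F x y I I' c c' := by
    intro X Y _ _ F
    simp only [← Fintype.sum_prod_type' (α₁ := X) (α₂ := Y)]
    symm
    rw [Finset.sum_comm]
    refine Finset.sum_congr rfl fun _ _ ↦ ?_
    rw [Finset.sum_comm]
    refine Finset.sum_congr rfl fun _ _ ↦ ?_
    rw [Finset.sum_comm]
    exact Finset.sum_congr rfl fun _ _ ↦ Finset.sum_comm
  exact h7 _

lemma tensorNorm_nonneg (g : Matrix (Fin n) (Fin n) ℝ) (S : (Fin r → Fin n) → Fin n → ℝ) :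
    0 ≤ tensorNorm g S := Real.sqrt_nonneg _

/-- With `tensorNorm_le`, this makes bounds on the norm and on the components in an orthonormal
frame equivalent, with constants free of the metric. -/
lemma abs_frameComp_le {g P Q : Matrix (Fin n) (Fin n) ℝ} (hPQ : P * Q = 1)
    (hg : P.transpose * g * P = 1) (S : (Fin r → Fin n) → Fin n → ℝ) (I : Fin r → Fin n)
    (c : Fin n) : |frameComp P Q S I c| ≤ tensorNorm g S := by
  rw [tensorNorm_eq hPQ hg]
  refine Real.abs_le_sqrt ?_
  refine (Finset.single_le_sum (f := fun c ↦ frameComp P Q S I c ^ 2) (fun _ _ ↦ sq_nonneg _)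
    (Finset.mem_univ c)).trans ?_
  exact Finset.single_le_sum (f := fun I ↦ ∑ c, frameComp P Q S I c ^ 2)
    (fun _ _ ↦ Finset.sum_nonneg fun _ _ ↦ sq_nonneg _) (Finset.mem_univ I)

lemma tensorNorm_le {g P Q : Matrix (Fin n) (Fin n) ℝ} (hPQ : P * Q = 1)
    (hg : P.transpose * g * P = 1) (S : (Fin r → Fin n) → Fin n → ℝ) :
    tensorNorm g S ≤ ∑ I, ∑ c, |frameComp P Q S I c| := by
  rw [tensorNorm_eq hPQ hg]
  simp only [← Fintype.sum_prod_type']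
  refine Real.sqrt_le_iff.2 ⟨Finset.sum_nonneg fun _ _ ↦ abs_nonneg _, ?_⟩
  simp only [← sq_abs (frameComp _ _ _ _ _)]
  exact Finset.sum_sq_le_sq_sum_of_nonneg fun _ _ ↦ abs_nonneg _

-- A positive definite g factors as BᵀB, and the columns of B⁻¹ are orthonormal.
open scoped MatrixOrder in
lemma exists_orthonormal_frame {g : Matrix (Fin n) (Fin n) ℝ} (hg : g.PosDef) :
    ∃ P : Matrix (Fin n) (Fin n) ℝ, P.det ≠ 0 ∧ P.transpose * g * P = 1 := by
  obtain ⟨B, hB⟩ := CStarAlgebra.nonneg_iff_eq_star_mul_self.1 hg.posSemidef.nonneg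
  rw [Matrix.star_eq_conjTranspose, Matrix.conjTranspose_eq_transpose_of_trivial] at hB
  have hdet : B.det ≠ 0 := by
    intro h0
    have := hg.det_pos
    rw [hB, Matrix.det_mul, h0, mul_zero] at this
    exact lt_irrefl _ this
  have h1 : B * B⁻¹ = 1 := Matrix.mul_nonsing_inv _ (isUnit_iff_ne_zero.2 hdet)
  refine ⟨B⁻¹, ?_, ?_⟩
  · rw [Matrix.det_nonsing_inv, Ring.inverse_eq_inv']
    exact inv_ne_zero hdet
  · rw [hB, Matrix.mul_assoc, Matrix.mul_assoc, h1, Matrix.mul_one, ← Matrix.transpose_mul, h1,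
      Matrix.transpose_one]

end Norm

/-! ### Smoothness of the coordinate expressions. -/

section AlmostHermitian

variable {n : ℕ}

/-- The coordinate expressions of an almost-Hermitian structure near a point: smoothness and
algebraic relations. -/
structure AlmostHermitianAt (g J : EuclideanSpace ℝ (Fin n) → Matrix (Fin n) (Fin n) ℝ)
    (y : EuclideanSpace ℝ (Fin n)) : Prop where
  smooth_g : ∀ i j, ContDiffAt ℝ ∞ (fun z ↦ g z i j) y
  smooth_J : ∀ i j, ContDiffAt ℝ ∞ (fun z ↦ J z i j) y
  symm : ∀ᶠ z in 𝓝 y, (g z).transpose = g z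
  posDef : (g y).PosDef
  J_sq : ∀ᶠ z in 𝓝 y, J z * J z = -1
  compat : ∀ᶠ z in 𝓝 y, (J z).transpose * g z * J z = g z

/-- The first-order identities must hold on a whole neighbourhood, since horizontal derivatives of
every order are taken of them. -/
lemma AlmostHermitianAt.eventually_near
    {g J : EuclideanSpace ℝ (Fin n) → Matrix (Fin n) (Fin n) ℝ} {y : EuclideanSpace ℝ (Fin n)}
    (h : AlmostHermitianAt g J y) : ∀ᶠ z in 𝓝 y, AlmostHermitianNear g J z := by
  filter_upwards [Filter.eventually_all.2 fun i ↦ Filter.eventually_all.2 fun j ↦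
      (h.smooth_g i j).eventually_differentiableAt, Filter.eventually_all.2 fun i ↦
      Filter.eventually_all.2 fun j ↦ (h.smooth_J i j).eventually_differentiableAt,
    h.symm.eventually_nhds, h.J_sq.eventually_nhds, h.compat.eventually_nhds,
    eventually_det_ne_zero h.smooth_g h.posDef.det_pos.ne'] with z h1 h2 h3 h4 h5 h6
  exact ⟨h1, h2, h3, h6, h4, h5⟩

section Smooth

variable {Γ A B : EuclideanSpace ℝ (Fin n) → Fin n → Fin n → Fin n → ℝ}
  {M₁ M₂ M₃ : EuclideanSpace ℝ (Fin n) → Matrix (Fin n) (Fin n) ℝ}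
  {y : EuclideanSpace ℝ (Fin n)}

lemma SmoothAt₃.add (hA : SmoothAt₃ A y) (hB : SmoothAt₃ B y) :
    SmoothAt₃ (fun z ↦ A z + B z) y := fun i j k ↦ (hA i j k).add (hB i j k)

lemma SmoothAt₃.sub (hA : SmoothAt₃ A y) (hB : SmoothAt₃ B y) :
    SmoothAt₃ (fun z ↦ A z - B z) y := fun i j k ↦ (hA i j k).sub (hB i j k)

lemma SmoothAt₃.neg (hA : SmoothAt₃ A y) : SmoothAt₃ (-A) y := fun i j k ↦ (hA i j k).neg

lemma SmoothAt₃.smul (t : ℝ) (hA : SmoothAt₃ A y) : SmoothAt₃ (fun z ↦ t • A z) y :=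
  fun i j k ↦ contDiffAt_const.mul (hA i j k)

lemma SmoothAt₃.rot (hA : SmoothAt₃ A y) : SmoothAt₃ (fun z ↦ rot (A z)) y :=
  fun i j k ↦ hA j k i

lemma SmoothAt₃.comp3 (hA : SmoothAt₃ A y) (h₁ : ∀ i j, ContDiffAt ℝ ∞ (fun z ↦ M₁ z i j) y)
    (h₂ : ∀ i j, ContDiffAt ℝ ∞ (fun z ↦ M₂ z i j) y)
    (h₃ : ∀ i j, ContDiffAt ℝ ∞ (fun z ↦ M₃ z i j) y) :
    SmoothAt₃ (fun z ↦ comp3 (A z) (M₁ z) (M₂ z) (M₃ z)) y := by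
  intro a b c
  simp only [comp3_apply]
  exact ContDiffAt.sum fun i _ ↦ ContDiffAt.sum fun j _ ↦ ContDiffAt.sum fun k _ ↦
    (((h₁ _ _).mul (h₂ _ _)).mul (h₃ _ _)).mul (hA _ _ _)

lemma SmoothAt₃.curvature (hΓ : SmoothAt₃ Γ y) : SmoothAt (curvature Γ) y := by
  intro I c
  refine ContDiffAt.add (ContDiffAt.neg (ContDiffAt.add ?_ ?_)) (ContDiffAt.add ?_ ?_)
  · exact contDiffAt_pd (hΓ _ _ _) _
  · exact ContDiffAt.sum fun d _ ↦ (hΓ _ _ _).mul (hΓ _ _ _)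
  · exact contDiffAt_pd (hΓ _ _ _) _
  · exact ContDiffAt.sum fun d _ ↦ (hΓ _ _ _).mul (hΓ _ _ _)

lemma SmoothAt₃.torsion (hΓ : SmoothAt₃ Γ y) : SmoothAt (torsion Γ) y :=
  fun _ _ ↦ (hΓ _ _ _).sub (hΓ _ _ _)

end Smooth

namespace AlmostHermitianAt

variable {g J : EuclideanSpace ℝ (Fin n) → Matrix (Fin n) (Fin n) ℝ}
  {y : EuclideanSpace ℝ (Fin n)} (h : AlmostHermitianAt g J y)
include h

lemma smooth_inv (i j : Fin n) : ContDiffAt ℝ ∞ (fun z ↦ (g z)⁻¹ i j) y :=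
  contDiffAt_matrix_inv h.smooth_g h.posDef.det_pos.ne' i j

lemma smoothAt_leviCivita : SmoothAt₃ (leviCivita g) y := by
  intro a b c
  refine contDiffAt_const.mul (ContDiffAt.sum fun d _ ↦ (h.smooth_inv c d).mul ?_)
  exact ((contDiffAt_pd (h.smooth_g _ _) _).add (contDiffAt_pd (h.smooth_g _ _) _)).sub
    (contDiffAt_pd (h.smooth_g _ _) _)

lemma smoothAt_end : SmoothAt (r := 1) (fun z I c ↦ J z c (I 0)) y :=
  fun _ _ ↦ h.smooth_J _ _

lemma smoothAt_gauduchonDiff (t : ℝ) : SmoothAt₃ (gauduchonDiff t g J) y := by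
  have h1 : ∀ i j : Fin n, ContDiffAt ℝ ∞
      (fun _ : EuclideanSpace ℝ (Fin n) ↦ (1 : Matrix (Fin n) (Fin n) ℝ) i j) y :=
    fun i j ↦ contDiffAt_const
  have hω : ∀ a b, ContDiffAt ℝ ∞ (fun z ↦ fundForm g J z a b) y := fun a b ↦
    ContDiffAt.sum fun p _ ↦ (h.smooth_J p a).mul (h.smooth_g p b)
  have hd : SmoothAt₃ (extDeriv₂ (fundForm g J)) y := fun a b c ↦
    ((contDiffAt_pd (hω _ _) _).add (contDiffAt_pd (hω _ _) _)).add (contDiffAt_pd (hω _ _) _)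
  have hN : SmoothAt₃ (nijenhuis J) y := by
    intro a b c
    refine ContDiffAt.sub (ContDiffAt.sum fun p _ ↦ ?_) (ContDiffAt.sum fun p _ ↦ ?_)
    · exact ((h.smooth_J _ _).mul (contDiffAt_pd (h.smooth_J _ _) _)).sub
        ((h.smooth_J _ _).mul (contDiffAt_pd (h.smooth_J _ _) _))
    · exact (h.smooth_J _ _).mul
        ((contDiffAt_pd (h.smooth_J _ _) _).sub (contDiffAt_pd (h.smooth_J _ _) _))
  have hJ := h.smooth_J
  have hdc := hd.comp3 hJ hJ hJ
  have hm := (((hdc.sub (hdc.comp3 hJ hJ h1)).sub (hdc.comp3 hJ h1 hJ)).sub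
    (hdc.comp3 h1 hJ hJ)).smul (1 / 4)
  have hp := hdc.sub hm
  have key := (((((hp.comp3 h1 hJ hJ).smul (-((t + 1) / 4))).sub (hp.smul ((t - 1) / 4))).sub
    ((hN.comp3 h1 h1 (M₃ := fun z ↦ (g z).transpose) fun i j ↦ h.smooth_g j i).rot.smul
      (1 / 4))).sub (hm.smul (1 / 2))).comp3 h1 h1
      (M₃ := fun z ↦ ((g z)⁻¹).transpose) fun i j ↦ h.smooth_inv j i
  intro a b c
  simpa only [gauduchonDiff, gauduchonTerm_eq, gauduchonForm, plusPart_eq, minusPart_eq]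
    using key a b c

lemma smoothAt_gauduchon (t : ℝ) : SmoothAt₃ (gauduchon t g J) y := by
  rw [gauduchon_eq]
  exact h.smoothAt_leviCivita.add (h.smoothAt_gauduchonDiff t)

end AlmostHermitianAt

end AlmostHermitian

/-! ### The metric, J and the difference tensor in orthonormal frames. -/

section AlmostHermitian

variable {n : ℕ}

/-- The Gram matrices of the frames. -/
def metricLift (g : EuclideanSpace ℝ (Fin n) → Matrix (Fin n) (Fin n) ℝ) (q : FrameSpace n) :
    Matrix (Fin n) (Fin n) ℝ := (frame q).transpose * g q.1 * frame q

/-- The inverses of the Gram matrices of the frames. -/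
noncomputable def cometricLift (g : EuclideanSpace ℝ (Fin n) → Matrix (Fin n) (Fin n) ℝ)
    (q : FrameSpace n) : Matrix (Fin n) (Fin n) ℝ :=
  coframe q * (g q.1)⁻¹ * (coframe q).transpose

/-- The matrices of an endomorphism field in the frames. -/
noncomputable def endLift (J : EuclideanSpace ℝ (Fin n) → Matrix (Fin n) (Fin n) ℝ)
    (q : FrameSpace n) : Matrix (Fin n) (Fin n) ℝ := coframe q * J q.1 * frame q

lemma lift_end (J : EuclideanSpace ℝ (Fin n) → Matrix (Fin n) (Fin n) ℝ) (q : FrameSpace n)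
    (I : Fin 1 → Fin n) (c : Fin n) :
    lift (r := 1) (fun y I c ↦ J y c (I 0)) q I c = endLift J q c (I 0) :=
  frameComp_one (J q.1) I c

/-- Parallel transport of a metric connection preserves inner products, so the Gram matrix is
constant in horizontal directions. -/
lemma horDeriv_metricLift {Γ : EuclideanSpace ℝ (Fin n) → Fin n → Fin n → Fin n → ℝ}
    {g : EuclideanSpace ℝ (Fin n) → Matrix (Fin n) (Fin n) ℝ} {q : FrameSpace n}
    (hg : ∀ i j, DifferentiableAt ℝ (fun z ↦ g z i j) q.1) (hs : (g q.1).transpose = g q.1)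
    (hm : IsMetric Γ g q.1) (a b c : Fin n) :
    horDeriv Γ a (fun q ↦ metricLift g q b c) q = 0 := by
  have hP : ∀ i b, DifferentiableAt ℝ (fun q : FrameSpace n ↦ frame q i b) q := fun i b ↦
    differentiableAt_frame i b
  have hg' : ∀ i j, DifferentiableAt ℝ (fun q : FrameSpace n ↦ g q.1 i j) q := fun i j ↦
    (hg i j).comp q differentiableAt_fst
  have e1 : (fun q : FrameSpace n ↦ metricLift g q b c) =
      fun q ↦ ∑ i, ∑ j, frame q i b * frame q j c * g q.1 i j := by
    funext q
    simp only [metricLift, Matrix.mul_apply, Matrix.transpose_apply, Finset.sum_mul]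
    rw [Finset.sum_comm]
    exact Finset.sum_congr rfl fun _ _ ↦ Finset.sum_congr rfl fun _ _ ↦ by ring
  have e2 : horDeriv Γ a (fun q ↦ metricLift g q b c) q =
      comp3 (pdArray g q.1) (frame q) (frame q) (frame q) a b c
      - comp3 (Γ q.1) (frame q) (frame q) (g q.1 * frame q) a b c
      - comp3 (Γ q.1) (frame q) (frame q) ((g q.1).transpose * frame q) a c b := by
    rw [e1, horDeriv_sum Γ a _ fun i _ ↦ DifferentiableAt.fun_sum fun j _ ↦
      ((hP i b).fun_mul (hP j c)).fun_mul (hg' i j)]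
    have e3 : ∀ i, horDeriv Γ a (fun q ↦ ∑ j, frame q i b * frame q j c * g q.1 i j) q =
        ∑ j, (∑ k, frame q k a * frame q i b * frame q j c * pd k (fun z ↦ g z i j) q.1
          - ∑ k, ∑ s, frame q k a * frame q s b * (g q.1 i j * frame q j c) * Γ q.1 k s i
          - ∑ k, ∑ s, frame q k a * frame q s c * (g q.1 i j * frame q i b) * Γ q.1 k s j) := by
      intro i
      rw [horDeriv_sum Γ a _ fun j _ ↦ ((hP i b).fun_mul (hP j c)).fun_mul (hg' i j)]
      refine Finset.sum_congr rfl fun j _ ↦ ?_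
      rw [horDeriv_mul Γ a ((hP i b).fun_mul (hP j c)) (hg' i j), horDeriv_mul Γ a (hP i b) (hP j c),
        horDeriv_base Γ a (hg i j), horDeriv_frame', horDeriv_frame']
      simp only [neg_mul, mul_neg, add_mul, Finset.mul_sum, Finset.sum_mul]
      have e4 : ∀ x y z x' y' z' : ℝ, x = x' → y = y' → z = z' → -x + -y + z = z' - x' - y' := by
        intros; subst_vars; ring
      refine e4 _ _ _ _ _ _ ?_ ?_ ?_
      · exact Finset.sum_congr rfl fun _ _ ↦ Finset.sum_congr rfl fun _ _ ↦ by ring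
      · exact Finset.sum_congr rfl fun _ _ ↦ Finset.sum_congr rfl fun _ _ ↦ by ring
      · exact Finset.sum_congr rfl fun _ _ ↦ by ring
    have r1 : ∀ F : Fin n → Fin n → Fin n → ℝ, ∑ i, ∑ j, ∑ k, F i j k = ∑ k, ∑ i, ∑ j, F i j k := by
      intro F
      rw [Finset.sum_comm (s := (Finset.univ : Finset (Fin n)))]
      rw [Finset.sum_comm]
      refine (Finset.sum_congr rfl fun i _ ↦ Finset.sum_comm).trans ?_
      exact Finset.sum_comm
    have r2 : ∀ F : Fin n → Fin n → Fin n → Fin n → ℝ, ∑ i, ∑ j, ∑ k, ∑ s, F i j k s =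
        ∑ k, ∑ s, ∑ i, ∑ j, F i j k s := by
      intro F
      rw [r1]
      exact Finset.sum_congr rfl fun k _ ↦ r1 _
    simp only [e3, Finset.sum_sub_distrib]
    congr 1
    · congr 1
      · rw [r1]
        simp only [comp3_apply, pdArray]
      · rw [r2]
        simp only [comp3_apply, Matrix.mul_apply, Finset.mul_sum, Finset.sum_mul]
    · rw [r2]
      simp only [comp3_apply, Matrix.mul_apply, Finset.mul_sum, Finset.sum_mul,
        Matrix.transpose_apply]
      exact Finset.sum_congr rfl fun _ _ ↦ Finset.sum_congr rfl fun _ _ ↦ Finset.sum_comm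
  rw [e2, hs, hm]
  simp only [comp3_add, comp3_swap₂₃, comp3_comp3, Matrix.one_mul]
  simp only [Pi.add_apply, swap₂₃]
  ring

lemma abs_one_matrix_le (i j : Fin n) : |(1 : Matrix (Fin n) (Fin n) ℝ) i j| ≤ 1 := by
  rw [Matrix.one_apply]; split <;> simp

/-- A family of coordinate expressions of almost-Hermitian structures with orthonormal frames. -/
structure OrthonormalFamily {ι : Type*}
    (g J : ι → EuclideanSpace ℝ (Fin n) → Matrix (Fin n) (Fin n) ℝ) (p : ι → FrameSpace n) :
    Prop where
  almostHermitian : ∀ l, AlmostHermitianAt (g l) (J l) (p l).1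
  orthonormal : ∀ l, metricLift (g l) (p l) = 1

namespace OrthonormalFamily

variable {ι : Type*} {g J : ι → EuclideanSpace ℝ (Fin n) → Matrix (Fin n) (Fin n) ℝ}
  {p : ι → FrameSpace n} (h : OrthonormalFamily g J p)
  {Γ : ι → EuclideanSpace ℝ (Fin n) → Fin n → Fin n → Fin n → ℝ} {N : ℕ}
include h

lemma frame_det (l : ι) : (frame (p l)).det ≠ 0 := by
  intro h0
  have := congrArg Matrix.det (h.orthonormal l)
  simp [metricLift, h0] at this

lemma contDiffAt_metricLift (l : ι) (b c : Fin n) :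
    ContDiffAt ℝ ∞ (fun q ↦ metricLift (g l) q b c) (p l) := by
  simp only [metricLift, Matrix.mul_apply, Matrix.transpose_apply]
  exact ContDiffAt.sum fun i _ ↦ (ContDiffAt.sum fun j _ ↦ (contDiffAt_frame _ _).mul
    (((h.almostHermitian l).smooth_g _ _).comp _ contDiffAt_fst)).mul (contDiffAt_frame _ _)

lemma contDiffAt_cometricLift (l : ι) (b c : Fin n) :
    ContDiffAt ℝ ∞ (fun q ↦ cometricLift (g l) q b c) (p l) := by
  simp only [cometricLift, Matrix.mul_apply, Matrix.transpose_apply]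
  exact ContDiffAt.sum fun i _ ↦ (ContDiffAt.sum fun j _ ↦
    (contDiffAt_coframe (h.frame_det l) _ _).mul
    (((h.almostHermitian l).smooth_inv _ _).comp _ contDiffAt_fst)).mul
    (contDiffAt_coframe (h.frame_det l) _ _)

lemma eventually_near (l : ι) :
    ∀ᶠ q in 𝓝 (p l), AlmostHermitianNear (g l) (J l) q.1 :=
  continuous_fst.continuousAt.eventually (h.almostHermitian l).eventually_near

lemma eventually_cometric_mul (l : ι) :
    ∀ᶠ q in 𝓝 (p l), cometricLift (g l) q * metricLift (g l) q = 1 := by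
  filter_upwards [h.eventually_near l, eventually_frame_det (h.frame_det l)] with q h1 h2
  have hT : (coframe q).transpose * (frame q).transpose = 1 := by
    rw [← Matrix.transpose_mul, frame_mul_coframe h2, Matrix.transpose_one]
  calc cometricLift (g l) q * metricLift (g l) q
      = coframe q * ((g l q.1)⁻¹ * ((coframe q).transpose * (frame q).transpose) * g l q.1) *
        frame q := by simp only [cometricLift, metricLift, Matrix.mul_assoc]
    _ = 1 := by rw [hT, Matrix.mul_one, h1.inv_mul, Matrix.mul_one, coframe_mul_frame h2]

lemma horDeriv_metricLift_eventuallyEq (hm : ∀ l, ∀ᶠ y in 𝓝 (p l).1, IsMetric (Γ l) (g l) y)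
    (l : ι) (a b c : Fin n) :
    horDeriv (Γ l) a (fun q ↦ metricLift (g l) q b c) =ᶠ[𝓝 (p l)] fun _ ↦ 0 := by
  filter_upwards [h.eventually_near l, continuous_fst.continuousAt.eventually (hm l)] with q h1 h2
  exact horDeriv_metricLift h1.diff_g h1.g_symm h2 a b c

/-- The Gram matrix is the identity at the chosen frame only, but its horizontal derivatives vanish
at all nearby frames; this gives bounds to every order. -/
lemma bddToMat_metricLift (hm : ∀ l, ∀ᶠ y in 𝓝 (p l).1, IsMetric (Γ l) (g l) y) :
    BddToMat Γ p N (fun l ↦ metricLift (g l)) := by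
  intro b c
  refine BddTo.of_parallel ⟨fun l ↦ h.contDiffAt_metricLift l b c, 1, fun l ↦ ?_⟩
    fun l a ↦ h.horDeriv_metricLift_eventuallyEq hm l a b c
  change |metricLift (g l) (p l) b c| ≤ 1
  rw [h.orthonormal]
  exact abs_one_matrix_le b c

lemma bddToMat_cometricLift (hm : ∀ l, ∀ᶠ y in 𝓝 (p l).1, IsMetric (Γ l) (g l) y) :
    BddToMat Γ p N (fun l ↦ cometricLift (g l)) := by
  intro b c
  refine BddTo.of_parallel ⟨fun l ↦ h.contDiffAt_cometricLift l b c, 1, fun l ↦ ?_⟩ fun l a ↦ ?_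
  · have := (h.eventually_cometric_mul l).self_of_nhds
    rw [h.orthonormal, Matrix.mul_one] at this
    change |cometricLift (g l) (p l) b c| ≤ 1
    rw [this]
    exact abs_one_matrix_le b c
  · have e1 : ∀ᶠ q in 𝓝 (p l), ∀ i j,
        horDeriv (Γ l) a (fun q ↦ metricLift (g l) q i j) q = 0 :=
      Filter.eventually_all.2 fun i ↦ Filter.eventually_all.2 fun j ↦
        h.horDeriv_metricLift_eventuallyEq hm l a i j
    filter_upwards [Filter.eventually_all.2 fun i ↦ Filter.eventually_all.2 fun j ↦
      (h.contDiffAt_metricLift l i j).eventually_differentiableAt,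
      Filter.eventually_all.2 fun i ↦ Filter.eventually_all.2 fun j ↦
      (h.contDiffAt_cometricLift l i j).eventually_differentiableAt,
      (h.eventually_cometric_mul l).eventually_nhds, e1] with q h1 h2 h3 h4
    rw [horDeriv_matrix_inverse (Γ l) a h1 h2 h3]
    simp [h4]

/-- In an orthonormal frame compatibility makes the matrix of J orthogonal, so its columns are unit
vectors. -/
lemma abs_endLift_le (l : ι) (b c : Fin n) : |endLift (J l) (p l) b c| ≤ 1 := by
  have hdet := h.frame_det l
  have h1 := (h.almostHermitian l).compat.self_of_nhds
  have h2 : (endLift (J l) (p l)).transpose * endLift (J l) (p l) = 1 := by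
    have hT : (coframe (p l)).transpose * (frame (p l)).transpose = 1 := by
      rw [← Matrix.transpose_mul, frame_mul_coframe hdet, Matrix.transpose_one]
    calc (endLift (J l) (p l)).transpose * endLift (J l) (p l)
        = (endLift (J l) (p l)).transpose * metricLift (g l) (p l) * endLift (J l) (p l) := by
          rw [h.orthonormal, Matrix.mul_one]
      _ = (frame (p l)).transpose * (J l (p l).1).transpose * ((coframe (p l)).transpose *
            (frame (p l)).transpose) * g l (p l).1 * (frame (p l) * coframe (p l)) *
            J l (p l).1 * frame (p l) := by
          simp only [endLift, metricLift, Matrix.mul_assoc, Matrix.transpose_mul]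
      _ = (frame (p l)).transpose * ((J l (p l).1).transpose * g l (p l).1 * J l (p l).1) *
            frame (p l) := by
          rw [hT, frame_mul_coframe hdet, Matrix.mul_one, Matrix.mul_one]
          simp only [Matrix.mul_assoc]
      _ = 1 := by rw [h1]; exact h.orthonormal l
  have h3 : ∑ i, endLift (J l) (p l) i c ^ 2 = 1 := by
    have := congrFun (congrFun h2 c) c
    rw [Matrix.mul_apply, Matrix.one_apply_eq] at this
    simpa only [Matrix.transpose_apply, sq] using this
  rw [← sq_le_one_iff_abs_le_one, ← h3]
  exact Finset.single_le_sum (f := fun i ↦ endLift (J l) (p l) i c ^ 2)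
    (fun _ _ ↦ sq_nonneg _) (Finset.mem_univ b)

lemma bddTo_end_zero : LiftBdd (r := 1) Γ p 0 (fun l y I c ↦ J l y c (I 0)) := by
  intro I c
  refine ⟨fun l ↦ (h.almostHermitian l).smoothAt_end.contDiffAt_lift (h.frame_det l) I c, 1,
    fun l ↦ ?_⟩
  simp only [lift_end]
  exact h.abs_endLift_le l _ _

/-- The difference of the Gauduchon and the Levi-Civita connections is bounded in terms of the
covariant derivatives of `J`. -/
lemma bddTo₃_gauduchonDiff_of_end (t : ℝ)
    (hJ : LiftBdd (r := 1) (fun l ↦ leviCivita (g l)) p (N + 1) (fun l y I c ↦ J l y c (I 0))) :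
    BddTo₃ (fun l ↦ leviCivita (g l)) p N (fun l ↦ lift₃ (gauduchonDiff t (g l) (J l))) := by
  have hm : ∀ l, ∀ᶠ y in 𝓝 (p l).1, IsMetric (leviCivita (g l)) (g l) y := fun l ↦
    (h.almostHermitian l).eventually_near.mono fun y hy ↦ hy.leviCivita_isMetric
  have h1 : BddToMat (fun l ↦ leviCivita (g l)) p N (fun l ↦ endLift (J l)) := fun b c ↦ by
    simpa only [lift_end] using hJ.mono N.le_succ (fun _ ↦ c) b
  have h2 := hJ.covDeriv h.frame_det fun l ↦ (h.almostHermitian l).smoothAt_end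
  simp only [covDeriv_end] at h2
  -- The formula is evaluated on frame components and its last index raised by the inverse Gram
  -- matrix. By `gauduchonArray_frame` the result is the frame components of the difference tensor.
  -- One order is lost in passing from J to its derivative.
  have h3 := ((liftBdd_ofArray.1 h2).gauduchonArray t (h.bddToMat_metricLift hm) h1).comp3
    BddToMat.one BddToMat.one (h.bddToMat_cometricLift hm)
  refine h3.congr fun l ↦ ?_
  filter_upwards [h.eventually_near l, eventually_frame_det (h.frame_det l)] with q hq hq'
  simp only [lift₃, metricLift, endLift, cometricLift, gauduchonDiff]
  rw [gauduchonArray_frame t _ _ _ _ _ (frame_mul_coframe hq'), hq.gauduchonTerm_eq_array]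
  simp only [comp3_comp3, Matrix.one_mul, Matrix.mul_one]
  rw [← Matrix.mul_assoc, ← Matrix.mul_assoc, frame_mul_coframe hq', Matrix.one_mul, hq.inv_symm]

/-- The difference of the Gauduchon and the Levi-Civita connections is bounded in terms of the
torsion of the Gauduchon connection. -/
lemma bddTo₃_gauduchonDiff_of_torsion (t : ℝ)
    (hT : LiftBdd (fun l ↦ gauduchon t (g l) (J l)) p N
      (fun l ↦ torsion (gauduchon t (g l) (J l)))) :
    BddTo₃ (fun l ↦ gauduchon t (g l) (J l)) p N
      (fun l ↦ lift₃ (gauduchonDiff t (g l) (J l))) := by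
  have hm : ∀ l, ∀ᶠ y in 𝓝 (p l).1, IsMetric (gauduchon t (g l) (J l)) (g l) y := fun l ↦
    (h.almostHermitian l).eventually_near.mono fun y hy ↦ hy.gauduchon_isMetric t
  have hT' : BddTo₃ (fun l ↦ gauduchon t (g l) (J l)) p N (fun l ↦ lift₃ (fun y a b c ↦
      gauduchon t (g l) (J l) y a b c - gauduchon t (g l) (J l) y b a c)) :=
    liftBdd_ofArray.1 hT
  have h1 := hT'.comp3 BddToMat.one BddToMat.one (h.bddToMat_metricLift hm)
  have h2 := (((h1.sub h1.rot).add h1.rot.rot).smul (1 / 2)).comp3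
    BddToMat.one BddToMat.one (h.bddToMat_cometricLift hm)
  refine h2.congr fun l ↦ ?_
  filter_upwards [h.eventually_near l, eventually_frame_det (h.frame_det l)] with q hq hq'
  have hT : (coframe q).transpose * (frame q).transpose = 1 := by
    rw [← Matrix.transpose_mul, frame_mul_coframe hq', Matrix.transpose_one]
  have hc : ∀ X, (coframe q).transpose * ((frame q).transpose * X) = X := fun X ↦ by
    rw [← Matrix.mul_assoc, hT, Matrix.one_mul]
  have hc' : ∀ X, frame q * (coframe q * X) = X := fun X ↦ by
    rw [← Matrix.mul_assoc, frame_mul_coframe hq', Matrix.one_mul]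
  simp only [lift₃, metricLift, cometricLift, gauduchonDiff, hq.gauduchonTerm_eq_contorsion t]
  simp only [comp3_smul, comp3_add, comp3_sub, comp3_rot, comp3_comp3, Matrix.one_mul,
    Matrix.mul_one, Matrix.mul_assoc, hc, hc', hq.inv_symm]

end OrthonormalFamily

end AlmostHermitian

/-! ### The two implications for families, and uniform constants. -/

section AlmostHermitian

variable {n r : ℕ}

lemma exists_sum_bound {ι κ : Type*} (s : Finset κ) {F : κ → ι → ℝ}
    (h : ∀ i ∈ s, ∃ C, ∀ l, F i l ≤ C) : ∃ C, ∀ l, ∑ i ∈ s, F i l ≤ C := by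
  choose! C hC using h
  exact ⟨∑ i ∈ s, C i, fun l ↦ Finset.sum_le_sum fun i hi ↦ hC i hi l⟩

namespace OrthonormalFamily

variable {ι : Type*} {g J : ι → EuclideanSpace ℝ (Fin n) → Matrix (Fin n) (Fin n) ℝ}
  {p : ι → FrameSpace n} (h : OrthonormalFamily g J p)
  {Γ : ι → EuclideanSpace ℝ (Fin n) → Fin n → Fin n → Fin n → ℝ} {N : ℕ}
  {S : ι → EuclideanSpace ℝ (Fin n) → (Fin r → Fin n) → Fin n → ℝ}
include h

lemma exists_tensorNorm_le (hS : LiftBdd Γ p N S) :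
    ∃ C, ∀ l, tensorNorm (g l (p l).1) (S l (p l).1) ≤ C := by
  obtain ⟨C, hC⟩ := exists_sum_bound (ι := ι) Finset.univ
    (F := fun I l ↦ ∑ c, |lift (S l) (p l) I c|) fun I _ ↦
      exists_sum_bound Finset.univ (F := fun c l ↦ |lift (S l) (p l) I c|) fun c _ ↦
        (hS I c).bound
  exact ⟨C, fun l ↦ (tensorNorm_le (frame_mul_coframe (h.frame_det l)) (h.orthonormal l) _).trans
    (hC l)⟩

lemma liftBdd_of_tensorNorm_le (hΓ : ∀ l, SmoothAt₃ (Γ l) (p l).1)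
    (hS : ∀ l, SmoothAt (S l) (p l).1)
    (H : ∀ j ≤ N, ∃ C, ∀ l,
      tensorNorm (g l (p l).1) (iterCovDeriv (Γ l) (S l) j (p l).1) ≤ C) :
    LiftBdd Γ p N S :=
  LiftBdd.of_iterCovDeriv h.frame_det hΓ hS fun j hj ↦ (H j hj).imp fun _ hC l I c ↦
    (abs_frameComp_le (frame_mul_coframe (h.frame_det l)) (h.orthonormal l) _ I c).trans (hC l)

/-- Bounds for the curvature of the Levi-Civita connection and the derivatives of `J` give bounds
for the curvature and the torsion of the Gauduchon connection. -/
lemma gauduchon_bounds (t : ℝ) (k : ℕ)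
    (hR : ∀ i ≤ k, ∃ C, ∀ l, tensorNorm (g l (p l).1)
      (iterCovDeriv (leviCivita (g l)) (curvature (leviCivita (g l))) i (p l).1) ≤ C)
    (hJ : ∀ j ∈ Finset.Icc 1 (k + 2), ∃ C, ∀ l, tensorNorm (g l (p l).1)
      (iterCovDeriv (r := 1) (leviCivita (g l)) (fun y I c ↦ J l y c (I 0)) j (p l).1) ≤ C) :
    (∀ i ≤ k, ∃ C, ∀ l, tensorNorm (g l (p l).1) (iterCovDeriv (gauduchon t (g l) (J l))
      (curvature (gauduchon t (g l) (J l))) i (p l).1) ≤ C) ∧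
    (∀ j ≤ k + 1, ∃ C, ∀ l, tensorNorm (g l (p l).1) (iterCovDeriv (gauduchon t (g l) (J l))
      (torsion (gauduchon t (g l) (J l))) j (p l).1) ≤ C) := by
  have hD : ∀ l, SmoothAt₃ (leviCivita (g l)) (p l).1 := fun l ↦
    (h.almostHermitian l).smoothAt_leviCivita
  have hA : ∀ l, SmoothAt₃ (gauduchonDiff t (g l) (J l)) (p l).1 := fun l ↦
    (h.almostHermitian l).smoothAt_gauduchonDiff t
  have bR : LiftBdd (fun l ↦ leviCivita (g l)) p k (fun l ↦ curvature (leviCivita (g l))) :=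
    h.liftBdd_of_tensorNorm_le hD (fun l ↦ (hD l).curvature) hR
  have bJ : LiftBdd (r := 1) (fun l ↦ leviCivita (g l)) p (k + 2)
      (fun l y I c ↦ J l y c (I 0)) := by
    refine h.liftBdd_of_tensorNorm_le hD (fun l ↦ (h.almostHermitian l).smoothAt_end)
      fun j hj ↦ ?_
    -- The sum in the hypothesis starts at j = 1; for j = 0 the bound is automatic because J is
    -- orthogonal.
    rcases Nat.eq_zero_or_pos j with rfl | hj'
    · exact h.exists_tensorNorm_le (h.bddTo_end_zero (Γ := fun l ↦ leviCivita (g l)))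
    · exact hJ j (Finset.mem_Icc.2 ⟨hj', hj⟩)
  have bA := h.bddTo₃_gauduchonDiff_of_end t bJ
  have bT : LiftBdd (fun l ↦ leviCivita (g l)) p (k + 1) (fun l ↦ torsion (leviCivita (g l))) := by
    intro I c
    refine BddTo.of_const (c := 0) (C := 0) (by simp) fun l ↦ ?_
    filter_upwards [h.eventually_near l] with q hq
    have : torsion (leviCivita (g l)) q.1 = fun _ _ ↦ 0 := by
      funext I c
      have := congrFun (congrFun (congrFun hq.swap₁₂_leviCivita (I 0)) (I 1)) c
      simp only [swap₁₂] at this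
      simp [torsion, this]
    simp [lift, frameComp, this]
  have bΩ := LiftBdd.curvature_add h.frame_det hD hA bA (bT.mono k.le_succ) bR
  have bΘ := LiftBdd.torsion_add bA bT
  have sG : ∀ l, SmoothAt₃ (leviCivita (g l) + gauduchonDiff t (g l) (J l)) (p l).1 := fun l ↦
    (hD l).add (hA l)
  simp only [gauduchon_eq]
  refine ⟨fun i hi ↦ ?_, fun j hj ↦ ?_⟩
  · exact h.exists_tensorNorm_le (LiftBdd.iterCovDeriv_add h.frame_det hD hA
      (fun l ↦ (sG l).curvature) bA bΩ (by omega) i (k - i) (by omega))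
  · exact h.exists_tensorNorm_le (LiftBdd.iterCovDeriv_add h.frame_det hD hA
      (fun l ↦ (sG l).torsion) bA bΘ (by omega) j (k + 1 - j) (by omega))

/-- Bounds for the curvature and the torsion of the Gauduchon connection give bounds for the
curvature of the Levi-Civita connection and the derivatives of `J`. -/
lemma leviCivita_bounds (t : ℝ) (k : ℕ)
    (hR : ∀ i ≤ k, ∃ C, ∀ l, tensorNorm (g l (p l).1) (iterCovDeriv (gauduchon t (g l) (J l))
      (curvature (gauduchon t (g l) (J l))) i (p l).1) ≤ C)
    (hT : ∀ j ≤ k + 1, ∃ C, ∀ l, tensorNorm (g l (p l).1) (iterCovDeriv (gauduchon t (g l) (J l))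
      (torsion (gauduchon t (g l) (J l))) j (p l).1) ≤ C) :
    (∀ i ≤ k, ∃ C, ∀ l, tensorNorm (g l (p l).1)
      (iterCovDeriv (leviCivita (g l)) (curvature (leviCivita (g l))) i (p l).1) ≤ C) ∧
    (∀ j ≤ k + 2, ∃ C, ∀ l, tensorNorm (g l (p l).1)
      (iterCovDeriv (r := 1) (leviCivita (g l)) (fun y I c ↦ J l y c (I 0)) j (p l).1) ≤ C) := by
  have hG : ∀ l, SmoothAt₃ (gauduchon t (g l) (J l)) (p l).1 := fun l ↦
    (h.almostHermitian l).smoothAt_gauduchon t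
  have hA : ∀ l, SmoothAt₃ (-gauduchonDiff t (g l) (J l)) (p l).1 := fun l ↦
    ((h.almostHermitian l).smoothAt_gauduchonDiff t).neg
  have bR : LiftBdd (fun l ↦ gauduchon t (g l) (J l)) p k
      (fun l ↦ curvature (gauduchon t (g l) (J l))) :=
    h.liftBdd_of_tensorNorm_le hG (fun l ↦ (hG l).curvature) hR
  have bT : LiftBdd (fun l ↦ gauduchon t (g l) (J l)) p (k + 1)
      (fun l ↦ torsion (gauduchon t (g l) (J l))) :=
    h.liftBdd_of_tensorNorm_le hG (fun l ↦ (hG l).torsion) hT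
  have bA : BddTo₃ (fun l ↦ gauduchon t (g l) (J l)) p (k + 1)
      (fun l ↦ lift₃ (-gauduchonDiff t (g l) (J l))) := by
    have := (h.bddTo₃_gauduchonDiff_of_torsion t bT).neg
    refine this.congr fun l ↦ Filter.EventuallyEq.of_eq (funext fun q ↦ ?_)
    simp only [lift₃, Pi.neg_apply, comp3_neg]
  -- J is parallel for the Gauduchon connection and bounded in orthonormal frames, so it is bounded
  -- to every order without using the hypotheses.
  have bJ : LiftBdd (r := 1) (fun l ↦ gauduchon t (g l) (J l)) p (k + 2)
      (fun l y I c ↦ J l y c (I 0)) := by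
    intro I c
    refine BddTo.of_parallel (h.bddTo_end_zero I c) fun l a ↦ ?_
    refine (horDeriv_lift_eventuallyEq _ (h.frame_det l) (h.almostHermitian l).smoothAt_end
      a I c).trans ?_
    filter_upwards [h.eventually_near l] with q hq
    simp [covDeriv_end, lift_ofArray, lift₃, hq.covDerivEnd_gauduchon t, comp3_apply]
  -- The roles are exchanged: the Gauduchon connection is the base, and the Levi-Civita connection
  -- is its perturbation by minus the difference tensor.
  have e : ∀ l, leviCivita (g l) = gauduchon t (g l) (J l) + -gauduchonDiff t (g l) (J l) :=
    fun l ↦ by rw [gauduchon_eq, add_neg_cancel_right]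
  have bΩ := LiftBdd.curvature_add h.frame_det hG hA bA (bT.mono k.le_succ) bR
  have sD : ∀ l, SmoothAt₃ (gauduchon t (g l) (J l) + -gauduchonDiff t (g l) (J l)) (p l).1 :=
    fun l ↦ (hG l).add (hA l)
  simp only [e]
  refine ⟨fun i hi ↦ ?_, fun j hj ↦ ?_⟩
  · exact h.exists_tensorNorm_le (LiftBdd.iterCovDeriv_add h.frame_det hG hA
      (fun l ↦ (sD l).curvature) bA bΩ (by omega) i (k - i) (by omega))
  -- The order condition is sharp here: k + 2 derivatives of J need exactly k + 1 derivatives of the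
  -- difference tensor.
  · exact h.exists_tensorNorm_le (LiftBdd.iterCovDeriv_add h.frame_det hG hA
      (fun l ↦ (h.almostHermitian l).smoothAt_end) bA bJ (by omega) j (k + 2 - j) (by omega))

end OrthonormalFamily

lemma exists_frameSpace_point {g J : EuclideanSpace ℝ (Fin n) → Matrix (Fin n) (Fin n) ℝ}
    {y : EuclideanSpace ℝ (Fin n)} (h : AlmostHermitianAt g J y) :
    ∃ q : FrameSpace n, q.1 = y ∧ metricLift g q = 1 := by
  obtain ⟨P, -, hP⟩ := exists_orthonormal_frame h.posDef
  exact ⟨(y, P), rfl, hP⟩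

/-- Uniform implications between bounds at a point of almost-Hermitian structures in coordinates:
it suffices to treat families with orthonormal frames. -/
lemma exists_uniform_bound {F G : (EuclideanSpace ℝ (Fin n) → Matrix (Fin n) (Fin n) ℝ) →
      (EuclideanSpace ℝ (Fin n) → Matrix (Fin n) (Fin n) ℝ) → EuclideanSpace ℝ (Fin n) → ℝ}
    (K : ℝ)
    (H : ∀ {ι : Type} {g J : ι → EuclideanSpace ℝ (Fin n) → Matrix (Fin n) (Fin n) ℝ}
      {p : ι → FrameSpace n}, OrthonormalFamily g J p → (∀ l, F (g l) (J l) (p l).1 < K) →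
      ∃ C, ∀ l, G (g l) (J l) (p l).1 ≤ C) :
    ∃ C, 0 < C ∧ ∀ g J y, AlmostHermitianAt g J y → F g J y < K → G g J y < C := by
  -- The universal family contains every admissible coordinate structure with an orthonormal frame,
  -- so its bound depends only on the dimension and on F, G and K. As it consists of coordinate
  -- data, it lives in `Type`, whatever the universe of the manifolds.
  let ι := {d : (EuclideanSpace ℝ (Fin n) → Matrix (Fin n) (Fin n) ℝ) ×
    (EuclideanSpace ℝ (Fin n) → Matrix (Fin n) (Fin n) ℝ) × FrameSpace n //
      AlmostHermitianAt d.1 d.2.1 d.2.2.1 ∧ metricLift d.1 d.2.2 = 1 ∧ F d.1 d.2.1 d.2.2.1 < K}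
  obtain ⟨C, hC⟩ := H (ι := ι) (g := fun l ↦ l.1.1) (J := fun l ↦ l.1.2.1) (p := fun l ↦ l.1.2.2)
    ⟨fun l ↦ l.2.1, fun l ↦ l.2.2.1⟩ fun l ↦ l.2.2.2
  -- This choice makes the constant positive and the inequality strict.
  refine ⟨|C| + 1, by positivity, fun g J y h hF ↦ ?_⟩
  obtain ⟨q, rfl, hq⟩ := exists_frameSpace_point h
  have := hC ⟨(g, J, q), h, hq, hF⟩
  exact (this.trans (le_abs_self C)).trans_lt (lt_add_one _)

/-- If a sum of two finite sums of nonnegative terms is bounded, so is each term. -/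
lemma le_of_sum_add_sum_lt {κ κ' : Type*} {s : Finset κ} {s' : Finset κ'} {f : κ → ℝ} {f' : κ' → ℝ}
    {K : ℝ} (hf : ∀ i, 0 ≤ f i) (hf' : ∀ i, 0 ≤ f' i)
    (h : ∑ i ∈ s, f i + ∑ i ∈ s', f' i < K) :
    (∀ i ∈ s, f i ≤ K) ∧ (∀ i ∈ s', f' i ≤ K) := by
  have h1 : 0 ≤ ∑ i ∈ s, f i := Finset.sum_nonneg fun i _ ↦ hf i
  have h2 : 0 ≤ ∑ i ∈ s', f' i := Finset.sum_nonneg fun i _ ↦ hf' i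
  refine ⟨fun i hi ↦ ?_, fun i hi ↦ ?_⟩
  · linarith [Finset.single_le_sum (fun i _ ↦ hf i) hi]
  · linarith [Finset.single_le_sum (fun i _ ↦ hf' i) hi]

theorem exists_leviCivita_bound (n k : ℕ) (t K : ℝ) : ∃ C, 0 < C ∧
    ∀ (g J : EuclideanSpace ℝ (Fin n) → Matrix (Fin n) (Fin n) ℝ) y, AlmostHermitianAt g J y →
    ∑ i ∈ Finset.range (k + 1), tensorNorm (g y)
        (iterCovDeriv (gauduchon t g J) (curvature (gauduchon t g J)) i y)
      + ∑ j ∈ Finset.range (k + 2), tensorNorm (g y)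
        (iterCovDeriv (gauduchon t g J) (torsion (gauduchon t g J)) j y) < K →
    ∑ i ∈ Finset.range (k + 1), tensorNorm (g y)
        (iterCovDeriv (leviCivita g) (curvature (leviCivita g)) i y)
      + ∑ j ∈ Finset.Icc 1 (k + 2), tensorNorm (g y)
        (iterCovDeriv (r := 1) (leviCivita g) (fun y I c ↦ J y c (I 0)) j y) < C := by
  refine exists_uniform_bound K fun {ι g J p} h hK ↦ ?_
  have hK' := fun l ↦ le_of_sum_add_sum_lt (fun _ ↦ tensorNorm_nonneg _ _)
    (fun _ ↦ tensorNorm_nonneg _ _) (hK l)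
  obtain ⟨h1, h2⟩ := h.leviCivita_bounds t k
    (fun i hi ↦ ⟨K, fun l ↦ (hK' l).1 i (Finset.mem_range.2 (by omega))⟩)
    (fun j hj ↦ ⟨K, fun l ↦ (hK' l).2 j (Finset.mem_range.2 (by omega))⟩)
  obtain ⟨C₁, hC₁⟩ := exists_sum_bound (Finset.range (k + 1)) fun i hi ↦
    h1 i (by have := Finset.mem_range.1 hi; omega)
  obtain ⟨C₂, hC₂⟩ := exists_sum_bound (Finset.Icc 1 (k + 2)) fun j hj ↦
    h2 j (Finset.mem_Icc.1 hj).2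
  exact ⟨C₁ + C₂, fun l ↦ add_le_add (hC₁ l) (hC₂ l)⟩

theorem exists_gauduchon_bound (n k : ℕ) (t K : ℝ) : ∃ C, 0 < C ∧
    ∀ (g J : EuclideanSpace ℝ (Fin n) → Matrix (Fin n) (Fin n) ℝ) y, AlmostHermitianAt g J y →
    ∑ i ∈ Finset.range (k + 1), tensorNorm (g y)
        (iterCovDeriv (leviCivita g) (curvature (leviCivita g)) i y)
      + ∑ j ∈ Finset.Icc 1 (k + 2), tensorNorm (g y)
        (iterCovDeriv (r := 1) (leviCivita g) (fun y I c ↦ J y c (I 0)) j y) < K →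
    ∑ i ∈ Finset.range (k + 1), tensorNorm (g y)
        (iterCovDeriv (gauduchon t g J) (curvature (gauduchon t g J)) i y)
      + ∑ j ∈ Finset.range (k + 2), tensorNorm (g y)
        (iterCovDeriv (gauduchon t g J) (torsion (gauduchon t g J)) j y) < C := by
  refine exists_uniform_bound K fun {ι g J p} h hK ↦ ?_
  have hK' := fun l ↦ le_of_sum_add_sum_lt (fun _ ↦ tensorNorm_nonneg _ _)
    (fun _ ↦ tensorNorm_nonneg _ _) (hK l)
  obtain ⟨h1, h2⟩ := h.gauduchon_bounds t k
    (fun i hi ↦ ⟨K, fun l ↦ (hK' l).1 i (Finset.mem_range.2 (by omega))⟩)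
    (fun j hj ↦ ⟨K, fun l ↦ (hK' l).2 j hj⟩)
  obtain ⟨C₁, hC₁⟩ := exists_sum_bound (Finset.range (k + 1)) fun i hi ↦
    h1 i (by have := Finset.mem_range.1 hi; omega)
  obtain ⟨C₂, hC₂⟩ := exists_sum_bound (Finset.range (k + 2)) fun j hj ↦
    h2 j (by have := Finset.mem_range.1 hj; omega)
  exact ⟨C₁ + C₂, fun l ↦ add_le_add (hC₁ l) (hC₂ l)⟩

end AlmostHermitian

/-! ### Almost-Hermitian structures in charts -/

section Algebra

variable {n : ℕ} {V : Type*} [TopologicalSpace V] [AddCommGroup V] [Module ℝ V]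

lemma euclidean_eq_sum (v : EuclideanSpace ℝ (Fin n)) :
    v = ∑ k, v k • (EuclideanSpace.single k 1 : EuclideanSpace ℝ (Fin n)) := by
  ext i
  simp [Pi.single_apply]

lemma clm_apply_eq_sum (L : EuclideanSpace ℝ (Fin n) →L[ℝ] V) (v : EuclideanSpace ℝ (Fin n)) :
    L v = ∑ k, v k • L (EuclideanSpace.single k 1) := by
  conv_lhs => rw [euclidean_eq_sum v]
  simp

variable (D : EuclideanSpace ℝ (Fin n) →L[ℝ] V) (D' : V →L[ℝ] EuclideanSpace ℝ (Fin n))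
  (J : V →L[ℝ] V) (B : V →L[ℝ] V →L[ℝ] ℝ)

/-- The Gram matrix of a bilinear form in the frame `D ∂ᵢ`. -/
noncomputable def gramMatrix : Matrix (Fin n) (Fin n) ℝ :=
  Matrix.of fun a b ↦ B (D (EuclideanSpace.single a 1)) (D (EuclideanSpace.single b 1))

/-- The matrix of an endomorphism in the frame `D ∂ᵢ`. -/
noncomputable def endMatrix : Matrix (Fin n) (Fin n) ℝ :=
  Matrix.of fun c b ↦ (D' (J (D (EuclideanSpace.single b 1)))) c

lemma gram_apply (v w : EuclideanSpace ℝ (Fin n)) :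
    B (D v) (D w) = ∑ a, ∑ b, v a * gramMatrix D B a b * w b := by
  rw [clm_apply_eq_sum D v, clm_apply_eq_sum D w]
  simp only [map_sum, map_smul, sum_apply, smul_apply,
    smul_eq_mul, gramMatrix, Matrix.of_apply, Finset.mul_sum]
  rw [Finset.sum_comm]
  exact Finset.sum_congr rfl fun _ _ ↦ Finset.sum_congr rfl fun _ _ ↦ by ring

lemma gramMatrix_transpose (hB : ∀ v w, B v w = B w v) :
    (gramMatrix D B).transpose = gramMatrix D B := by
  ext a b
  exact hB _ _

lemma gramMatrix_posDef (hB : ∀ v w, B v w = B w v) (hpos : ∀ v, v ≠ 0 → 0 < B v v)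
    (hD : Function.Injective D) : (gramMatrix D B).PosDef := by
  refine Matrix.PosDef.of_dotProduct_mulVec_pos ?_ fun v hv ↦ ?_
  · rw [Matrix.IsHermitian, Matrix.conjTranspose_eq_transpose_of_trivial,
      gramMatrix_transpose D B hB]
  · have h0 : D (WithLp.toLp 2 v) ≠ 0 := fun h0 ↦ hv <| by
      have := hD (h0.trans (map_zero D).symm)
      simpa using congrArg WithLp.ofLp this
    have := hpos _ h0
    rw [gram_apply] at this
    simpa [dotProduct, Matrix.mulVec, Finset.mul_sum, mul_assoc] using this

variable {D D' J B} (h : ∀ v, D (D' v) = v)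
include h

lemma endMatrix_mul_self (h' : ∀ v, D' (D v) = v) (hJ : ∀ v, J (J v) = -v) :
    endMatrix D D' J * endMatrix D D' J = -1 := by
  ext c b
  have h1 : (D' ∘L J ∘L D) (D' (J (D (EuclideanSpace.single b 1)))) =
      -EuclideanSpace.single b 1 := by
    simp [h, h', hJ]
  rw [clm_apply_eq_sum] at h1
  have h2 := congrArg (fun v : EuclideanSpace ℝ (Fin n) ↦ v c) h1
  simp only [PiLp.neg_apply, WithLp.ofLp_sum, Finset.sum_apply, PiLp.smul_apply,
    smul_eq_mul] at h2
  rw [Matrix.mul_apply]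
  simp only [endMatrix, Matrix.of_apply, Matrix.neg_apply, Matrix.one_apply]
  refine (Finset.sum_congr rfl fun _ _ ↦ mul_comm _ _).trans ?_
  refine Eq.trans ?_ (h2.trans ?_)
  · simp
  · simp

lemma endMatrix_compat (hJ : ∀ v w, B (J v) (J w) = B v w) :
    (endMatrix D D' J).transpose * gramMatrix D B * endMatrix D D' J = gramMatrix D B := by
  ext a b
  have h1 := gram_apply D B (D' (J (D (EuclideanSpace.single a 1))))
    (D' (J (D (EuclideanSpace.single b 1))))
  rw [h, h, hJ] at h1
  refine Eq.trans ?_ h1.symm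
  simp only [Matrix.mul_apply, Matrix.transpose_apply, Finset.sum_mul]
  rw [Finset.sum_comm]
  rfl

end Algebra

end TensorCalculus

/-! ### Components in a chart, and the theorem on manifolds. -/

namespace AlmostHermitianStructure

open TensorCalculus

variable {m : ℕ} {M : Type*} [TopologicalSpace M]
  [ChartedSpace (EuclideanSpace ℝ (Fin (2 * m))) M] [IsManifold (𝓡 (2 * m)) ∞ M]
  {e : OpenPartialHomeomorph M (EuclideanSpace ℝ (Fin (2 * m)))}
  (he : e ∈ IsManifold.maximalAtlas (𝓡 (2 * m)) ∞ M)

include he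

lemma mdifferentiable_of_mem_maximalAtlas : e.MDifferentiable (𝓡 (2 * m)) (𝓡 (2 * m)) :=
  ⟨(contMDiffOn_of_mem_maximalAtlas he).mdifferentiableOn (by simp),
    (contMDiffOn_symm_of_mem_maximalAtlas he).mdifferentiableOn (by simp)⟩

/-- The coordinate vector fields are smooth. -/
lemma contMDiffAt_coordVec (i : Fin (2 * m)) {y : EuclideanSpace ℝ (Fin (2 * m))}
    (hy : y ∈ e.target) :
    ContMDiffAt (𝓡 (2 * m)) ((𝓡 (2 * m)).prod 𝓘(ℝ, EuclideanSpace ℝ (Fin (2 * m)))) ∞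
      (fun z ↦ Bundle.TotalSpace.mk' (EuclideanSpace ℝ (Fin (2 * m)))
        (E := fun x : M ↦ TangentSpace (𝓡 (2 * m)) x) (e.symm z) (coordVec e i z)) y := by
  have hs : ContMDiffAt (𝓡 (2 * m)) ((𝓡 (2 * m)).prod 𝓘(ℝ, EuclideanSpace ℝ (Fin (2 * m)))) ∞
      (fun z : EuclideanSpace ℝ (Fin (2 * m)) ↦ (⟨z, EuclideanSpace.single i 1⟩ :
        TangentBundle (𝓡 (2 * m)) (EuclideanSpace ℝ (Fin (2 * m))))) y :=
    contMDiffAt_vectorSpace_iff_contDiffAt.2 contDiffAt_const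
  -- The coordinate field is the tangent map of the inverse chart applied to a constant section; on
  -- the open target the derivative within the set is the full derivative.
  have ht := (contMDiffOn_symm_of_mem_maximalAtlas he).contMDiffOn_tangentMapWithin (m := ∞)
    (by simp) e.open_target.uniqueMDiffOn
  have hc := ContMDiffAt.comp y ((ht ⟨y, EuclideanSpace.single i 1⟩ hy).contMDiffAt
    ((e.open_target.preimage (FiberBundle.continuous_proj _ _)).mem_nhds hy)) hs
  refine hc.congr_of_eventuallyEq ?_
  filter_upwards [e.open_target.mem_nhds hy] with z hz
  simp only [Function.comp, tangentMapWithin, coordVec]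
  rw [mfderivWithin_of_isOpen e.open_target hz]

lemma contDiffAt_gLoc (h : AlmostHermitianStructure m M) {y : EuclideanSpace ℝ (Fin (2 * m))}
    (hy : y ∈ e.target) (a b : Fin (2 * m)) :
    ContDiffAt ℝ ∞ (fun z ↦ h.gLoc e z a b) y := by
  have hb := (contMDiffOn_symm_of_mem_maximalAtlas he).contMDiffAt (e.open_target.mem_nhds hy)
  have : ContMDiffAt (𝓡 (2 * m)) ((𝓡 (2 * m)).prod 𝓘(ℝ)) ∞
      (fun z ↦ Bundle.TotalSpace.mk' ℝ (E := Bundle.Trivial M ℝ) (e.symm z)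
        (h.g.inner (e.symm z) (coordVec e a z) (coordVec e b z))) y := by
    apply ContMDiffAt.clm_bundle_apply₂ (F₁ := EuclideanSpace ℝ (Fin (2 * m)))
      (F₂ := EuclideanSpace ℝ (Fin (2 * m)))
    · exact ContMDiffAt.comp y h.g.contMDiff.contMDiffAt hb
    · exact contMDiffAt_coordVec he a hy
    · exact contMDiffAt_coordVec he b hy
  rw [Bundle.contMDiffAt_totalSpace] at this
  exact contMDiffAt_iff_contDiffAt.1 this.2

lemma contDiffAt_JLoc (h : AlmostHermitianStructure m M) {y : EuclideanSpace ℝ (Fin (2 * m))}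
    (hy : y ∈ e.target) (c b : Fin (2 * m)) :
    ContDiffAt ℝ ∞ (fun z ↦ h.JLoc e z c b) y := by
  have hb := (contMDiffOn_symm_of_mem_maximalAtlas he).contMDiffAt (e.open_target.mem_nhds hy)
  have hJ : ContMDiffAt (𝓡 (2 * m))
      ((𝓡 (2 * m)).prod 𝓘(ℝ, EuclideanSpace ℝ (Fin (2 * m)))) ∞
      (fun z ↦ Bundle.TotalSpace.mk' (EuclideanSpace ℝ (Fin (2 * m)))
        (E := fun x : M ↦ TangentSpace (𝓡 (2 * m)) x) (e.symm z)
        (h.J (e.symm z) (coordVec e b z))) y := by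
    apply ContMDiffAt.clm_bundle_apply (F₁ := EuclideanSpace ℝ (Fin (2 * m)))
    · exact ContMDiffAt.comp y h.contMDiff_J.contMDiffAt hb
    · exact contMDiffAt_coordVec he b hy
  have ht := (contMDiffOn_of_mem_maximalAtlas he).contMDiffOn_tangentMapWithin (m := ∞)
    (by simp) e.open_source.uniqueMDiffOn
  have hc := ContMDiffAt.comp y
    ((ht ⟨e.symm y, h.J (e.symm y) (coordVec e b y)⟩ (e.map_target hy)).contMDiffAt
      ((e.open_source.preimage (FiberBundle.continuous_proj _ _)).mem_nhds (e.map_target hy))) hJ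
  have key : ContMDiffAt (𝓡 (2 * m))
      ((𝓡 (2 * m)).prod 𝓘(ℝ, EuclideanSpace ℝ (Fin (2 * m)))) ∞
      (fun z : EuclideanSpace ℝ (Fin (2 * m)) ↦
        (⟨z, mfderiv (𝓡 (2 * m)) (𝓡 (2 * m)) e (e.symm z) (h.J (e.symm z) (coordVec e b z))⟩ :
          TangentBundle (𝓡 (2 * m)) (EuclideanSpace ℝ (Fin (2 * m))))) y := by
    refine hc.congr_of_eventuallyEq ?_
    -- The tangent map lands over e (e.symm z), which equals z only on the target; the vector
    -- component is unchanged when the base point is replaced.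
    have aux : ∀ (u v w : EuclideanSpace ℝ (Fin (2 * m))), u = v →
        (⟨u, w⟩ : TangentBundle (𝓡 (2 * m)) (EuclideanSpace ℝ (Fin (2 * m)))) = ⟨v, w⟩ := by
      rintro u v w rfl; rfl
    filter_upwards [e.open_target.mem_nhds hy] with z hz
    simp only [Function.comp, tangentMapWithin]
    rw [mfderivWithin_of_isOpen e.open_source (e.map_target hz)]
    exact aux _ _ _ (e.right_inv hz).symm
  have := contMDiffAt_vectorSpace_iff_contDiffAt.1 key
  exact (contDiffAt_euclidean.1 this) c

/-- The components of an almost-Hermitian structure in a chart. -/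
lemma almostHermitianAt (h : AlmostHermitianStructure m M) {x : M} (hx : x ∈ e.source) :
    AlmostHermitianAt (h.gLoc e) (h.JLoc e) (e x) := by
  have hy := e.map_source hx
  have hd := mdifferentiable_of_mem_maximalAtlas he
  -- The differentials of the chart and of its inverse are mutually inverse, so the pointwise
  -- relations for g and J become matrix relations.
  have h1 : ∀ z ∈ e.target, ∀ v, mfderiv (𝓡 (2 * m)) (𝓡 (2 * m)) e.symm z
      (mfderiv (𝓡 (2 * m)) (𝓡 (2 * m)) e (e.symm z) v) = v := by
    intro z hz v
    have := DFunLike.congr_fun (hd.symm_comp_deriv (e.map_target hz)) v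
    rw [e.right_inv hz] at this
    exact this
  have h2 : ∀ z ∈ e.target, ∀ v, mfderiv (𝓡 (2 * m)) (𝓡 (2 * m)) e (e.symm z)
      (mfderiv (𝓡 (2 * m)) (𝓡 (2 * m)) e.symm z v) = v :=
    fun z hz v ↦ DFunLike.congr_fun (hd.comp_symm_deriv hz) v
  refine ⟨contDiffAt_gLoc he h hy, contDiffAt_JLoc he h hy, ?_, ?_, ?_, ?_⟩
  · refine Filter.Eventually.of_forall fun z ↦ ?_
    ext a b
    exact h.g.symm _ _ _
  · exact gramMatrix_posDef (mfderiv (𝓡 (2 * m)) (𝓡 (2 * m)) e.symm (e x))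
      (h.g.inner (e.symm (e x))) (h.g.symm _) (h.g.pos _)
      (Function.LeftInverse.injective (h2 _ hy))
  · filter_upwards [e.open_target.mem_nhds hy] with z hz
    exact endMatrix_mul_self (D := mfderiv (𝓡 (2 * m)) (𝓡 (2 * m)) e.symm z)
      (D' := mfderiv (𝓡 (2 * m)) (𝓡 (2 * m)) e (e.symm z)) (h1 z hz) (h2 z hz) (h.J_sq _)
  · filter_upwards [e.open_target.mem_nhds hy] with z hz
    exact endMatrix_compat (D := mfderiv (𝓡 (2 * m)) (𝓡 (2 * m)) e.symm z)
      (D' := mfderiv (𝓡 (2 * m)) (𝓡 (2 * m)) e (e.symm z)) (h1 z hz) (h.compat _)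

end AlmostHermitianStructure

theorem mainTheorem9 (m k : ℕ) (t : ℝ) :
    (∀ K₁ : ℝ, 0 < K₁ → ∃ C₁ : ℝ, 0 < C₁ ∧
      ∀ (M : Type*) [TopologicalSpace M]
        [ChartedSpace (EuclideanSpace ℝ (Fin (2 * m))) M] [IsManifold (𝓡 (2 * m)) ∞ M]
        (h : AlmostHermitianStructure m M) (x : M)
        (e : OpenPartialHomeomorph M (EuclideanSpace ℝ (Fin (2 * m)))),
        e ∈ IsManifold.maximalAtlas (𝓡 (2 * m)) ∞ M → x ∈ e.source →
        ∑ i ∈ Finset.range (k + 1), h.normGauduchonCurv t e i x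
          + ∑ j ∈ Finset.range (k + 2), h.normGauduchonTors t e j x < K₁ →
        ∑ i ∈ Finset.range (k + 1), h.normRm e i x
          + ∑ j ∈ Finset.Icc 1 (k + 2), h.normJ e j x < C₁) ∧
    (∀ K₂ : ℝ, 0 < K₂ → ∃ C₂ : ℝ, 0 < C₂ ∧
      ∀ (M : Type*) [TopologicalSpace M]
        [ChartedSpace (EuclideanSpace ℝ (Fin (2 * m))) M] [IsManifold (𝓡 (2 * m)) ∞ M]
        (h : AlmostHermitianStructure m M) (x : M)
        (e : OpenPartialHomeomorph M (EuclideanSpace ℝ (Fin (2 * m)))),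
        e ∈ IsManifold.maximalAtlas (𝓡 (2 * m)) ∞ M → x ∈ e.source →
        ∑ i ∈ Finset.range (k + 1), h.normRm e i x
          + ∑ j ∈ Finset.Icc 1 (k + 2), h.normJ e j x < K₂ →
        ∑ i ∈ Finset.range (k + 1), h.normGauduchonCurv t e i x
          + ∑ j ∈ Finset.range (k + 2), h.normGauduchonTors t e j x < C₂) := by
  refine ⟨fun K₁ _ ↦ ?_, fun K₂ _ ↦ ?_⟩
  -- The constant is fixed before any manifold or chart is chosen; the norms at x unfold to the
  -- coordinate expressions at e x.
  · obtain ⟨C, hC, H⟩ := TensorCalculus.exists_leviCivita_bound (2 * m) k t K₁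
    exact ⟨C, hC, fun M _ _ _ h x e he hx hK ↦
      H (h.gLoc e) (h.JLoc e) (e x) (AlmostHermitianStructure.almostHermitianAt he h hx) hK⟩
  · obtain ⟨C, hC, H⟩ := TensorCalculus.exists_gauduchon_bound (2 * m) k t K₂
    exact ⟨C, hC, fun M _ _ _ h x e he hx hK ↦
      H (h.gLoc e) (h.JLoc e) (e x) (AlmostHermitianStructure.almostHermitianAt he h hx) hK⟩
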